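/- **Theorem (Exact recovery of ScalGD-VHL).** Let $n,n_1,n_2,s,r\ge 1$ with $n_1+n_2=n+1$; indices start at $0$. *Model.* Let $X_\star=\sum_{k=1}^r d_k h_k a_{\tau_k}^T\in\mathbb C^{s\times n}$ with $d_k\in\mathbb C$, $h_k\in\mathbb C^s$, $\tau_k\in\mathbb R$, $a_\tau=(1,e^{-2\pi i\tau},\dots,e^{-2\pi i\tau(n-1)})^T$. For a random matrix $B\in\mathbb C^{n\times s}$ let $b_j\in\mathbb C^s$ be the $j$-th column of $B^H$. Observed are $\sum_{k} d_k e^{-2\pi i\tau_k j}(Bh_k)_j=b_j^HX_\star e_j$, $j=0,\dots,n-1$. Let $w_i=\#\{(j,k):j+k=i,\ 0\le j<n_1,\ 0\le k<n_2\}$, and let $y\in\mathbb C^n$, $y_j=\sqrt{w_j}\,b_j^HX_\star e_j$, be the weighted observations. *Operators.* $\mathcal H(X)\in\mathbb C^{sn_1\times n_2}$ is the block matrix whose block in position $(a,k)$ is column $a+k$ of $X\in\mathbb C^{s\times n}$; $\mathcal D$ multiplies column $i$ by $\sqrt{w_i}$; $\mathcal G=\mathcal H\mathcal D^{-1}$;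 $\mathcal A(Z)_j=b_j^HZe_j$; $\mathcal G^*,\mathcal A^*$ are the adjoints with respect to $\langle Z_1,Z_2\rangle=\operatorname{trace}(Z_1^HZ_2)$. *Assumptions.* (1) $M_\star=\mathcal H(X_\star)$ has rank $r$ and compact SVD $M_\star=U_\star\Sigma_\star V_\star^H$ with singular values $\sigma_1\ge\dots\ge\sigma_r>0$, $\kappa=\sigma_1/\sigma_r$; for some $\mu_1>0$, each of the $n_1$ consecutive $s\times r$ blocks of $U_\star$ and each row of $V_\star$ has squared Frobenius norm at most $\mu_1r/n$. (2) $b_0,\dots,b_{n-1}$ are i.i.d., $\mathbb E[b_ib_i^H]=I_s$, and almost surely $\max_\ell|b_i[\ell]|^2\le\mu_0$. *Algorithm.* Let $U^0\Sigma^0(V^0)^H$ be a top-$r$ SVD of $\mathcal G\mathcal A^*(y)$, $L^0=U^0(\Sigma^0)^{1/2}$, $R^0=V^0(\Sigma^0)^{1/2}$, and, with step size $\eta>0$, $$L^{k+1}=L^k-\eta\,E^kR^k\big((R^k)^HR^k\big)^{-1},\qquad R^{k+1}=R^k-\eta\,(E^k)^HL^k\big((L^k)^HL^k\big)^{-1},$$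 where $E^k=\mathcal G\mathcal A^*\big(\mathcal A\mathcal G^*(L^k(R^k)^H)-y\big)+(\mathcal I-\mathcal G\mathcal G^*)(L^k(R^k)^H)$. Let $X^k=\mathcal D^{-1}\mathcal G^*(L^k(R^k)^H)$. *Conclusion.* There are universal constants $C,c_1,c_2>0$ such that, whenever $\eta\le\frac14$, $0<\delta_0\le\frac1{10}$ and $$n\ge C\,\delta_0^{-2}\mu_0^2\mu_1s^2r^2\kappa^2\log^2(sn),$$ with probability at least $1-c_1(sn)^{-c_2}$, for every choice of the top-$r$ SVD and for all $k\ge0$, the matrices $(L^k)^HL^k$ and $(R^k)^HR^k$ are invertible and $$\|X^k-X_\star\|_F^2\le\Big(1-\frac{\eta}{25}\Big)^k\sigma_r^2.$$ In particular the convergence rate does not depend on $\kappa$. -/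

import Mathlib

open MeasureTheory ProbabilityTheory
open scoped Matrix Matrix.Norms.Frobenius

/- All matrix norms below are Frobenius norms, the norm of the trace inner product
`⟨Z₁, Z₂⟩ = trace (Z₁ᴴ Z₂)`. Rows of an `s n₁ × n₂` block matrix are indexed by pairs
`(block number, position in the block)`, and all indices start at `0`. -/

namespace BlindSR

noncomputable section

/-! ### Signal model -/

/-- `X⋆ = ∑ₖ dₖ hₖ a_{τₖ}ᵀ` with `a_τ = (1, e^{-2πiτ}, …, e^{-2πiτ(n-1)})ᵀ`. -/
def signalMatrix {s r : ℕ} (n : ℕ) (d : Fin r → ℂ) (τ : Fin r → ℝ)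
    (h : Fin r → Fin s → ℂ) : Matrix (Fin s) (Fin n) ℂ :=
  Matrix.of fun l j =>
    ∑ k, d k * h k l * Complex.exp (-2 * Real.pi * Complex.I * (τ k : ℂ) * ((j : ℕ) : ℂ))

/-- The raw samples `yⱼ = ∑ₖ dₖ e^{-2πiτₖ j} gₖ(j)`, where `gₖ = B hₖ`. -/
def samples {n s r : ℕ} (B : Matrix (Fin n) (Fin s) ℂ) (d : Fin r → ℂ) (τ : Fin r → ℝ)
    (h : Fin r → Fin s → ℂ) : Fin n → ℂ := fun j =>
  ∑ k, d k * Complex.exp (-2 * Real.pi * Complex.I * (τ k : ℂ) * ((j : ℕ) : ℂ)) * (B *ᵥ h k) j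

/-- `bⱼ ∈ ℂˢ`, the `j`-th column of `Bᴴ`. -/
def sensingVec {n s : ℕ} (B : Matrix (Fin n) (Fin s) ℂ) (j : Fin n) : Fin s → ℂ :=
  fun l => Bᴴ l j

/-! ### Operators -/

/-- `wᵢ`, the number of pairs `(j, k)` with `j < n₁`, `k < n₂`, `j + k = i`. -/
def antidiagCard (n₁ n₂ i : ℕ) : ℕ :=
  (Finset.univ.filter fun p : Fin n₁ × Fin n₂ => (p.1 : ℕ) + (p.2 : ℕ) = i).card

/-- The inverse of the column scaling `𝒟 : zᵢ ↦ √wᵢ zᵢ`. -/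
def colUnscale {s n : ℕ} (n₁ n₂ : ℕ) (Z : Matrix (Fin s) (Fin n) ℂ) :
    Matrix (Fin s) (Fin n) ℂ :=
  Matrix.of fun l i => ((Real.sqrt (antidiagCard n₁ n₂ i) : ℝ) : ℂ)⁻¹ * Z l i

/-- The weighted measurements `D y`, `D = diag (√w₀, …, √w_{n-1})`. -/
def weighted {n : ℕ} (n₁ n₂ : ℕ) (y : Fin n → ℂ) : Fin n → ℂ :=
  fun i => ((Real.sqrt (antidiagCard n₁ n₂ i) : ℝ) : ℂ) * y i

/-- The vectorized Hankel lift `ℋ`: the block in position `(a, k)` is column `a + k` of `X`. -/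
def hankelLift {s n n₁ n₂ : ℕ} (hn : n₁ + n₂ = n + 1) (X : Matrix (Fin s) (Fin n) ℂ) :
    Matrix (Fin n₁ × Fin s) (Fin n₂) ℂ :=
  Matrix.of fun p k => X p.2 ⟨(p.1 : ℕ) + (k : ℕ), by omega⟩

/-- `𝒢 = ℋ 𝒟⁻¹`. -/
def liftG {s n n₁ n₂ : ℕ} (hn : n₁ + n₂ = n + 1) (Z : Matrix (Fin s) (Fin n) ℂ) :
    Matrix (Fin n₁ × Fin s) (Fin n₂) ℂ :=
  hankelLift hn (colUnscale n₁ n₂ Z)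

/-- `𝒢*`, the adjoint of `𝒢` (see `trace_liftGAdj`). -/
def liftGAdj {s n₁ n₂ : ℕ} (n : ℕ) (M : Matrix (Fin n₁ × Fin s) (Fin n₂) ℂ) :
    Matrix (Fin s) (Fin n) ℂ :=
  Matrix.of fun l i => ((Real.sqrt (antidiagCard n₁ n₂ i) : ℝ) : ℂ)⁻¹ *
    ∑ a : Fin n₁, ∑ k : Fin n₂, if (a : ℕ) + (k : ℕ) = (i : ℕ) then M (a, l) k else 0

/-- `𝒜(Z)ⱼ = ⟨bⱼ eⱼᵀ, Z⟩ = bⱼᴴ Z eⱼ`. -/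
def measA {n s : ℕ} (B : Matrix (Fin n) (Fin s) ℂ) (Z : Matrix (Fin s) (Fin n) ℂ) : Fin n → ℂ :=
  fun j => ∑ l, star (sensingVec B j l) * Z l j

/-- `𝒜*(y) = ∑ⱼ yⱼ bⱼ eⱼᵀ`. -/
def measAAdj {n s : ℕ} (B : Matrix (Fin n) (Fin s) ℂ) (y : Fin n → ℂ) :
    Matrix (Fin s) (Fin n) ℂ :=
  Matrix.of fun l j => y j * sensingVec B j l

/-- `⟨𝒢 Z, M⟩ = ⟨Z, 𝒢* M⟩`. -/
theorem trace_liftGAdj {s n n₁ n₂ : ℕ} (hn : n₁ + n₂ = n + 1) (Z : Matrix (Fin s) (Fin n) ℂ)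
    (M : Matrix (Fin n₁ × Fin s) (Fin n₂) ℂ) :
    ((liftG hn Z)ᴴ * M).trace = (Zᴴ * liftGAdj n M).trace := by
  have key : ∀ (a : Fin n₁) (k : Fin n₂) (l : Fin s),
      star (liftG hn Z (a, l) k) * M (a, l) k
        = ∑ i : Fin n, star (Z l i) * (((Real.sqrt (antidiagCard n₁ n₂ i) : ℝ) : ℂ)⁻¹ *
          if (a : ℕ) + (k : ℕ) = (i : ℕ) then M (a, l) k else 0) := by
    intro a k l
    rw [Finset.sum_eq_single (⟨(a : ℕ) + (k : ℕ), by omega⟩ : Fin n)]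
    · simp [liftG, hankelLift, colUnscale]
      ring
    · intro i _ hi
      rw [if_neg (fun h => hi (Fin.ext h.symm))]
      simp
    · simp
  simp only [Matrix.trace, Matrix.diag_apply, Matrix.mul_apply, Matrix.conjTranspose_apply,
    Fintype.sum_prod_type, key]
  simp only [liftGAdj, Matrix.of_apply, Finset.mul_sum]
  rw [Finset.sum_comm' (t' := Finset.univ) (s' := fun _ => Finset.univ) (by simp)]
  calc _ = ∑ a : Fin n₁, ∑ l : Fin s, ∑ k : Fin n₂, ∑ i : Fin n, star (Z l i) *
        (((Real.sqrt (antidiagCard n₁ n₂ i) : ℝ) : ℂ)⁻¹ *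
          if (a : ℕ) + (k : ℕ) = (i : ℕ) then M (a, l) k else 0) :=
        Finset.sum_congr rfl fun a _ => Finset.sum_comm
    _ = ∑ a : Fin n₁, ∑ l : Fin s, ∑ i : Fin n, ∑ k : Fin n₂, star (Z l i) *
        (((Real.sqrt (antidiagCard n₁ n₂ i) : ℝ) : ℂ)⁻¹ *
          if (a : ℕ) + (k : ℕ) = (i : ℕ) then M (a, l) k else 0) :=
        Finset.sum_congr rfl fun a _ => Finset.sum_congr rfl fun l _ => Finset.sum_comm
    _ = ∑ l : Fin s, ∑ a : Fin n₁, ∑ i : Fin n, ∑ k : Fin n₂, star (Z l i) *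
        (((Real.sqrt (antidiagCard n₁ n₂ i) : ℝ) : ℂ)⁻¹ *
          if (a : ℕ) + (k : ℕ) = (i : ℕ) then M (a, l) k else 0) := Finset.sum_comm
    _ = ∑ l : Fin s, ∑ i : Fin n, ∑ a : Fin n₁, ∑ k : Fin n₂, star (Z l i) *
        (((Real.sqrt (antidiagCard n₁ n₂ i) : ℝ) : ℂ)⁻¹ *
          if (a : ℕ) + (k : ℕ) = (i : ℕ) then M (a, l) k else 0) :=
        Finset.sum_congr rfl fun l _ => Finset.sum_comm
    _ = _ := Finset.sum_comm

/-! ### Singular value decompositions -/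

/-- `M = U Σ Vᴴ` is a singular value decomposition with `p` triples: orthonormal columns and
nonincreasing nonnegative singular values (some may be zero). -/
structure IsSVD {m n : Type*} [Fintype m] [Fintype n] {p : ℕ} (M : Matrix m n ℂ)
    (U : Matrix m (Fin p) ℂ) (σ : Fin p → ℝ) (V : Matrix n (Fin p) ℂ) : Prop where
  left_orthonormal : Uᴴ * U = 1
  right_orthonormal : Vᴴ * V = 1
  antitone : Antitone σ
  nonneg : ∀ i, 0 ≤ σ i
  eq : M = U * Matrix.diagonal (fun i => (σ i : ℂ)) * Vᴴ

/-- A compact singular value decomposition: all singular values are positive, so that their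
number `r` is the rank of `M`. -/
def IsCompactSVD {m n : Type*} [Fintype m] [Fintype n] {r : ℕ} (M : Matrix m n ℂ)
    (U : Matrix m (Fin r) ℂ) (σ : Fin r → ℝ) (V : Matrix n (Fin r) ℂ) : Prop :=
  IsSVD M U σ V ∧ ∀ i, 0 < σ i

/-- `𝒯ᵣ(M) = U Σ Vᴴ` is a top-`r` SVD of `M`: the `r` leading triples of some SVD of `M`. -/
def IsTopSVD {m n : Type*} [Fintype m] [Fintype n] {r : ℕ} (M : Matrix m n ℂ)
    (U : Matrix m (Fin r) ℂ) (σ : Fin r → ℝ) (V : Matrix n (Fin r) ℂ) : Prop :=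
  ∃ (p : ℕ) (hrp : r ≤ p) (U' : Matrix m (Fin p) ℂ) (σ' : Fin p → ℝ) (V' : Matrix n (Fin p) ℂ),
    IsSVD M U' σ' V' ∧ U = U'.submatrix id (Fin.castLE hrp) ∧ σ = σ' ∘ Fin.castLE hrp ∧
      V = V'.submatrix id (Fin.castLE hrp)

/-! ### Assumptions -/

/-- `μ₁`-incoherence of the singular vectors: every `s × r` block of `U` and every row of `V` has
squared norm at most `μ₁ r / n`. -/
def Incoherent {s n₁ n₂ r : ℕ} (n : ℕ) (μ₁ : ℝ) (U : Matrix (Fin n₁ × Fin s) (Fin r) ℂ)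
    (V : Matrix (Fin n₂) (Fin r) ℂ) : Prop :=
  (∀ a : Fin n₁, ‖U.submatrix (fun l : Fin s => (a, l)) id‖ ^ 2 ≤ μ₁ * r / n) ∧
    ∀ k : Fin n₂, ∑ c, ‖V k c‖ ^ 2 ≤ μ₁ * r / n

/-- The columns `bᵢ` of `Bᴴ` are i.i.d., isotropic, and have entries with `|bᵢ[l]|² ≤ μ₀`. -/
structure RandomSubspace {Ω : Type*} [MeasurableSpace Ω] (P : Measure Ω) {n s : ℕ}
    (B : Ω → Matrix (Fin n) (Fin s) ℂ) (μ₀ : ℝ) : Prop where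
  measurable : ∀ i, Measurable fun ω => sensingVec (B ω) i
  indep : iIndepFun (fun i ω => sensingVec (B ω) i) P
  ident : ∀ i j, IdentDistrib (fun ω => sensingVec (B ω) i) (fun ω => sensingVec (B ω) j) P P
  isotropic : ∀ (i : Fin n) (l m : Fin s),
    ∫ ω, sensingVec (B ω) i l * star (sensingVec (B ω) i m) ∂P = if l = m then 1 else 0
  bounded : ∀ i, ∀ᵐ ω ∂P, ∀ l, ‖sensingVec (B ω) i l‖ ^ 2 ≤ μ₀

/-! ### The algorithm -/

/-- `𝒢𝒜*(𝒜𝒢*(L Rᴴ) - y) + (ℐ - 𝒢𝒢*)(L Rᴴ)`. -/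
def gradCore {s n n₁ n₂ r : ℕ} (hn : n₁ + n₂ = n + 1) (B : Matrix (Fin n) (Fin s) ℂ)
    (y : Fin n → ℂ) (L : Matrix (Fin n₁ × Fin s) (Fin r) ℂ) (R : Matrix (Fin n₂) (Fin r) ℂ) :
    Matrix (Fin n₁ × Fin s) (Fin n₂) ℂ :=
  liftG hn (measAAdj B (measA B (liftGAdj n (L * Rᴴ)) - y)) +
    (L * Rᴴ - liftG hn (liftGAdj n (L * Rᴴ)))

/-- The gradient in `L` of
`f(L, R) = ½ ‖y - 𝒜𝒢*(L Rᴴ)‖² + ½ ‖(ℐ - 𝒢𝒢*)(L Rᴴ)‖²`. -/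
def gradL {s n n₁ n₂ r : ℕ} (hn : n₁ + n₂ = n + 1) (B : Matrix (Fin n) (Fin s) ℂ)
    (y : Fin n → ℂ) (L : Matrix (Fin n₁ × Fin s) (Fin r) ℂ) (R : Matrix (Fin n₂) (Fin r) ℂ) :
    Matrix (Fin n₁ × Fin s) (Fin r) ℂ :=
  gradCore hn B y L R * R

/-- The gradient in `R` of the same function. -/
def gradR {s n n₁ n₂ r : ℕ} (hn : n₁ + n₂ = n + 1) (B : Matrix (Fin n) (Fin s) ℂ)
    (y : Fin n → ℂ) (L : Matrix (Fin n₁ × Fin s) (Fin r) ℂ) (R : Matrix (Fin n₂) (Fin r) ℂ) :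
    Matrix (Fin n₂) (Fin r) ℂ :=
  (gradCore hn B y L R)ᴴ * L

/-- The iterates `(Lᵏ, Rᵏ)` of scaled gradient descent with step size `η` from `(L⁰, R⁰)`; both
factors are updated simultaneously. -/
def scaledGD {s n n₁ n₂ r : ℕ} (hn : n₁ + n₂ = n + 1) (B : Matrix (Fin n) (Fin s) ℂ)
    (y : Fin n → ℂ) (η : ℝ) (L₀ : Matrix (Fin n₁ × Fin s) (Fin r) ℂ)
    (R₀ : Matrix (Fin n₂) (Fin r) ℂ) :
    ℕ → Matrix (Fin n₁ × Fin s) (Fin r) ℂ × Matrix (Fin n₂) (Fin r) ℂ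
  | 0 => (L₀, R₀)
  | k + 1 =>
    let F := scaledGD hn B y η L₀ R₀ k
    (F.1 - (η : ℂ) • (gradL hn B y F.1 F.2 * (F.2ᴴ * F.2)⁻¹),
      F.2 - (η : ℂ) • (gradR hn B y F.1 F.2 * (F.1ᴴ * F.1)⁻¹))

/-- `X = 𝒟⁻¹𝒢*(L Rᴴ)`. -/
def estimate {s n₁ n₂ r : ℕ} (n : ℕ) (L : Matrix (Fin n₁ × Fin s) (Fin r) ℂ)
    (R : Matrix (Fin n₂) (Fin r) ℂ) : Matrix (Fin s) (Fin n) ℂ :=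
  colUnscale n₁ n₂ (liftGAdj n (L * Rᴴ))

/-- `A Σ^{1/2}` for `Σ = diag σ`. -/
def mulSqrt {m : Type*} {r : ℕ} (A : Matrix m (Fin r) ℂ) (σ : Fin r → ℝ) :
    Matrix m (Fin r) ℂ :=
  A * Matrix.diagonal (fun i => ((Real.sqrt (σ i) : ℝ) : ℂ))

end

end BlindSR

open BlindSR

/-! The argument is local linear convergence from an accurate spectral start, on an event of high
probability. Write `M = L Rᴴ`, `D = M - M⋆`, and let `P`, `Q` be the orthogonal projections onto the
column spaces of `L` and `R`.

Contraction. The preconditioners turn one step into `M ↦ M - η (P E + E Q) + η² E M⁺ E`, which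
depends on the factors only through `M`; this is why `κ` does not enter the rate. Since `M⋆` lies in
the range of `𝒢`, `E - D = 𝒢(𝒜*𝒜 - ℐ)𝒢* D`. With `E` replaced by `D`, the linear part contracts
because `(1 - P) D (1 - Q)`, the only component it misses, is quadratic in `D` (`norm_residual_le`,
`norm_sub_projections_le`). The correction `E - D` enters only through `P (E - D)` and `(E - D) Q`,
so it is tested only against directions close to the tangent space at `M⋆`, as is `D` itself. The
term with `M⁺` is small because `‖M⁺‖ ≤ 1 / (σ_r - ‖D‖)`. These combine in `scaled_step_contracts`.
Incoherence of the iterates is not tracked: off the tangent space only the crude bound `α = √(μ₀ s)`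
for `𝒜` is used, and it is absorbed by the small radius `σ_r / (200 α)` of the basin.

Near isometry on the tangent space. A tangent matrix `U Wᴴ + W' Vᴴ` is a combination of atoms `U_c
e_kᵀ` and `e_q V_cᴴ`. The entries of the form `⟨𝒜·, 𝒜·⟩ - ⟨·, ·⟩` in these atoms are sums of
independent scalars, controlled by Hoeffding's inequality and a union bound
(`RandomSubspace.measForm_tail`). A Schur test then passes from entries to the whole form
(`isoDefect_tangent_le`). Incoherence bounds the averages of the atoms over antidiagonals, and
summing `1 / w_j` costs only a logarithm, so no matrix concentration is needed.

Initialization. The error `𝒢𝒜*(y) - M⋆` is the Hankel lift of `𝒜*𝒜 X⋆ - X⋆`. Its operator norm is at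
most the largest norm of its vector-valued symbol at the `n`-th roots of unity
(`norm_hankelLift_mul_le`), and each coordinate of the symbol is handled by scalar Bernstein
(`RandomSubspace.symbol_tail`). Truncation to rank `r` costs a further factor `4 √r` in Frobenius
norm (`norm_topSVD_sub_le`). Comparing this error, proportional to `σ_1`, with the basin radius,
proportional to `σ_r`, is the only place where `κ²` is needed in the sample size. -/

namespace BlindSR

/-! ### Frobenius inner product, isometries and orthogonal projections. -/

variable {l m n k : Type*} [Fintype l] [Fintype m] [Fintype n] [Fintype k]

/-- The real part of the trace inner product. -/
noncomputable def reIP (X Y : Matrix m n ℂ) : ℝ := (Xᴴ * Y).trace.re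

theorem frob_sq (X : Matrix m n ℂ) : ‖X‖ ^ 2 = ∑ i, ∑ j, ‖X i j‖ ^ 2 := by
  rw [Matrix.frobenius_norm_def, ← Real.sqrt_eq_rpow, Real.sq_sqrt]
  · simp
  · positivity

theorem reIP_eq_sum (X Y : Matrix m n ℂ) :
    reIP X Y = (∑ i, ∑ j, star (X i j) * Y i j).re := by
  rw [reIP, Matrix.trace, Finset.sum_comm]
  simp [Matrix.mul_apply, Matrix.conjTranspose_apply]

theorem reIP_self (X : Matrix m n ℂ) : reIP X X = ‖X‖ ^ 2 := by
  rw [reIP_eq_sum, frob_sq, Complex.re_sum]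
  refine Finset.sum_congr rfl fun i _ => ?_
  rw [Complex.re_sum]
  refine Finset.sum_congr rfl fun j _ => ?_
  rw [← Complex.normSq_eq_norm_sq, Complex.normSq_apply]
  simp

theorem reIP_comm (X Y : Matrix m n ℂ) : reIP X Y = reIP Y X := by
  have : Yᴴ * X = (Xᴴ * Y)ᴴ := by simp
  rw [reIP, reIP, this, Matrix.trace_conjTranspose]
  simp

theorem reIP_add_left (X Y Z : Matrix m n ℂ) : reIP (X + Y) Z = reIP X Z + reIP Y Z := by
  simp [reIP, Matrix.add_mul]

theorem reIP_add_right (X Y Z : Matrix m n ℂ) : reIP X (Y + Z) = reIP X Y + reIP X Z := by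
  simp [reIP, Matrix.mul_add]

theorem reIP_sub_left (X Y Z : Matrix m n ℂ) : reIP (X - Y) Z = reIP X Z - reIP Y Z := by
  simp [reIP, Matrix.sub_mul]

theorem reIP_sub_right (X Y Z : Matrix m n ℂ) : reIP X (Y - Z) = reIP X Y - reIP X Z := by
  simp [reIP, Matrix.mul_sub]

theorem reIP_smul_right (c : ℝ) (X Y : Matrix m n ℂ) :
    reIP X ((c : ℂ) • Y) = c * reIP X Y := by
  simp [reIP]

theorem reIP_mul_left (A : Matrix l m ℂ) (X : Matrix m n ℂ) (Y : Matrix l n ℂ) :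
    reIP (A * X) Y = reIP X (Aᴴ * Y) := by
  simp [reIP, Matrix.conjTranspose_mul, Matrix.mul_assoc]

theorem reIP_mul_right (X : Matrix l m ℂ) (A : Matrix m n ℂ) (Y : Matrix l n ℂ) :
    reIP (X * A) Y = reIP X (Y * Aᴴ) := by
  rw [reIP, reIP, Matrix.conjTranspose_mul, Matrix.mul_assoc, Matrix.trace_mul_comm,
    Matrix.mul_assoc]

theorem norm_add_sq_frob (X Y : Matrix m n ℂ) :
    ‖X + Y‖ ^ 2 = ‖X‖ ^ 2 + 2 * reIP X Y + ‖Y‖ ^ 2 := by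
  rw [← reIP_self, ← reIP_self, ← reIP_self, reIP_add_left, reIP_add_right, reIP_add_right,
    reIP_comm Y X]
  ring

theorem norm_sub_sq_frob (X Y : Matrix m n ℂ) :
    ‖X - Y‖ ^ 2 = ‖X‖ ^ 2 - 2 * reIP X Y + ‖Y‖ ^ 2 := by
  rw [← reIP_self, ← reIP_self, ← reIP_self, reIP_sub_left, reIP_sub_right, reIP_sub_right,
    reIP_comm Y X]
  ring

theorem reIP_le (X Y : Matrix m n ℂ) : reIP X Y ≤ ‖X‖ * ‖Y‖ := by
  have h1 := norm_add_sq_frob X Y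
  have h2 := pow_le_pow_left₀ (norm_nonneg _) (norm_add_le X Y) 2
  nlinarith

/-- Used throughout for duality arguments: bounding `‖X‖²` by a pairing of `X` with itself leaves
one factor `‖X‖` to cancel, and this form needs no case split at `0`. -/
theorem norm_le_of_sq_le_mul {a b : ℝ} (hb : 0 ≤ b) (h : a ^ 2 ≤ b * a) : a ≤ b := by
  by_contra! hc
  nlinarith

theorem norm_le_of_reIP_le {X : Matrix m n ℂ} {c : ℝ} (hc : 0 ≤ c)
    (h : reIP X X ≤ c * ‖X‖) : ‖X‖ ≤ c := by
  rw [reIP_self] at h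
  exact norm_le_of_sq_le_mul hc h

theorem norm_conjT (X : Matrix m n ℂ) : ‖Xᴴ‖ = ‖X‖ := Matrix.frobenius_norm_conjTranspose X

/-- Multiplication by a matrix with orthonormal columns preserves the norm. -/
theorem norm_isometry_mul [DecidableEq m] {U : Matrix l m ℂ} (hU : Uᴴ * U = 1)
    (X : Matrix m n ℂ) : ‖U * X‖ = ‖X‖ := by
  have : ‖U * X‖ ^ 2 = ‖X‖ ^ 2 := by
    rw [← reIP_self, reIP_mul_left, ← Matrix.mul_assoc, hU, Matrix.one_mul, reIP_self]
  exact (pow_left_inj₀ (norm_nonneg _) (norm_nonneg _) two_ne_zero).1 this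

/-- If `‖A X‖ ≤ c ‖X‖` for all `X` then `‖Aᴴ Y‖ ≤ c ‖Y‖`. -/
theorem norm_conjT_mul_le {A : Matrix l m ℂ} {c : ℝ} (hc : 0 ≤ c)
    (h : ∀ X : Matrix m n ℂ, ‖A * X‖ ≤ c * ‖X‖) (Y : Matrix l n ℂ) : ‖Aᴴ * Y‖ ≤ c * ‖Y‖ := by
  refine norm_le_of_reIP_le (by positivity) ?_
  rw [reIP_mul_left, Matrix.conjTranspose_conjTranspose]
  refine (reIP_le _ _).trans ?_
  have := mul_le_mul_of_nonneg_left (h (Aᴴ * Y)) (norm_nonneg Y)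
  linarith

theorem norm_conjT_isometry_mul [DecidableEq m] {U : Matrix l m ℂ} (hU : Uᴴ * U = 1)
    (Y : Matrix l n ℂ) : ‖Uᴴ * Y‖ ≤ ‖Y‖ := by
  simpa using norm_conjT_mul_le (c := 1) zero_le_one
    (fun X : Matrix m n ℂ => by rw [norm_isometry_mul hU, one_mul]) Y

/-- Orthogonal projections. -/
structure IsProj (P : Matrix m m ℂ) : Prop where
  herm : Pᴴ = P
  idem : P * P = P

theorem IsProj.one_sub [DecidableEq m] {P : Matrix m m ℂ} (h : IsProj P) : IsProj (1 - P) where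
  herm := by simp [h.herm]
  idem := by simp [Matrix.sub_mul, Matrix.mul_sub, h.idem]

theorem IsProj.of_isometry [DecidableEq m] {U : Matrix l m ℂ} (hU : Uᴴ * U = 1) :
    IsProj (U * Uᴴ) where
  herm := by simp
  idem := by
    rw [Matrix.mul_assoc, ← Matrix.mul_assoc Uᴴ, hU, Matrix.one_mul]

theorem IsProj.norm_sq {P : Matrix m m ℂ} (h : IsProj P) (X : Matrix m n ℂ) :
    ‖P * X‖ ^ 2 = reIP X (P * X) := by
  rw [← reIP_self, reIP_mul_left, h.herm, ← Matrix.mul_assoc, h.idem]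

theorem IsProj.norm_mul_le {P : Matrix m m ℂ} (h : IsProj P) (X : Matrix m n ℂ) :
    ‖P * X‖ ≤ ‖X‖ := by
  refine norm_le_of_sq_le_mul (norm_nonneg _) ?_
  rw [h.norm_sq]
  exact reIP_le _ _

theorem IsProj.norm_mul_right_le {P : Matrix m m ℂ} (h : IsProj P) (X : Matrix n m ℂ) :
    ‖X * P‖ ≤ ‖X‖ := by
  rw [← norm_conjT, ← norm_conjT X, Matrix.conjTranspose_mul, h.herm]
  exact h.norm_mul_le _

theorem IsProj.norm_right_sq {P : Matrix m m ℂ} (h : IsProj P) (X : Matrix n m ℂ) :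
    ‖X * P‖ ^ 2 = reIP X (X * P) := by
  rw [← reIP_self, reIP_mul_right, h.herm, Matrix.mul_assoc, h.idem]

theorem IsProj.pythagoras [DecidableEq m] {P : Matrix m m ℂ} (h : IsProj P)
    (X : Matrix m n ℂ) : ‖X‖ ^ 2 = ‖P * X‖ ^ 2 + ‖(1 - P) * X‖ ^ 2 := by
  rw [h.norm_sq, h.one_sub.norm_sq, ← reIP_add_right, ← Matrix.add_mul]
  simp [reIP_self]

theorem IsProj.pythagoras_right [DecidableEq m] {P : Matrix m m ℂ} (h : IsProj P)
    (X : Matrix n m ℂ) : ‖X‖ ^ 2 = ‖X * P‖ ^ 2 + ‖X * (1 - P)‖ ^ 2 := by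
  rw [h.norm_right_sq, h.one_sub.norm_right_sq, ← reIP_add_right, ← Matrix.mul_add]
  simp [reIP_self]

/-! ### Perturbation of the factors near `M⋆`; pseudoinverse and column projections. -/

section Contraction

variable {m n k : Type*} [Fintype m] [Fintype n] [Fintype k] {r : ℕ}

theorem IsCompactSVD.conjT {M : Matrix m n ℂ} {U : Matrix m (Fin r) ℂ} {σ : Fin r → ℝ}
    {V : Matrix n (Fin r) ℂ} (h : IsCompactSVD M U σ V) : IsCompactSVD Mᴴ V σ U := by
  refine ⟨⟨h.1.right_orthonormal, h.1.left_orthonormal, h.1.antitone, h.1.nonneg, ?_⟩, h.2⟩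
  rw [h.1.eq]
  simp only [Matrix.conjTranspose_mul, Matrix.conjTranspose_conjTranspose,
    Matrix.diagonal_conjTranspose, Matrix.mul_assoc]
  congr 3
  ext i
  simp

theorem norm_diagonal_mul_ge {σ : Fin r → ℝ} {s : ℝ} (hs : 0 ≤ s) (hσ : ∀ i, s ≤ σ i)
    (X : Matrix (Fin r) k ℂ) : s * ‖X‖ ≤ ‖Matrix.diagonal (fun i => (σ i : ℂ)) * X‖ := by
  refine (pow_le_pow_iff_left₀ (by positivity) (norm_nonneg _) two_ne_zero).1 ?_
  rw [mul_pow, frob_sq, frob_sq, Finset.mul_sum]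
  refine Finset.sum_le_sum fun i _ => ?_
  rw [Finset.mul_sum]
  refine Finset.sum_le_sum fun j _ => ?_
  rw [Matrix.diagonal_mul, norm_mul, mul_pow, Complex.norm_real, Real.norm_eq_abs, sq_abs]
  gcongr
  exact hσ i

theorem norm_diagonal_mul_le {σ : Fin r → ℝ} {s : ℝ} (hs : 0 ≤ s) (hσ : ∀ i, |σ i| ≤ s)
    (X : Matrix (Fin r) k ℂ) : ‖Matrix.diagonal (fun i => (σ i : ℂ)) * X‖ ≤ s * ‖X‖ := by
  refine (pow_le_pow_iff_left₀ (norm_nonneg _) (by positivity) two_ne_zero).1 ?_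
  rw [mul_pow, frob_sq, frob_sq, Finset.mul_sum]
  refine Finset.sum_le_sum fun i _ => ?_
  rw [Finset.mul_sum]
  refine Finset.sum_le_sum fun j _ => ?_
  rw [Matrix.diagonal_mul, norm_mul, mul_pow, Complex.norm_real, Real.norm_eq_abs]
  gcongr
  exact hσ i

theorem isUnit_of_mul_eq_zero {A : Matrix (Fin r) (Fin r) ℂ}
    (h : ∀ X : Matrix (Fin r) (Fin 1) ℂ, A * X = 0 → X = 0) : IsUnit A := by
  rw [Matrix.isUnit_iff_isUnit_det, isUnit_iff_ne_zero]
  intro hdet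
  obtain ⟨v, hv, hA⟩ := Matrix.exists_mulVec_eq_zero_iff.2 hdet
  refine hv ?_
  have := h (Matrix.replicateCol (Fin 1) v) (by
    rw [← Matrix.replicateCol_mulVec, hA, Matrix.replicateCol_zero])
  ext i
  simpa using congrFun (congrFun this i) 0

/-- The lower bound behind `σ_r(M) ≥ σ_r(M⋆) - ‖M - M⋆‖`. -/
theorem norm_conjT_mul_ge {Ms M : Matrix m n ℂ} {U : Matrix m (Fin r) ℂ} {σ : Fin r → ℝ}
    {V : Matrix n (Fin r) ℂ} (h : IsCompactSVD Ms U σ V) {s : ℝ} (hs : 0 ≤ s)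
    (hσ : ∀ i, s ≤ σ i) (v : Matrix (Fin r) k ℂ) :
    (s - ‖M - Ms‖) * ‖v‖ ≤ ‖Mᴴ * (U * v)‖ := by
  have e1 : Mᴴ * (U * v) = Msᴴ * (U * v) + (M - Ms)ᴴ * (U * v) := by
    rw [← Matrix.add_mul, ← Matrix.conjTranspose_add]; simp
  have e2 : Msᴴ * (U * v) = V * (Matrix.diagonal (fun i => (σ i : ℂ)) * v) := by
    rw [h.conjT.1.eq, Matrix.mul_assoc, Matrix.mul_assoc, ← Matrix.mul_assoc Uᴴ,
      h.1.left_orthonormal, Matrix.one_mul]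
  have e3 : s * ‖v‖ ≤ ‖Msᴴ * (U * v)‖ := by
    rw [e2, norm_isometry_mul h.1.right_orthonormal]
    exact norm_diagonal_mul_ge hs hσ v
  have e4 : ‖(M - Ms)ᴴ * (U * v)‖ ≤ ‖M - Ms‖ * ‖v‖ := by
    refine (Matrix.frobenius_norm_mul _ _).trans ?_
    rw [norm_conjT, norm_isometry_mul h.1.left_orthonormal]
  have e5 : ‖Msᴴ * (U * v)‖ ≤ ‖Mᴴ * (U * v)‖ + ‖(M - Ms)ᴴ * (U * v)‖ := by
    rw [e1]
    exact norm_le_add_norm_add _ _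
  linarith

/-- A kernel vector `X` of `Lᴴ U` gives `(L Rᴴ)ᴴ U X = R Lᴴ U X = 0`, whereas `(L Rᴴ)ᴴ` is bounded
below on the range of `U`. -/
theorem isUnit_conjT_mul_left {Ms : Matrix m n ℂ} {U : Matrix m (Fin r) ℂ} {σ : Fin r → ℝ}
    {V : Matrix n (Fin r) ℂ} (h : IsCompactSVD Ms U σ V) {s : ℝ} (hs : 0 ≤ s)
    (hσ : ∀ i, s ≤ σ i) {L : Matrix m (Fin r) ℂ} {R : Matrix n (Fin r) ℂ}
    (hd : ‖L * Rᴴ - Ms‖ < s) : IsUnit (Lᴴ * U) := by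
  refine isUnit_of_mul_eq_zero fun X hX => ?_
  have h1 := norm_conjT_mul_ge (M := L * Rᴴ) h hs hσ X
  rw [Matrix.conjTranspose_mul, Matrix.mul_assoc, ← Matrix.mul_assoc Lᴴ, hX, Matrix.mul_zero,
    norm_zero] at h1
  have : ‖X‖ ≤ 0 := by
    by_contra! hc
    nlinarith [mul_pos (sub_pos.2 hd) hc]
  exact norm_le_zero_iff.1 this

/-- Invertibility of `Lᴴ U` writes `R X` as `(L Rᴴ)ᴴ U v` with `v = (Lᴴ U)⁻¹ X`, so `R X = 0` forces
`v = 0` and then `X = 0`. -/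
theorem isUnit_gram_right {Ms : Matrix m n ℂ} {U : Matrix m (Fin r) ℂ} {σ : Fin r → ℝ}
    {V : Matrix n (Fin r) ℂ} (h : IsCompactSVD Ms U σ V) {s : ℝ} (hs : 0 ≤ s)
    (hσ : ∀ i, s ≤ σ i) {L : Matrix m (Fin r) ℂ} {R : Matrix n (Fin r) ℂ}
    (hd : ‖L * Rᴴ - Ms‖ < s) : IsUnit (Rᴴ * R) := by
  have hu := isUnit_conjT_mul_left h hs hσ hd
  rw [Matrix.isUnit_iff_isUnit_det] at hu
  refine isUnit_of_mul_eq_zero fun X hX => ?_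
  have hRX : R * X = 0 := by
    have : ‖R * X‖ ^ 2 = 0 := by
      rw [← reIP_self, reIP_mul_left, ← Matrix.mul_assoc, hX]; simp [reIP]
    simpa using this
  have h1 := norm_conjT_mul_ge (M := L * Rᴴ) h hs hσ ((Lᴴ * U)⁻¹ * X)
  have e : (L * Rᴴ)ᴴ * (U * ((Lᴴ * U)⁻¹ * X)) = R * X := by
    rw [Matrix.conjTranspose_mul, Matrix.conjTranspose_conjTranspose, Matrix.mul_assoc,
      ← Matrix.mul_assoc Lᴴ, ← Matrix.mul_assoc (Lᴴ * U), Matrix.mul_nonsing_inv _ hu,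
      Matrix.one_mul]
  rw [e, hRX, norm_zero] at h1
  have h2 : ‖(Lᴴ * U)⁻¹ * X‖ ≤ 0 := by
    by_contra! hc
    nlinarith [mul_pos (sub_pos.2 hd) hc]
  have h3 := norm_le_zero_iff.1 h2
  rw [← Matrix.one_mul X, ← Matrix.mul_nonsing_inv _ hu, Matrix.mul_assoc, h3, Matrix.mul_zero]

theorem isUnit_gram_left {Ms : Matrix m n ℂ} {U : Matrix m (Fin r) ℂ} {σ : Fin r → ℝ}
    {V : Matrix n (Fin r) ℂ} (h : IsCompactSVD Ms U σ V) {s : ℝ} (hs : 0 ≤ s)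
    (hσ : ∀ i, s ≤ σ i) {L : Matrix m (Fin r) ℂ} {R : Matrix n (Fin r) ℂ}
    (hd : ‖L * Rᴴ - Ms‖ < s) : IsUnit (Lᴴ * L) := by
  refine isUnit_gram_right h.conjT hs hσ (L := R) (R := L) ?_
  have : R * Lᴴ - Msᴴ = (L * Rᴴ - Ms)ᴴ := by simp
  rwa [this, norm_conjT]

/-- The orthogonal projection onto the column space of `L`. -/
noncomputable def colProj (L : Matrix m (Fin r) ℂ) : Matrix m m ℂ := L * (Lᴴ * L)⁻¹ * Lᴴ

theorem colProj_mul {L : Matrix m (Fin r) ℂ} (hL : IsUnit (Lᴴ * L)) : colProj L * L = L := by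
  rw [Matrix.isUnit_iff_isUnit_det] at hL
  rw [colProj, Matrix.mul_assoc, Matrix.mul_assoc, Matrix.nonsing_inv_mul _ hL, Matrix.mul_one]

theorem gram_inv_herm (L : Matrix m (Fin r) ℂ) : ((Lᴴ * L)⁻¹)ᴴ = (Lᴴ * L)⁻¹ := by
  rw [Matrix.conjTranspose_nonsing_inv]; simp

theorem isProj_colProj {L : Matrix m (Fin r) ℂ} (hL : IsUnit (Lᴴ * L)) : IsProj (colProj L) where
  herm := by
    simp only [colProj, Matrix.conjTranspose_mul, Matrix.conjTranspose_conjTranspose,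
      gram_inv_herm, Matrix.mul_assoc]
  idem := by
    conv_lhs => rhs; rw [colProj, Matrix.mul_assoc]
    rw [← Matrix.mul_assoc, colProj_mul hL, ← Matrix.mul_assoc, colProj]

/-- The Moore-Penrose inverse of `L Rᴴ` for `L`, `R` of full column rank. -/
noncomputable def factorPinv (L : Matrix m (Fin r) ℂ) (R : Matrix n (Fin r) ℂ) : Matrix n m ℂ :=
  R * (Rᴴ * R)⁻¹ * ((Lᴴ * L)⁻¹ * Lᴴ)

theorem mul_factorPinv {L : Matrix m (Fin r) ℂ} {R : Matrix n (Fin r) ℂ}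
    (hR : IsUnit (Rᴴ * R)) : L * Rᴴ * factorPinv L R = colProj L := by
  rw [Matrix.isUnit_iff_isUnit_det] at hR
  rw [factorPinv, colProj, ← Matrix.mul_assoc, Matrix.mul_assoc L, ← Matrix.mul_assoc Rᴴ,
    Matrix.mul_nonsing_inv _ hR, Matrix.mul_one, Matrix.mul_assoc]

theorem factorPinv_mul {L : Matrix m (Fin r) ℂ} {R : Matrix n (Fin r) ℂ}
    (hL : IsUnit (Lᴴ * L)) : factorPinv L R * (L * Rᴴ) = colProj R := by
  rw [Matrix.isUnit_iff_isUnit_det] at hL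
  rw [factorPinv, colProj, Matrix.mul_assoc, ← Matrix.mul_assoc _ L, Matrix.mul_assoc _ Lᴴ,
    Matrix.nonsing_inv_mul _ hL, Matrix.one_mul]

theorem colProj_mul_factorPinv {L : Matrix m (Fin r) ℂ} {R : Matrix n (Fin r) ℂ}
    (hR : IsUnit (Rᴴ * R)) : colProj R * factorPinv L R = factorPinv L R := by
  rw [factorPinv, Matrix.mul_assoc R, ← Matrix.mul_assoc, colProj_mul hR]

theorem factorPinv_mul_colProj {L : Matrix m (Fin r) ℂ} {R : Matrix n (Fin r) ℂ}
    (hL : IsUnit (Lᴴ * L)) : factorPinv L R * colProj L = factorPinv L R := by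
  rw [Matrix.isUnit_iff_isUnit_det] at hL
  rw [factorPinv, colProj, Matrix.mul_assoc, Matrix.mul_assoc _ Lᴴ, ← Matrix.mul_assoc Lᴴ,
    ← Matrix.mul_assoc Lᴴ, Matrix.mul_nonsing_inv _ hL, Matrix.one_mul]

/-- This is `‖M⁺‖ ≤ 1 / (s - ‖M - M⋆‖)` without singular values of `M`. With `T = M⁺ X = Mᴴ U v`,
the identity `M M⁺ = P` gives `‖T‖² = ⟨v, Uᴴ P X⟩ ≤ ‖v‖ ‖X‖`, while `‖v‖` is controlled by `‖T‖`
through the lower bound for `Mᴴ U`. -/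
theorem norm_factorPinv_mul_le {Ms : Matrix m n ℂ} {U : Matrix m (Fin r) ℂ} {σ : Fin r → ℝ}
    {V : Matrix n (Fin r) ℂ} (h : IsCompactSVD Ms U σ V) {s : ℝ} (hs : 0 ≤ s)
    (hσ : ∀ i, s ≤ σ i) {L : Matrix m (Fin r) ℂ} {R : Matrix n (Fin r) ℂ}
    (hd : ‖L * Rᴴ - Ms‖ < s) (X : Matrix m k ℂ) :
    (s - ‖L * Rᴴ - Ms‖) * ‖factorPinv L R * X‖ ≤ ‖X‖ := by
  have hR := isUnit_gram_right h hs hσ hd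
  have hL := isUnit_gram_left h hs hσ hd
  have hu := isUnit_conjT_mul_left h hs hσ hd
  rw [Matrix.isUnit_iff_isUnit_det] at hu
  set T := factorPinv L R * X with hT
  -- The vector with `Mᴴ U v = T`; it exists because `Lᴴ U` is invertible.
  set v := (Lᴴ * U)⁻¹ * ((Rᴴ * R)⁻¹ * (((Lᴴ * L)⁻¹ * Lᴴ) * X)) with hv
  have e : (L * Rᴴ)ᴴ * (U * v) = T := by
    rw [Matrix.conjTranspose_mul, Matrix.conjTranspose_conjTranspose, Matrix.mul_assoc,
      ← Matrix.mul_assoc Lᴴ, hv, ← Matrix.mul_assoc (Lᴴ * U), Matrix.mul_nonsing_inv _ hu,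
      Matrix.one_mul, hT, factorPinv]
    simp only [Matrix.mul_assoc]
  have hge := norm_conjT_mul_ge (M := L * Rᴴ) h hs hσ v
  rw [e] at hge
  have h1 : ‖T‖ ^ 2 ≤ ‖v‖ * ‖X‖ := by
    rw [← reIP_self]
    conv_lhs => lhs; rw [← e]
    rw [reIP_mul_left, reIP_mul_left, Matrix.conjTranspose_conjTranspose, hT,
      ← Matrix.mul_assoc (L * Rᴴ), mul_factorPinv hR]
    refine (reIP_le _ _).trans ?_
    gcongr
    exact (norm_conjT_isometry_mul h.1.left_orthonormal _).trans
      ((isProj_colProj hL).norm_mul_le _)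
  have hp : 0 < s - ‖L * Rᴴ - Ms‖ := sub_pos.2 hd
  refine norm_le_of_sq_le_mul (a := (s - ‖L * Rᴴ - Ms‖) * ‖T‖) (norm_nonneg X) ?_
  have h2 := mul_le_mul_of_nonneg_left h1 (sq_nonneg (s - ‖L * Rᴴ - Ms‖))
  have h3 := mul_le_mul_of_nonneg_right hge (mul_nonneg hp.le (norm_nonneg X))
  nlinarith

/-- One step of scaled gradient descent, in terms of the product of the factors. -/
theorem scaled_step_product {L : Matrix m (Fin r) ℂ} {R : Matrix n (Fin r) ℂ} (E : Matrix m n ℂ)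
    (η : ℝ) :
    (L - (η : ℂ) • (E * R * (Rᴴ * R)⁻¹)) * (R - (η : ℂ) • (Eᴴ * L * (Lᴴ * L)⁻¹))ᴴ
      = L * Rᴴ - (η : ℂ) • (colProj L * E + E * colProj R)
        + (η : ℂ) • (η : ℂ) • (E * factorPinv L R * E) := by
  simp only [Matrix.conjTranspose_sub, Matrix.conjTranspose_smul, Matrix.conjTranspose_mul,
    Matrix.conjTranspose_conjTranspose, gram_inv_herm, Matrix.sub_mul, Matrix.mul_sub,
    Matrix.smul_mul, Matrix.mul_smul, colProj, factorPinv, Matrix.mul_assoc]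
  have : star (η : ℂ) = η := by simp
  rw [this, smul_add, smul_sub]
  abel

end Contraction

/-! ### One step of scaled gradient descent contracts the error. -/

section Step

variable {m n : Type*} [Fintype m] [Fintype n] [DecidableEq m] [DecidableEq n] {r : ℕ}

/-- `Z = U Wᴴ + W' Vᴴ` for some `W`, `W'`, when `U` and `V` have orthonormal columns. -/
def IsTangent (U : Matrix m (Fin r) ℂ) (V : Matrix n (Fin r) ℂ) (Z : Matrix m n ℂ) : Prop :=
  (1 - U * Uᴴ) * Z * (1 - V * Vᴴ) = 0

/-- A form `Bf X Y = ⟨a X, a Y⟩ - ⟨g X, g Y⟩` that is small on the tangent space at `U`, `V` and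
bounded through `nA X = ‖a X‖ ≤ α ‖X‖` elsewhere. -/
structure NearIsometry (U : Matrix m (Fin r) ℂ) (V : Matrix n (Fin r) ℂ) (α : ℝ)
    (Bf : Matrix m n ℂ → Matrix m n ℂ → ℝ) (nA : Matrix m n ℂ → ℝ) : Prop where
  add_left : ∀ X Y Z, Bf (X + Y) Z = Bf X Z + Bf Y Z
  add_right : ∀ X Y Z, Bf X (Y + Z) = Bf X Y + Bf X Z
  bound : ∀ X Y, Bf X Y ≤ nA X * nA Y + ‖X‖ * ‖Y‖
  nonneg : ∀ X, 0 ≤ nA X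
  subadd : ∀ X Y, nA (X + Y) ≤ nA X + nA Y
  norm_le : ∀ X, nA X ≤ α * ‖X‖
  tangent : ∀ X Y, IsTangent U V X → IsTangent U V Y → Bf X Y ≤ 1 / 50 * (‖X‖ * ‖Y‖)
  tangent_norm_le : ∀ X, IsTangent U V X → nA X ≤ 2 * ‖X‖

theorem isTangent_sub {U : Matrix m (Fin r) ℂ} {V : Matrix n (Fin r) ℂ} (hU : Uᴴ * U = 1)
    (hV : Vᴴ * V = 1) (Z : Matrix m n ℂ) :
    IsTangent U V (Z - (1 - U * Uᴴ) * Z * (1 - V * Vᴴ)) := by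
  have h1 := (IsProj.of_isometry hU).one_sub.idem
  have h2 := (IsProj.of_isometry hV).one_sub.idem
  have : (1 - U * Uᴴ) * ((1 - U * Uᴴ) * Z * (1 - V * Vᴴ)) * (1 - V * Vᴴ)
      = ((1 - U * Uᴴ) * (1 - U * Uᴴ)) * Z * ((1 - V * Vᴴ) * (1 - V * Vᴴ)) := by
    simp only [Matrix.mul_assoc]
  rw [IsTangent, Matrix.mul_sub (1 - U * Uᴴ), Matrix.sub_mul ((1 - U * Uᴴ) * Z), this, h1, h2,
    sub_self]

/-- The near isometry on the tangent space at `M⋆` extends to the form between an error direction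
and a tangent direction at a nearby point. -/
theorem NearIsometry.bound_of_close {U : Matrix m (Fin r) ℂ} {V : Matrix n (Fin r) ℂ}
    (hU : Uᴴ * U = 1) (hV : Vᴴ * V = 1) {α : ℝ}
    {Bf : Matrix m n ℂ → Matrix m n ℂ → ℝ} {nA : Matrix m n ℂ → ℝ}
    (hB : NearIsometry U V α Bf nA) (hα : 1 ≤ α) {γ : ℝ} (hγα : α * γ ≤ 1 / 100)
    {D Z : Matrix m n ℂ} (hD : ‖(1 - U * Uᴴ) * D * (1 - V * Vᴴ)‖ ≤ γ * ‖D‖)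
    (hZ : ‖(1 - U * Uᴴ) * Z * (1 - V * Vᴴ)‖ ≤ 2 * γ * ‖Z‖) :
    Bf D Z ≤ 1 / 8 * (‖D‖ * ‖Z‖) := by
  have htD := isTangent_sub hU hV D
  have htZ := isTangent_sub hU hV Z
  set D2 := (1 - U * Uᴴ) * D * (1 - V * Vᴴ)
  set Z2 := (1 - U * Uᴴ) * Z * (1 - V * Vᴴ)
  set D1 := D - D2 with hD1
  set Z1 := Z - Z2 with hZ1
  have hd := norm_nonneg D
  have hz := norm_nonneg Z
  have bD2 : α * ‖D2‖ ≤ 1 / 100 * ‖D‖ := by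
    calc α * ‖D2‖ ≤ α * (γ * ‖D‖) := by gcongr
      _ = α * γ * ‖D‖ := by ring
      _ ≤ _ := by gcongr
  have bZ2 : α * ‖Z2‖ ≤ 1 / 50 * ‖Z‖ := by
    calc α * ‖Z2‖ ≤ α * (2 * γ * ‖Z‖) := by gcongr
      _ = 2 * (α * γ) * ‖Z‖ := by ring
      _ ≤ 2 * (1 / 100) * ‖Z‖ := by gcongr
      _ = _ := by ring
  have bD2' : ‖D2‖ ≤ 1 / 100 * ‖D‖ :=
    (le_mul_of_one_le_left (norm_nonneg _) hα).trans bD2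
  have bZ2' : ‖Z2‖ ≤ 1 / 50 * ‖Z‖ := (le_mul_of_one_le_left (norm_nonneg _) hα).trans bZ2
  have bD1 : ‖D1‖ ≤ 101 / 100 * ‖D‖ := by
    have := norm_sub_le D D2
    rw [← hD1] at this
    linarith
  have bZ1 : ‖Z1‖ ≤ 51 / 50 * ‖Z‖ := by
    have := norm_sub_le Z Z2
    rw [← hZ1] at this
    linarith
  -- Only the tangent-tangent term uses the near isometry. Each of the others has a normal factor of
  -- relative size `O(γ)`, and `α γ ≤ 1 / 100` pays for the crude bound `α` there.
  have e : Bf D Z = Bf D1 Z1 + Bf D1 Z2 + Bf D2 Z := by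
    have h1 : D = D1 + D2 := by simp [hD1]
    have h2 : Z = Z1 + Z2 := by simp [hZ1]
    calc Bf D Z = Bf (D1 + D2) Z := by rw [← h1]
      _ = Bf D1 Z + Bf D2 Z := hB.add_left _ _ _
      _ = Bf D1 (Z1 + Z2) + Bf D2 Z := by rw [← h2]
      _ = _ := by rw [hB.add_right]
  have t1 : Bf D1 Z1 ≤ 1 / 50 * (101 / 100 * ‖D‖ * (51 / 50 * ‖Z‖)) :=
    (hB.tangent _ _ htD htZ).trans (by gcongr)
  have aD1 : nA D1 ≤ 2 * (101 / 100 * ‖D‖) :=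
    (hB.tangent_norm_le _ htD).trans (by gcongr)
  have aZ1 : nA Z1 ≤ 2 * (51 / 50 * ‖Z‖) := (hB.tangent_norm_le _ htZ).trans (by gcongr)
  have aZ2 : nA Z2 ≤ 1 / 50 * ‖Z‖ := (hB.norm_le _).trans bZ2
  have aD2 : nA D2 ≤ 1 / 100 * ‖D‖ := (hB.norm_le _).trans bD2
  have aZ : nA Z ≤ 2 * (51 / 50 * ‖Z‖) + 1 / 50 * ‖Z‖ := by
    have h2 : Z = Z1 + Z2 := by simp [hZ1]
    have := hB.subadd Z1 Z2
    rw [← h2] at this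
    linarith
  have t2 : Bf D1 Z2 ≤ 2 * (101 / 100 * ‖D‖) * (1 / 50 * ‖Z‖)
      + 101 / 100 * ‖D‖ * (1 / 50 * ‖Z‖) := by
    refine (hB.bound _ _).trans (add_le_add ?_ ?_)
    · exact mul_le_mul aD1 aZ2 (hB.nonneg _) (by positivity)
    · gcongr
  have t3 : Bf D2 Z ≤ 1 / 100 * ‖D‖ * (2 * (51 / 50 * ‖Z‖) + 1 / 50 * ‖Z‖)
      + 1 / 100 * ‖D‖ * ‖Z‖ := by
    refine (hB.bound _ _).trans (add_le_add ?_ ?_)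
    · exact mul_le_mul aD2 aZ (hB.nonneg _) (by positivity)
    · gcongr
  have := mul_nonneg hd hz
  nlinarith

/-- Since `(1 - P) M = 0` and `M (1 - Q) = 0`, the residual equals `-(1 - P) D M⋆⁺ D (1 - Q)`: it is
quadratic in `D`. The bound is stated with `s - ‖D‖` rather than `s` so that it uses the same ratio
as the pseudoinverse bound. -/
theorem norm_residual_le {Ms : Matrix m n ℂ} {U : Matrix m (Fin r) ℂ} {σ : Fin r → ℝ}
    {V : Matrix n (Fin r) ℂ} (h : IsCompactSVD Ms U σ V) {s : ℝ} (hs : 0 < s)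
    (hσ : ∀ i, s ≤ σ i) {L : Matrix m (Fin r) ℂ} {R : Matrix n (Fin r) ℂ}
    (hds : ‖L * Rᴴ - Ms‖ < s) :
    ‖(1 - colProj L) * (L * Rᴴ - Ms) * (1 - colProj R)‖
      ≤ ‖L * Rᴴ - Ms‖ / (s - ‖L * Rᴴ - Ms‖) * ‖L * Rᴴ - Ms‖ := by
  have hR := isUnit_gram_right h hs.le hσ hds
  have hL := isUnit_gram_left h hs.le hσ hds
  set D := L * Rᴴ - Ms with hD
  have hU := h.1.left_orthonormal
  have hV := h.1.right_orthonormal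
  have hPL := isProj_colProj hL
  have hPR := isProj_colProj hR
  have hUMs : U * Uᴴ * Ms = Ms := by
    rw [h.1.eq, ← Matrix.mul_assoc, ← Matrix.mul_assoc, Matrix.mul_assoc U, hU, Matrix.mul_one]
  have hLM : (1 - colProj L) * (L * Rᴴ) = 0 := by
    rw [← Matrix.mul_assoc, Matrix.sub_mul, colProj_mul hL]; simp
  have hMR : L * Rᴴ * (1 - colProj R) = 0 := by
    have : (colProj R * R)ᴴ = Rᴴ := by rw [colProj_mul hR]
    rw [Matrix.conjTranspose_mul, hPR.herm] at this
    rw [Matrix.mul_assoc, Matrix.mul_sub, this]; simp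
  have e : (1 - colProj L) * D * (1 - colProj R)
      = (1 - colProj L) * (U * Uᴴ) * (D * (1 - colProj R)) := by
    have e1 : D * (1 - colProj R) = -(Ms * (1 - colProj R)) := by
      rw [hD, Matrix.sub_mul, hMR, zero_sub]
    rw [Matrix.mul_assoc, e1, Matrix.mul_assoc, Matrix.mul_neg, Matrix.mul_neg, Matrix.mul_neg,
      ← Matrix.mul_assoc (U * Uᴴ), hUMs]
  -- `(1 - P_L) U Uᴴ = -(1 - P_L) D V Σ⁻¹ Uᴴ`
  set G := V * Matrix.diagonal (fun i => ((σ i)⁻¹ : ℂ)) * Uᴴ with hG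
  have hMG : Ms * G = U * Uᴴ := by
    rw [h.1.eq, hG]
    have : (Matrix.diagonal fun i => (σ i : ℂ)) * Matrix.diagonal (fun i => ((σ i)⁻¹ : ℂ))
        = 1 := by
      rw [Matrix.diagonal_mul_diagonal, ← Matrix.diagonal_one]
      congr 1
      ext i
      have : (σ i : ℂ) ≠ 0 := by exact_mod_cast (h.2 i).ne'
      field_simp
    rw [← Matrix.mul_assoc, ← Matrix.mul_assoc, Matrix.mul_assoc _ Vᴴ, hV, Matrix.mul_one,
      Matrix.mul_assoc U, this, Matrix.mul_one]
  have e2 : (1 - colProj L) * (U * Uᴴ) = -((1 - colProj L) * (D * G)) := by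
    rw [hD, Matrix.sub_mul (L * Rᴴ), Matrix.mul_sub, ← Matrix.mul_assoc _ (L * Rᴴ), hLM, hMG]
    simp
  have hGn : ‖G * (D * (1 - colProj R))‖ ≤ s⁻¹ * ‖D‖ := by
    rw [hG, Matrix.mul_assoc, Matrix.mul_assoc, norm_isometry_mul hV]
    have := norm_diagonal_mul_le (σ := fun i => (σ i)⁻¹) (s := s⁻¹) (by positivity)
      (fun i => by
        rw [abs_of_pos (inv_pos.2 (h.2 i))]
        exact inv_anti₀ hs (hσ i)) (Uᴴ * (D * (1 - colProj R)))
    simp only [Complex.ofReal_inv] at this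
    refine this.trans ?_
    gcongr
    exact (norm_conjT_isometry_mul hU _).trans (hPR.one_sub.norm_mul_right_le _)
  rw [e, e2, Matrix.neg_mul, norm_neg, Matrix.mul_assoc, Matrix.mul_assoc]
  refine (hPL.one_sub.norm_mul_le _).trans ((Matrix.frobenius_norm_mul _ _).trans ?_)
  calc ‖D‖ * ‖G * (D * (1 - colProj R))‖ ≤ ‖D‖ * (s⁻¹ * ‖D‖) := by gcongr
    _ = ‖D‖ / s * ‖D‖ := by ring
    _ ≤ _ := by
      have : 0 < s - ‖D‖ := sub_pos.2 hds
      gcongr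
      linarith [norm_nonneg D]

/-- Put `S = ‖P D‖² + ‖D Q‖²`. Then `⟨D, P D + D Q⟩ = S` and `‖P D + D Q‖² ≤ 2 S`, so the squared
norm drops by at least `(2η - 2η²) S`, and `2η - 2η² ≥ 3η / 2` for `η ≤ 1 / 4`. Two applications of
Pythagoras give `S ≥ ‖D‖² - ‖(1 - P) D (1 - Q)‖²`. -/
theorem norm_sub_projections_le {P : Matrix m m ℂ} {Q : Matrix n n ℂ} (hP : IsProj P)
    (hQ : IsProj Q) {η : ℝ} (h0 : 0 < η) (h1 : η ≤ 1 / 4) {D : Matrix m n ℂ}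
    (hrest : ‖(1 - P) * D * (1 - Q)‖ ≤ 1 / 100 * ‖D‖) :
    ‖D - (η : ℂ) • (P * D + D * Q)‖ ≤ (1 - 7 / 10 * η) * ‖D‖ := by
  have hdn := norm_nonneg D
  have a1 := hP.pythagoras D
  have a2 := hQ.pythagoras_right ((1 - P) * D)
  have a3 : ‖(1 - P) * D * Q‖ ≤ ‖D * Q‖ := by
    rw [Matrix.mul_assoc]; exact hP.one_sub.norm_mul_le _
  have a4 := pow_le_pow_left₀ (norm_nonneg _) a3 2
  have a5 := pow_le_pow_left₀ (norm_nonneg _) hrest 2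
  have a7 : ‖P * D + D * Q‖ ^ 2
      ≤ 2 * (‖P * D‖ ^ 2 + ‖D * Q‖ ^ 2) := by
    have := pow_le_pow_left₀ (norm_nonneg _) (norm_add_le (P * D) (D * Q)) 2
    nlinarith [sq_nonneg (‖P * D‖ - ‖D * Q‖)]
  have a8 : reIP D (P * D + D * Q)
      = ‖P * D‖ ^ 2 + ‖D * Q‖ ^ 2 := by
    rw [reIP_add_right, hP.norm_sq, hQ.norm_right_sq]
  have a9 : ‖D - (η : ℂ) • (P * D + D * Q)‖ ^ 2
      ≤ ‖D‖ ^ 2 - (2 * η - 2 * η ^ 2) * (‖P * D‖ ^ 2 + ‖D * Q‖ ^ 2) := by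
    rw [norm_sub_sq_frob, reIP_smul_right, a8, norm_smul, mul_pow, Complex.norm_real,
      Real.norm_eq_abs, sq_abs]
    linarith [mul_le_mul_of_nonneg_left a7 (sq_nonneg η)]
  refine (pow_le_pow_iff_left₀ (norm_nonneg _) (by nlinarith) two_ne_zero).1 ?_
  refine a9.trans ?_
  have b1 : 9999 / 10000 * ‖D‖ ^ 2 ≤ ‖P * D‖ ^ 2 + ‖D * Q‖ ^ 2 := by linarith
  have b2 : 3 / 2 * η ≤ 2 * η - 2 * η ^ 2 := by nlinarith
  have b3 : 3 / 2 * η * (9999 / 10000 * ‖D‖ ^ 2)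
      ≤ (2 * η - 2 * η ^ 2) * (‖P * D‖ ^ 2 + ‖D * Q‖ ^ 2) :=
    mul_le_mul b2 b1 (by positivity) (by nlinarith)
  have : 0 ≤ η ^ 2 * ‖D‖ ^ 2 := by positivity
  have : 0 ≤ η * ‖D‖ ^ 2 := by positivity
  nlinarith

/-- Three contributions: the projected identity step, the near-isometry defect, and the second-order
term. All smallness comes from `γ = ‖D‖ / (s - ‖D‖)` with `α γ ≤ 1 / 100`. The hypothesis `hE`
describes `E` only by pairing, which suffices because only `P E` and `E Q` occur. -/
theorem scaled_step_contracts {Ms : Matrix m n ℂ} {U : Matrix m (Fin r) ℂ} {σ : Fin r → ℝ}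
    {V : Matrix n (Fin r) ℂ} (h : IsCompactSVD Ms U σ V) {s : ℝ} (hs : 0 < s)
    (hσ : ∀ i, s ≤ σ i) {α : ℝ} {Bf : Matrix m n ℂ → Matrix m n ℂ → ℝ}
    {nA : Matrix m n ℂ → ℝ} (hB : NearIsometry U V α Bf nA) (hα : 1 ≤ α)
    {L : Matrix m (Fin r) ℂ} {R : Matrix n (Fin r) ℂ} (hd : 200 * α * ‖L * Rᴴ - Ms‖ ≤ s)
    {E : Matrix m n ℂ} (hE : ∀ Z, reIP (E - (L * Rᴴ - Ms)) Z = Bf (L * Rᴴ - Ms) Z)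
    {η : ℝ} (h0 : 0 < η) (h1 : η ≤ 1 / 4) :
    ‖(L - (η : ℂ) • (E * R * (Rᴴ * R)⁻¹)) * (R - (η : ℂ) • (Eᴴ * L * (Lᴴ * L)⁻¹))ᴴ - Ms‖
      ≤ (1 - 2 / 5 * η) * ‖L * Rᴴ - Ms‖ := by
  set D := L * Rᴴ - Ms with hD
  have hU := h.1.left_orthonormal
  have hV := h.1.right_orthonormal
  have hdn := norm_nonneg D
  have hd' : 200 * ‖D‖ ≤ s := by nlinarith
  have hds : ‖D‖ < s := by linarith
  have hR := isUnit_gram_right h hs.le hσ hds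
  have hL := isUnit_gram_left h hs.le hσ hds
  have hp := norm_factorPinv_mul_le (k := n) h hs.le hσ hds
  rw [← hD] at hp
  have hPL := isProj_colProj hL
  have hPR := isProj_colProj hR
  have hQU := (IsProj.of_isometry hU).one_sub
  have hQV := (IsProj.of_isometry hV).one_sub
  set γ := ‖D‖ / (s - ‖D‖) with hγ
  have hsd : 0 < s - ‖D‖ := by linarith
  have hγ0 : 0 ≤ γ := by positivity
  have hγα : α * γ ≤ 1 / 100 := by
    rw [hγ, ← mul_div_assoc, div_le_iff₀ hsd]
    nlinarith
  have hγ1 : γ ≤ 1 / 100 := (le_mul_of_one_le_left hγ0 hα).trans hγα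
  have hpinv : ∀ X : Matrix m n ℂ, ‖D‖ * ‖factorPinv L R * X‖ ≤ γ * ‖X‖ := fun X => by
    rw [hγ, div_mul_eq_mul_div, le_div_iff₀ hsd]
    have := mul_le_mul_of_nonneg_left (hp X) hdn
    linarith
  -- the singular spaces of `M⋆` nearly contain those of `L Rᴴ`
  have hUMs : (1 - U * Uᴴ) * Ms = 0 := by
    rw [h.1.eq, ← Matrix.mul_assoc, ← Matrix.mul_assoc, Matrix.sub_mul, Matrix.mul_assoc U, hU]
    simp
  have hVMs : Ms * (1 - V * Vᴴ) = 0 := by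
    rw [h.1.eq, Matrix.mul_assoc, Matrix.mul_sub, ← Matrix.mul_assoc Vᴴ, hV]
    simp
  have hUM : (1 - U * Uᴴ) * (L * Rᴴ) = (1 - U * Uᴴ) * D := by
    rw [hD, Matrix.mul_sub, hUMs, sub_zero]
  have hVM : L * Rᴴ * (1 - V * Vᴴ) = D * (1 - V * Vᴴ) := by
    rw [hD, Matrix.sub_mul, hVMs, sub_zero]
  -- Writing `P = M M⁺` and using `(1 - U Uᴴ) M = (1 - U Uᴴ) D` shows that the column space of `L`
  -- tilts away from that of `U` by at most `‖D‖ ‖M⁺‖ ≤ γ`.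
  have hleft : ∀ X : Matrix m n ℂ, ‖(1 - U * Uᴴ) * (colProj L * X)‖ ≤ γ * ‖X‖ := fun X => by
    rw [← mul_factorPinv hR, Matrix.mul_assoc, ← Matrix.mul_assoc, hUM, Matrix.mul_assoc]
    refine (hQU.norm_mul_le _).trans ((Matrix.frobenius_norm_mul _ _).trans (hpinv X))
  have hright : ∀ X : Matrix m n ℂ, ‖X * colProj R * (1 - V * Vᴴ)‖ ≤ γ * ‖X‖ := fun X => by
    rw [← factorPinv_mul (R := R) hL, Matrix.mul_assoc, Matrix.mul_assoc _ (L * Rᴴ), hVM,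
      ← Matrix.mul_assoc _ D, ← Matrix.mul_assoc X]
    refine (hQV.norm_mul_right_le _).trans ((Matrix.frobenius_norm_mul _ _).trans ?_)
    have h2 : ‖factorPinv L R * D‖ ≤ γ := by
      rw [hγ, le_div_iff₀ hsd]
      linarith [hp D]
    rw [mul_comm]
    gcongr
  -- The normal part of `D` is also the normal part of `M = P M`, so the tilt bound applies to it.
  have hDtan : ‖(1 - U * Uᴴ) * D * (1 - V * Vᴴ)‖ ≤ γ * ‖D‖ := by
    rw [← hUM, Matrix.mul_assoc]
    have e : L * Rᴴ * (1 - V * Vᴴ) = colProj L * (D * (1 - V * Vᴴ)) := by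
      rw [← hVM, ← Matrix.mul_assoc, ← Matrix.mul_assoc, colProj_mul hL]
    rw [e]
    refine (hleft _).trans ?_
    gcongr
    exact hQV.norm_mul_right_le _
  have key : ∀ X : Matrix m n ℂ, Bf D (colProj L * X) ≤ 1 / 8 * (‖D‖ * ‖colProj L * X‖) := by
    intro X
    refine hB.bound_of_close hU hV hα hγα hDtan ?_
    refine (hQV.norm_mul_right_le _).trans ?_
    have := hleft (colProj L * X)
    rw [← Matrix.mul_assoc (colProj L), hPL.idem] at this
    nlinarith [norm_nonneg (colProj L * X)]
  have key' : ∀ X : Matrix m n ℂ, Bf D (X * colProj R) ≤ 1 / 8 * (‖D‖ * ‖X * colProj R‖) := by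
    intro X
    refine hB.bound_of_close hU hV hα hγα hDtan ?_
    rw [Matrix.mul_assoc]
    refine (hQU.norm_mul_le _).trans ?_
    have := hright (X * colProj R)
    rw [Matrix.mul_assoc X, hPR.idem] at this
    nlinarith [norm_nonneg (X * colProj R)]
  -- Self-duality: the squared norm is the pairing of `E - D` with its own projection, hence the
  -- form at `D` and a nearly tangent direction. A bound on all of `E - D` would bring in powers of
  -- `α`.
  have hF : ‖colProj L * (E - D)‖ ≤ 1 / 8 * ‖D‖ := by
    refine norm_le_of_sq_le_mul (by positivity) ?_
    rw [hPL.norm_sq, hE]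
    exact (key _).trans_eq (by ring)
  have hF' : ‖(E - D) * colProj R‖ ≤ 1 / 8 * ‖D‖ := by
    refine norm_le_of_sq_le_mul (by positivity) ?_
    rw [hPR.norm_right_sq, hE]
    exact (key' _).trans_eq (by ring)
  have hPE : ‖colProj L * E‖ ≤ 9 / 8 * ‖D‖ := by
    have e : colProj L * E = colProj L * D + colProj L * (E - D) := by
      rw [← Matrix.mul_add]; simp
    rw [e]
    refine (norm_add_le _ _).trans ?_
    linarith [hPL.norm_mul_le D]
  have hEP : ‖E * colProj R‖ ≤ 9 / 8 * ‖D‖ := by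
    have e : E * colProj R = D * colProj R + (E - D) * colProj R := by
      rw [← Matrix.add_mul]; simp
    rw [e]
    refine (norm_add_le _ _).trans ?_
    linarith [hPR.norm_mul_right_le D]
  -- the second-order term
  have hquad : ‖E * factorPinv L R * E‖ ≤ 1 / 50 * ‖D‖ := by
    have e : E * factorPinv L R * E
        = (E * colProj R) * (factorPinv L R * (colProj L * E)) := by
      rw [← Matrix.mul_assoc (factorPinv L R), factorPinv_mul_colProj hL, Matrix.mul_assoc E,
        Matrix.mul_assoc E, ← Matrix.mul_assoc (colProj R), colProj_mul_factorPinv hR]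
    rw [e]
    calc _ ≤ ‖E * colProj R‖ * ‖factorPinv L R * (colProj L * E)‖ :=
          Matrix.frobenius_norm_mul _ _
      _ ≤ 9 / 8 * ‖D‖ * ‖factorPinv L R * (colProj L * E)‖ := by gcongr
      _ = 9 / 8 * (‖D‖ * ‖factorPinv L R * (colProj L * E)‖) := by ring
      _ ≤ 9 / 8 * (γ * ‖colProj L * E‖) := mul_le_mul_of_nonneg_left (hpinv _) (by norm_num)
      _ ≤ 9 / 8 * (1 / 100 * (9 / 8 * ‖D‖)) := by gcongr
      _ ≤ _ := by nlinarith
  -- the main term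
  have hrest : ‖(1 - colProj L) * D * (1 - colProj R)‖ ≤ γ * ‖D‖ :=
    norm_residual_le h hs hσ hds
  have hmain : ‖D - (η : ℂ) • (colProj L * D + D * colProj R)‖ ≤ (1 - 7 / 10 * η) * ‖D‖ :=
    norm_sub_projections_le hPL hPR h0 h1 (hrest.trans (by gcongr))
  have e : (L - (η : ℂ) • (E * R * (Rᴴ * R)⁻¹)) * (R - (η : ℂ) • (Eᴴ * L * (Lᴴ * L)⁻¹))ᴴ - Ms
      = (D - (η : ℂ) • (colProj L * D + D * colProj R))
        - (η : ℂ) • (colProj L * (E - D) + (E - D) * colProj R)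
        + (η : ℂ) • (η : ℂ) • (E * factorPinv L R * E) := by
    have hM : L * Rᴴ = D + Ms := by rw [hD]; abel
    rw [scaled_step_product, Matrix.mul_sub (colProj L) E D, Matrix.sub_mul E D, hM]
    simp only [smul_add, smul_sub]
    abel
  rw [e]
  have n1 : ‖(η : ℂ)‖ = η := by rw [Complex.norm_real, Real.norm_eq_abs, abs_of_pos h0]
  refine (norm_add_le _ _).trans ((add_le_add_left (norm_sub_le _ _) _).trans ?_)
  rw [norm_smul, norm_smul, norm_smul, n1]
  have c1 := norm_add_le (colProj L * (E - D)) ((E - D) * colProj R)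
  have c2 : η * ‖colProj L * (E - D) + (E - D) * colProj R‖ ≤ η * (1 / 4 * ‖D‖) := by
    gcongr; linarith
  have c3 : η * (η * ‖E * factorPinv L R * E‖) ≤ η * (1 / 4 * (1 / 50 * ‖D‖)) := by
    gcongr
  -- `1 - 7η/10 + η/4 + η/200 ≤ 1 - 2η/5`.
  nlinarith [mul_nonneg h0.le hdn]

end Step

/-! ### The lifting and sensing operators and the defect of isometry. -/

section Operators

variable {s n n₁ n₂ r : ℕ}

theorem antidiagCard_eq_sum (n₁ n₂ i : ℕ) :
    (antidiagCard n₁ n₂ i : ℂ) = ∑ a : Fin n₁, ∑ k : Fin n₂, if (a : ℕ) + k = i then 1 else 0 := by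
  rw [antidiagCard, Finset.card_filter, Nat.cast_sum, Fintype.sum_prod_type]
  simp

theorem antidiagCard_pos (hn : n₁ + n₂ = n + 1) (h₁ : 0 < n₁) (h₂ : 0 < n₂) (i : Fin n) :
    0 < antidiagCard n₁ n₂ i := by
  rw [antidiagCard, Finset.card_pos]
  have hi := i.2
  by_cases h : (i : ℕ) < n₁
  · exact ⟨(⟨i, h⟩, ⟨0, h₂⟩), by simp⟩
  · refine ⟨(⟨n₁ - 1, by omega⟩, ⟨i - (n₁ - 1), by omega⟩), ?_⟩
    simp
    omega

theorem liftGAdj_add (X Y : Matrix (Fin n₁ × Fin s) (Fin n₂) ℂ) :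
    liftGAdj n (X + Y) = liftGAdj n X + liftGAdj n Y := by
  ext l i
  simp only [liftGAdj, Matrix.of_apply, Matrix.add_apply, ← mul_add, ← Finset.sum_add_distrib]
  congr 1
  refine Finset.sum_congr rfl fun a _ => Finset.sum_congr rfl fun k _ => ?_
  split_ifs <;> simp

theorem liftGAdj_neg (X : Matrix (Fin n₁ × Fin s) (Fin n₂) ℂ) :
    liftGAdj n (-X) = -liftGAdj n X := by
  have h0 : liftGAdj n (0 : Matrix (Fin n₁ × Fin s) (Fin n₂) ℂ) = 0 := by
    ext l i; simp [liftGAdj]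
  rw [eq_neg_iff_add_eq_zero, ← liftGAdj_add, neg_add_cancel, h0]

theorem liftGAdj_sub (X Y : Matrix (Fin n₁ × Fin s) (Fin n₂) ℂ) :
    liftGAdj n (X - Y) = liftGAdj n X - liftGAdj n Y := by
  rw [sub_eq_add_neg, liftGAdj_add, liftGAdj_neg, sub_eq_add_neg]

theorem liftG_sub (hn : n₁ + n₂ = n + 1) (X Y : Matrix (Fin s) (Fin n) ℂ) :
    liftG hn (X - Y) = liftG hn X - liftG hn Y := by
  ext p k
  simp [liftG, hankelLift, colUnscale, mul_sub]

theorem liftGAdj_hankelLift (hn : n₁ + n₂ = n + 1) (h₁ : 0 < n₁) (h₂ : 0 < n₂)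
    (X : Matrix (Fin s) (Fin n) ℂ) (l : Fin s) (i : Fin n) :
    liftGAdj n (hankelLift hn X) l i = ((Real.sqrt (antidiagCard n₁ n₂ i) : ℝ) : ℂ) * X l i := by
  have e : (∑ a : Fin n₁, ∑ k : Fin n₂,
      if (a : ℕ) + (k : ℕ) = (i : ℕ) then hankelLift hn X (a, l) k else 0)
      = (antidiagCard n₁ n₂ i : ℂ) * X l i := by
    rw [antidiagCard_eq_sum, Finset.sum_mul]
    refine Finset.sum_congr rfl fun a _ => ?_
    rw [Finset.sum_mul]
    refine Finset.sum_congr rfl fun k _ => ?_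
    split_ifs with h
    · rw [one_mul, hankelLift, Matrix.of_apply]
      congr 1
      exact Fin.ext h
    · simp
  have hw : (0 : ℝ) < antidiagCard n₁ n₂ i := by exact_mod_cast antidiagCard_pos hn h₁ h₂ i
  rw [liftGAdj, Matrix.of_apply, e, ← mul_assoc]
  congr 1
  rw [inv_mul_eq_iff_eq_mul₀ (by exact_mod_cast (Real.sqrt_pos.2 hw).ne'), ← Complex.ofReal_mul,
    Real.mul_self_sqrt hw.le]
  simp

theorem colUnscale_liftGAdj_hankelLift (hn : n₁ + n₂ = n + 1) (h₁ : 0 < n₁) (h₂ : 0 < n₂)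
    (X : Matrix (Fin s) (Fin n) ℂ) : colUnscale n₁ n₂ (liftGAdj n (hankelLift hn X)) = X := by
  ext l i
  have hw : (0 : ℝ) < antidiagCard n₁ n₂ i := by exact_mod_cast antidiagCard_pos hn h₁ h₂ i
  rw [colUnscale, Matrix.of_apply, liftGAdj_hankelLift hn h₁ h₂, inv_mul_cancel_left₀]
  exact_mod_cast (Real.sqrt_pos.2 hw).ne'

theorem liftGAdj_liftG (hn : n₁ + n₂ = n + 1) (h₁ : 0 < n₁) (h₂ : 0 < n₂)
    (X : Matrix (Fin s) (Fin n) ℂ) : liftGAdj n (liftG hn X) = X := by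
  ext l i
  have hw : (0 : ℝ) < antidiagCard n₁ n₂ i := by exact_mod_cast antidiagCard_pos hn h₁ h₂ i
  rw [liftG, liftGAdj_hankelLift hn h₁ h₂, colUnscale, Matrix.of_apply, mul_inv_cancel_left₀]
  exact_mod_cast (Real.sqrt_pos.2 hw).ne'

theorem liftG_liftGAdj_hankelLift (hn : n₁ + n₂ = n + 1) (h₁ : 0 < n₁) (h₂ : 0 < n₂)
    (X : Matrix (Fin s) (Fin n) ℂ) :
    liftG hn (liftGAdj n (hankelLift hn X)) = hankelLift hn X := by
  rw [liftG, colUnscale_liftGAdj_hankelLift hn h₁ h₂]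

theorem reIP_liftG (hn : n₁ + n₂ = n + 1) (Z : Matrix (Fin s) (Fin n) ℂ)
    (M : Matrix (Fin n₁ × Fin s) (Fin n₂) ℂ) :
    reIP (liftG hn Z) M = reIP Z (liftGAdj n M) := by
  rw [reIP, trace_liftGAdj, reIP]

theorem norm_liftG (hn : n₁ + n₂ = n + 1) (h₁ : 0 < n₁) (h₂ : 0 < n₂)
    (Z : Matrix (Fin s) (Fin n) ℂ) : ‖liftG hn Z‖ = ‖Z‖ := by
  have : ‖liftG hn Z‖ ^ 2 = ‖Z‖ ^ 2 := by
    rw [← reIP_self, reIP_liftG, liftGAdj_liftG hn h₁ h₂, reIP_self]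
  exact (pow_left_inj₀ (norm_nonneg _) (norm_nonneg _) two_ne_zero).1 this

theorem norm_liftGAdj_le (hn : n₁ + n₂ = n + 1) (h₁ : 0 < n₁) (h₂ : 0 < n₂)
    (M : Matrix (Fin n₁ × Fin s) (Fin n₂) ℂ) : ‖liftGAdj n M‖ ≤ ‖M‖ := by
  refine norm_le_of_sq_le_mul (norm_nonneg _) ?_
  rw [← reIP_self, ← reIP_liftG hn]
  refine (reIP_le _ _).trans ?_
  rw [norm_liftG hn h₁ h₂, mul_comm]

theorem norm_colUnscale_le (hn : n₁ + n₂ = n + 1) (h₁ : 0 < n₁) (h₂ : 0 < n₂)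
    (Z : Matrix (Fin s) (Fin n) ℂ) : ‖colUnscale n₁ n₂ Z‖ ≤ ‖Z‖ := by
  refine (pow_le_pow_iff_left₀ (norm_nonneg _) (norm_nonneg _) two_ne_zero).1 ?_
  rw [frob_sq, frob_sq]
  refine Finset.sum_le_sum fun l _ => Finset.sum_le_sum fun i _ => ?_
  have hw : (1 : ℝ) ≤ antidiagCard n₁ n₂ i := by exact_mod_cast antidiagCard_pos hn h₁ h₂ i
  have hw' : 1 ≤ Real.sqrt (antidiagCard n₁ n₂ i) := Real.one_le_sqrt.2 hw
  gcongr
  rw [colUnscale, Matrix.of_apply, norm_mul, norm_inv, Complex.norm_real, Real.norm_eq_abs,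
    abs_of_pos (by linarith)]
  exact mul_le_of_le_one_left (norm_nonneg _) (inv_le_one_of_one_le₀ hw')

/-- `𝒟⁻¹𝒢*` is a left inverse of `ℋ`, and it is nonexpansive because every antidiagonal is nonempty,
so that all weights are at least `1`. -/
theorem norm_estimate_sub_le (hn : n₁ + n₂ = n + 1) (h₁ : 0 < n₁) (h₂ : 0 < n₂)
    (L : Matrix (Fin n₁ × Fin s) (Fin r) ℂ) (R : Matrix (Fin n₂) (Fin r) ℂ)
    (X : Matrix (Fin s) (Fin n) ℂ) :
    ‖estimate n L R - X‖ ≤ ‖L * Rᴴ - hankelLift hn X‖ := by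
  have e : estimate n L R - X = colUnscale n₁ n₂ (liftGAdj n (L * Rᴴ - hankelLift hn X)) := by
    conv_lhs => rw [← colUnscale_liftGAdj_hankelLift hn h₁ h₂ X]
    rw [liftGAdj_sub]
    ext l i
    simp [estimate, colUnscale, mul_sub]
  rw [e]
  exact (norm_colUnscale_le hn h₁ h₂ _).trans (norm_liftGAdj_le hn h₁ h₂ _)

/-- The measurements `𝒜(Z)` as a column. -/
noncomputable def measCol (B : Matrix (Fin n) (Fin s) ℂ) (Z : Matrix (Fin s) (Fin n) ℂ) :
    Matrix (Fin n) (Fin 1) ℂ := Matrix.of fun j _ => measA B Z j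

theorem measA_apply (B : Matrix (Fin n) (Fin s) ℂ) (Z : Matrix (Fin s) (Fin n) ℂ) (j : Fin n) :
    measA B Z j = ∑ l, B j l * Z l j := by
  simp [measA, sensingVec]

theorem measCol_add (B : Matrix (Fin n) (Fin s) ℂ) (X Y : Matrix (Fin s) (Fin n) ℂ) :
    measCol B (X + Y) = measCol B X + measCol B Y := by
  ext j i
  simp [measCol, measA_apply, mul_add, Finset.sum_add_distrib]

theorem measA_sub (B : Matrix (Fin n) (Fin s) ℂ) (X Y : Matrix (Fin s) (Fin n) ℂ) :
    measA B (X - Y) = measA B X - measA B Y := by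
  ext j
  simp [measA_apply, mul_sub, Finset.sum_sub_distrib]

theorem reIP_measAAdj (B : Matrix (Fin n) (Fin s) ℂ) (X Z : Matrix (Fin s) (Fin n) ℂ) :
    reIP (measAAdj B (measA B X)) Z = reIP (measCol B X) (measCol B Z) := by
  rw [reIP_eq_sum, reIP_eq_sum, Finset.sum_comm]
  congr 1
  refine Finset.sum_congr rfl fun j _ => ?_
  simp only [Fin.sum_univ_one, measCol, Matrix.of_apply, measAAdj]
  rw [measA_apply B Z, Finset.mul_sum]
  refine Finset.sum_congr rfl fun l _ => ?_
  simp [sensingVec]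
  ring

theorem norm_measA_sq_le {B : Matrix (Fin n) (Fin s) ℂ} {μ₀ : ℝ}
    (hB : ∀ j l, ‖B j l‖ ^ 2 ≤ μ₀) (Z : Matrix (Fin s) (Fin n) ℂ) (j : Fin n) :
    ‖measA B Z j‖ ^ 2 ≤ μ₀ * s * ∑ l, ‖Z l j‖ ^ 2 := by
  rw [measA_apply]
  calc ‖∑ l, B j l * Z l j‖ ^ 2 ≤ (∑ l, ‖B j l‖ * ‖Z l j‖) ^ 2 := by
        gcongr
        refine (norm_sum_le _ _).trans_eq ?_
        simp
    _ ≤ (∑ l, ‖B j l‖ ^ 2) * ∑ l, ‖Z l j‖ ^ 2 := Finset.sum_mul_sq_le_sq_mul_sq _ _ _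
    _ ≤ (∑ _l : Fin s, μ₀) * ∑ l, ‖Z l j‖ ^ 2 := by
        gcongr with l
        exact hB j l
    _ = _ := by
        rw [Finset.sum_const, Finset.card_univ, Fintype.card_fin, nsmul_eq_mul, mul_comm (s : ℝ)]

theorem norm_measCol_le {B : Matrix (Fin n) (Fin s) ℂ} {μ₀ : ℝ}
    (hB : ∀ j l, ‖B j l‖ ^ 2 ≤ μ₀) (Z : Matrix (Fin s) (Fin n) ℂ) :
    ‖measCol B Z‖ ≤ Real.sqrt (μ₀ * s) * ‖Z‖ := by
  have h : ‖measCol B Z‖ ^ 2 ≤ μ₀ * s * ‖Z‖ ^ 2 := by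
    rw [frob_sq, frob_sq, Finset.sum_comm (s := (Finset.univ : Finset (Fin s))), Finset.mul_sum]
    refine Finset.sum_le_sum fun j _ => ?_
    simp only [Fin.sum_univ_one, measCol, Matrix.of_apply]
    exact norm_measA_sq_le hB Z j
  rw [← Real.sqrt_sq (norm_nonneg Z), ← Real.sqrt_mul' _ (sq_nonneg _)]
  exact Real.le_sqrt_of_sq_le h

/-- `⟨𝒜𝒢* X, 𝒜𝒢* Y⟩ - ⟨𝒢* X, 𝒢* Y⟩`. -/
noncomputable def isoDefect (B : Matrix (Fin n) (Fin s) ℂ)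
    (X Y : Matrix (Fin n₁ × Fin s) (Fin n₂) ℂ) : ℝ :=
  reIP (measCol B (liftGAdj n X)) (measCol B (liftGAdj n Y)) - reIP (liftGAdj n X) (liftGAdj n Y)

theorem isoDefect_add_left (B : Matrix (Fin n) (Fin s) ℂ)
    (X Y Z : Matrix (Fin n₁ × Fin s) (Fin n₂) ℂ) :
    isoDefect B (X + Y) Z = isoDefect B X Z + isoDefect B Y Z := by
  simp only [isoDefect, liftGAdj_add, measCol_add, reIP_add_left]
  ring

theorem isoDefect_comm (B : Matrix (Fin n) (Fin s) ℂ)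
    (X Y : Matrix (Fin n₁ × Fin s) (Fin n₂) ℂ) : isoDefect B X Y = isoDefect B Y X := by
  rw [isoDefect, reIP_comm, reIP_comm (liftGAdj n X), isoDefect]

theorem isoDefect_add_right (B : Matrix (Fin n) (Fin s) ℂ)
    (X Y Z : Matrix (Fin n₁ × Fin s) (Fin n₂) ℂ) :
    isoDefect B X (Y + Z) = isoDefect B X Y + isoDefect B X Z := by
  rw [isoDefect_comm, isoDefect_add_left, isoDefect_comm, isoDefect_comm B Z]

/-- Reduces everything to the bound on tangent directions: the other properties hold for every `B`
with entries bounded by `√μ₀`, as `𝒢*` is nonexpansive and Cauchy-Schwarz in each column gives `‖𝒜‖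
≤ √(μ₀ s)`. -/
theorem nearIsometry_of_tangent (hn : n₁ + n₂ = n + 1) (h₁ : 0 < n₁) (h₂ : 0 < n₂)
    {B : Matrix (Fin n) (Fin s) ℂ} {μ₀ : ℝ} (hB : ∀ j l, ‖B j l‖ ^ 2 ≤ μ₀)
    {U : Matrix (Fin n₁ × Fin s) (Fin r) ℂ} {V : Matrix (Fin n₂) (Fin r) ℂ}
    (ht : ∀ X Y, IsTangent U V X → IsTangent U V Y →
      isoDefect B X Y ≤ 1 / 50 * (‖X‖ * ‖Y‖)) :
    NearIsometry U V (Real.sqrt (μ₀ * s)) (isoDefect B)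
      (fun X => ‖measCol B (liftGAdj n X)‖) where
  add_left := isoDefect_add_left B
  add_right := isoDefect_add_right B
  bound X Y := by
    have h1 := reIP_le (measCol B (liftGAdj n X)) (measCol B (liftGAdj n Y))
    have h2 := reIP_le (-liftGAdj n X) (liftGAdj n Y)
    have h3 : reIP (-liftGAdj n X) (liftGAdj n Y) = -reIP (liftGAdj n X) (liftGAdj n Y) := by
      simp [reIP]
    rw [h3, norm_neg] at h2
    have h4 : ‖liftGAdj n X‖ * ‖liftGAdj n Y‖ ≤ ‖X‖ * ‖Y‖ :=
      mul_le_mul (norm_liftGAdj_le hn h₁ h₂ X) (norm_liftGAdj_le hn h₁ h₂ Y) (norm_nonneg _)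
        (norm_nonneg _)
    rw [isoDefect]
    linarith
  nonneg X := norm_nonneg _
  subadd X Y := by
    rw [liftGAdj_add, measCol_add]
    exact norm_add_le _ _
  norm_le X := by
    refine (norm_measCol_le hB _).trans ?_
    gcongr
    exact norm_liftGAdj_le hn h₁ h₂ X
  tangent := ht
  tangent_norm_le X hX := by
    have h1 := ht X X hX hX
    rw [isoDefect, reIP_self, reIP_self] at h1
    have h2 := pow_le_pow_left₀ (norm_nonneg _) (norm_liftGAdj_le hn h₁ h₂ X) 2
    refine (pow_le_pow_iff_left₀ (norm_nonneg _) (by positivity) two_ne_zero).1 ?_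
    nlinarith [norm_nonneg X]

/-- The lifting: the data are linear in `X⋆`, and the weights `√w_j` are exactly those that `𝒢*`
produces on a Hankel matrix, because `𝒢*ℋ = 𝒟`. -/
theorem weighted_samples (hn : n₁ + n₂ = n + 1) (h₁ : 0 < n₁) (h₂ : 0 < n₂)
    (B : Matrix (Fin n) (Fin s) ℂ) (d : Fin r → ℂ) (τ : Fin r → ℝ) (h : Fin r → Fin s → ℂ) :
    weighted n₁ n₂ (samples B d τ h)
      = measA B (liftGAdj n (hankelLift hn (signalMatrix n d τ h))) := by
  ext j
  rw [measA_apply]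
  simp only [liftGAdj_hankelLift hn h₁ h₂, weighted, samples, signalMatrix, Matrix.of_apply,
    Matrix.mulVec, dotProduct, Finset.mul_sum]
  rw [Finset.sum_comm]
  refine Finset.sum_congr rfl fun l _ => Finset.sum_congr rfl fun k _ => ?_
  ring

/-- `𝒢𝒢*` fixes `M⋆`, so the structure penalty vanishes there and `E - D = 𝒢(𝒜*𝒜 - ℐ)𝒢* D`. -/
theorem reIP_gradCore_sub (hn : n₁ + n₂ = n + 1) (h₁ : 0 < n₁) (h₂ : 0 < n₂)
    (B : Matrix (Fin n) (Fin s) ℂ) (X : Matrix (Fin s) (Fin n) ℂ)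
    (L : Matrix (Fin n₁ × Fin s) (Fin r) ℂ) (R : Matrix (Fin n₂) (Fin r) ℂ)
    (Z : Matrix (Fin n₁ × Fin s) (Fin n₂) ℂ) :
    reIP (gradCore hn B (measA B (liftGAdj n (hankelLift hn X))) L R
      - (L * Rᴴ - hankelLift hn X)) Z = isoDefect B (L * Rᴴ - hankelLift hn X) Z := by
  have e : gradCore hn B (measA B (liftGAdj n (hankelLift hn X))) L R
      - (L * Rᴴ - hankelLift hn X)
      = liftG hn (measAAdj B (measA B (liftGAdj n (L * Rᴴ - hankelLift hn X))))
        - liftG hn (liftGAdj n (L * Rᴴ - hankelLift hn X)) := by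
    rw [gradCore, ← measA_sub, ← liftGAdj_sub, liftGAdj_sub, liftG_sub,
      liftG_liftGAdj_hankelLift hn h₁ h₂]
    abel
  rw [e, reIP_sub_left, reIP_liftG, reIP_liftG, reIP_measAAdj, isoDefect]

end Operators

/-! ### Rank-`r` truncation of a perturbation of `M⋆`. -/

section SpectralInit

variable {m n : Type*} [Fintype m] [Fintype n] {p r : ℕ}

theorem conjT_mul_submatrix {U : Matrix m (Fin p) ℂ} (hU : Uᴴ * U = 1) {q : ℕ}
    {f : Fin q → Fin p} (hf : Function.Injective f) :
    (U.submatrix id f)ᴴ * U.submatrix id f = 1 := by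
  have : (U.submatrix id f)ᴴ * U.submatrix id f = (Uᴴ * U).submatrix f f := by
    ext i j; simp [Matrix.mul_apply]
  rw [this, hU, Matrix.submatrix_one _ hf]

theorem IsSVD.mul_submatrix {M : Matrix m n ℂ} {U : Matrix m (Fin p) ℂ} {σ : Fin p → ℝ}
    {V : Matrix n (Fin p) ℂ} (h : IsSVD M U σ V) {q : ℕ} (f : Fin q → Fin p) :
    M * V.submatrix id f
      = U.submatrix id f * Matrix.diagonal (fun i => (σ (f i) : ℂ)) := by
  have h1 : M * V = U * Matrix.diagonal (fun i => (σ i : ℂ)) := by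
    conv_lhs => rw [h.eq]
    rw [Matrix.mul_assoc, h.right_orthonormal, Matrix.mul_one]
  have h2 : M * V.submatrix id f = (M * V).submatrix id f := by
    ext i j; simp [Matrix.mul_apply]
  rw [h2, h1]
  ext i j
  simp [Matrix.mul_diagonal]

theorem norm_isometry {U : Matrix m (Fin r) ℂ} (hU : Uᴴ * U = 1) : ‖U‖ = Real.sqrt r := by
  rw [eq_comm, Real.sqrt_eq_iff_eq_sq (by positivity) (norm_nonneg _), ← reIP_self, reIP, hU]
  simp

/-- Weyl's inequality. The span of the `r + 1` leading right singular vectors of `N` contains a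
nonzero vector orthogonal to the `r` columns of `V`; there `M⋆` vanishes, while `N` expands by at
least `σ' i`. The hypothesis `he` encodes an operator norm, since `‖·‖` is the Frobenius norm. -/
theorem IsSVD.sigma_le {N Ms : Matrix m n ℂ} {U : Matrix m (Fin r) ℂ} {σ : Fin r → ℝ}
    {V : Matrix n (Fin r) ℂ} (h : IsCompactSVD Ms U σ V) {e : ℝ}
    (he : ∀ (k : ℕ) (X : Matrix n (Fin k) ℂ), ‖(N - Ms) * X‖ ≤ e * ‖X‖)
    {U' : Matrix m (Fin p) ℂ} {σ' : Fin p → ℝ} {V' : Matrix n (Fin p) ℂ}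
    (h' : IsSVD N U' σ' V') (i : Fin p) (hi : r ≤ i) : σ' i ≤ e := by
  have hrp : r + 1 ≤ p := by omega
  have hinj := Fin.castLE_injective hrp
  obtain ⟨v, hv0, hv⟩ : ∃ v : Fin (r + 1) → ℂ, v ≠ 0 ∧
      (Vᴴ * V'.submatrix id (Fin.castLE hrp)) *ᵥ v = 0 := by
    have := LinearMap.ker_ne_bot_of_finrank_lt
      (f := (Vᴴ * V'.submatrix id (Fin.castLE hrp)).mulVecLin) (by simp)
    obtain ⟨v, hv, h0⟩ := Submodule.exists_mem_ne_zero_of_ne_bot this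
    exact ⟨v, h0, by simpa using hv⟩
  set X : Matrix (Fin (r + 1)) (Fin 1) ℂ := Matrix.replicateCol (Fin 1) v with hX
  have hX0 : 0 < ‖X‖ := by
    rw [norm_pos_iff]
    intro h0
    apply hv0
    ext j
    simpa [hX] using congrFun (congrFun h0 j) 0
  have hMs : Ms * (V'.submatrix id (Fin.castLE hrp) * X) = 0 := by
    have : Vᴴ * (V'.submatrix id (Fin.castLE hrp) * X) = 0 := by
      rw [← Matrix.mul_assoc, hX, ← Matrix.replicateCol_mulVec, hv, Matrix.replicateCol_zero]
    rw [h.1.eq, Matrix.mul_assoc, this, Matrix.mul_zero]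
  have h1 := he 1 (V'.submatrix id (Fin.castLE hrp) * X)
  rw [Matrix.sub_mul, hMs, sub_zero, ← Matrix.mul_assoc, h'.mul_submatrix, Matrix.mul_assoc,
    norm_isometry_mul (conjT_mul_submatrix h'.left_orthonormal hinj),
    norm_isometry_mul (conjT_mul_submatrix h'.right_orthonormal hinj)] at h1
  have h2 := norm_diagonal_mul_ge (σ := fun j => σ' (Fin.castLE hrp j)) (h'.nonneg i)
    (fun j => h'.antitone (by rw [Fin.le_def, Fin.val_castLE]; omega)) X
  exact le_of_mul_le_mul_right (h2.trans h1) hX0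

omit [Fintype m] [Fintype n] in
theorem mulSqrt_mul_conjT {U : Matrix m (Fin r) ℂ} {V : Matrix n (Fin r) ℂ} {σ : Fin r → ℝ}
    (hσ : ∀ i, 0 ≤ σ i) :
    mulSqrt U σ * (mulSqrt V σ)ᴴ = U * Matrix.diagonal (fun i => (σ i : ℂ)) * Vᴴ := by
  have e : Matrix.diagonal (fun i => ((Real.sqrt (σ i) : ℝ) : ℂ)) *
      (Matrix.diagonal (fun i => ((Real.sqrt (σ i) : ℝ) : ℂ)))ᴴ
      = Matrix.diagonal (fun i => (σ i : ℂ)) := by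
    rw [Matrix.diagonal_conjTranspose, Matrix.diagonal_mul_diagonal]
    congr 1
    ext i
    simp only [Pi.star_apply, RCLike.star_def, Complex.conj_ofReal]
    rw [← Complex.ofReal_mul, Real.mul_self_sqrt (hσ i)]
  rw [mulSqrt, mulSqrt, Matrix.conjTranspose_mul, Matrix.mul_assoc, ← Matrix.mul_assoc _ _ Vᴴ, e,
    Matrix.mul_assoc]

/-- A top-`r` SVD of a matrix close to `M⋆` in operator norm is close to `M⋆` in Frobenius
norm. -/
theorem norm_topSVD_sub_le [DecidableEq m] [DecidableEq n] {N Ms : Matrix m n ℂ}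
    {U : Matrix m (Fin r) ℂ} {σ : Fin r → ℝ}
    {V : Matrix n (Fin r) ℂ} (h : IsCompactSVD Ms U σ V) {e : ℝ} (he0 : 0 ≤ e)
    (he : ∀ (k : ℕ) (X : Matrix n (Fin k) ℂ), ‖(N - Ms) * X‖ ≤ e * ‖X‖)
    {U₀ : Matrix m (Fin r) ℂ} {σ₀ : Fin r → ℝ} {V₀ : Matrix n (Fin r) ℂ}
    (h₀ : IsTopSVD N U₀ σ₀ V₀) :
    ‖mulSqrt U₀ σ₀ * (mulSqrt V₀ σ₀)ᴴ - Ms‖ ≤ 4 * e * Real.sqrt r := by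
  obtain ⟨p, hrp, U', σ', V', h', rfl, rfl, rfl⟩ := h₀
  have hinj := Fin.castLE_injective hrp
  have hU := h.1.left_orthonormal
  rw [mulSqrt_mul_conjT (σ := σ' ∘ Fin.castLE hrp) (fun i => h'.nonneg _)]
  have hNV := h'.mul_submatrix (Fin.castLE hrp)
  have hV₀ := conjT_mul_submatrix h'.right_orthonormal hinj
  simp only [Function.comp_apply]
  rw [← hNV]
  -- Deflation: `1 - V₀ V₀ᴴ` removes the first `r` right singular directions, so their singular
  -- values may be replaced by `0` and Weyl's inequality bounds the rest.
  have hrow : ∀ (i : Fin p), (i : ℕ) < r → ∀ (k : ℕ) (X : Matrix n (Fin k) ℂ) (j : Fin k),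
      (V'ᴴ * ((1 - V'.submatrix id (Fin.castLE hrp) * (V'.submatrix id (Fin.castLE hrp))ᴴ) * X) :
        Matrix (Fin p) (Fin k) ℂ) i j = 0 := by
    intro i hi k X j
    have h1 : (V'.submatrix id (Fin.castLE hrp))ᴴ *
        ((1 - V'.submatrix id (Fin.castLE hrp) * (V'.submatrix id (Fin.castLE hrp))ᴴ) * X) = 0 := by
      rw [← Matrix.mul_assoc, Matrix.mul_sub, ← Matrix.mul_assoc, hV₀]
      simp
    have h2 := congrFun (congrFun h1 ⟨i, hi⟩) j
    simpa [Matrix.mul_apply] using h2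
  set V₀ := V'.submatrix id (Fin.castLE hrp) with hV₀def
  have hP := IsProj.of_isometry hV₀
  have hN : ∀ (k : ℕ) (X : Matrix n (Fin k) ℂ), ‖(N * V₀ * V₀ᴴ - N) * X‖ ≤ e * ‖X‖ := by
    intro k X
    have e1 : (N * V₀ * V₀ᴴ - N) * X = -(N * ((1 - V₀ * V₀ᴴ) * X)) := by
      rw [← Matrix.mul_assoc N, Matrix.mul_sub, Matrix.mul_one, Matrix.mul_assoc N,
        ← Matrix.neg_mul,
        neg_sub]
    have e2 : Matrix.diagonal (fun i => (σ' i : ℂ)) * (V'ᴴ * ((1 - V₀ * V₀ᴴ) * X))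
        = Matrix.diagonal (fun i : Fin p => (((if (i : ℕ) < r then 0 else σ' i) : ℝ) : ℂ)) *
          (V'ᴴ * ((1 - V₀ * V₀ᴴ) * X)) := by
      ext i j
      rw [Matrix.diagonal_mul, Matrix.diagonal_mul]
      split_ifs with hi
      · rw [hrow i hi]; simp
      · rfl
    rw [e1, norm_neg, h'.eq, Matrix.mul_assoc, Matrix.mul_assoc,
      norm_isometry_mul h'.left_orthonormal,
      e2]
    refine (norm_diagonal_mul_le he0 (fun i => ?_) _).trans ?_
    · split_ifs with hi
      · simpa using he0
      · rw [abs_of_nonneg (h'.nonneg i)]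
        exact h'.sigma_le h he i (not_lt.1 hi)
    · gcongr
      exact (norm_conjT_isometry_mul h'.right_orthonormal _).trans (hP.one_sub.norm_mul_le _)
  set D := N * V₀ * V₀ᴴ - Ms with hD
  have hDX : ∀ X : Matrix n (Fin r) ℂ, ‖D * X‖ ≤ 2 * e * ‖X‖ := by
    intro X
    have e1 : D * X = (N * V₀ * V₀ᴴ - N) * X + (N - Ms) * X := by
      rw [← Matrix.add_mul]; simp [hD]
    rw [e1]
    refine (norm_add_le _ _).trans ?_
    linarith [hN r X, he r X]
  -- `D` has operator norm at most `2 e` and is split into two pieces of rank at most `r`: the range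
  -- of `U` on the left, then that of `V₀` on the right. Each piece costs `√r` in passing to the
  -- Frobenius norm.
  have b1 : ‖U * Uᴴ * D‖ ≤ 2 * e * Real.sqrt r := by
    rw [Matrix.mul_assoc, norm_isometry_mul hU, ← norm_conjT, Matrix.conjTranspose_mul,
      Matrix.conjTranspose_conjTranspose, ← norm_isometry hU]
    exact norm_conjT_mul_le (by positivity) hDX U
  have b2 : ‖(1 - U * Uᴴ) * D‖ ≤ 2 * e * Real.sqrt r := by
    have hUMs : (1 - U * Uᴴ) * Ms = 0 := by
      rw [h.1.eq, ← Matrix.mul_assoc, ← Matrix.mul_assoc, Matrix.sub_mul, Matrix.mul_assoc U, hU]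
      simp
    have e1 : (1 - U * Uᴴ) * D = (1 - U * Uᴴ) * (D * V₀ * V₀ᴴ) := by
      have e2 : N * V₀ * V₀ᴴ * V₀ * V₀ᴴ = N * V₀ * V₀ᴴ := by
        rw [Matrix.mul_assoc _ V₀ᴴ, hV₀, Matrix.mul_one]
      rw [hD, Matrix.sub_mul (N * V₀ * V₀ᴴ), Matrix.sub_mul (N * V₀ * V₀ᴴ * V₀), e2, Matrix.mul_sub,
        hUMs, Matrix.mul_sub, Matrix.mul_assoc Ms, ← Matrix.mul_assoc _ Ms, hUMs, Matrix.zero_mul]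
    rw [e1]
    refine ((IsProj.of_isometry hU).one_sub.norm_mul_le _).trans ?_
    rw [← norm_conjT, Matrix.conjTranspose_mul, Matrix.conjTranspose_conjTranspose,
      norm_isometry_mul hV₀, norm_conjT, ← norm_isometry hV₀]
    exact hDX V₀
  have e3 : D = U * Uᴴ * D + (1 - U * Uᴴ) * D := by rw [← Matrix.add_mul]; simp
  rw [e3]
  refine (norm_add_le _ _).trans ?_
  linarith

end SpectralInit

/-! ### Block Hankel matrices and their symbols. -/

section Fourier

variable {s n n₁ n₂ : ℕ}

/-- The first `N` columns of the discrete Fourier matrix of the root of unity `ζ`. -/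
noncomputable def fourierMat (ζ : ℂ) (n N : ℕ) : Matrix (Fin n) (Fin N) ℂ :=
  Matrix.of fun t j => ζ ^ ((t : ℕ) * (j : ℕ))

theorem sum_fourier {ζ : ℂ} (hζ : IsPrimitiveRoot ζ n) {i j : ℕ} (hi : i < n)
    (hj : j < n) :
    ∑ t : Fin n, star (ζ ^ ((t : ℕ) * i)) * ζ ^ ((t : ℕ) * j) = if i = j then (n : ℂ) else 0 := by
  have hn : n ≠ 0 := by omega
  have hc : star ζ = ζ⁻¹ := (Complex.inv_eq_conj (hζ.norm'_eq_one hn)).symm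
  have h0 : ζ ≠ 0 := hζ.ne_zero hn
  have e : ∀ t : Fin n, star (ζ ^ ((t : ℕ) * i)) * ζ ^ ((t : ℕ) * j)
      = (ζ⁻¹ ^ i * ζ ^ j) ^ (t : ℕ) := by
    intro t
    rw [star_pow, hc, mul_pow, ← pow_mul, ← pow_mul, mul_comm i, mul_comm j]
  simp only [e]
  rw [Fin.sum_univ_eq_sum_range (fun t => (ζ⁻¹ ^ i * ζ ^ j) ^ t) n]
  split_ifs with h
  · subst h
    rw [← mul_pow, inv_mul_cancel₀ h0]
    simp
  · have h1 : ζ⁻¹ ^ i * ζ ^ j ≠ 1 := by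
      intro h1
      rw [inv_pow, inv_mul_eq_one₀ (pow_ne_zero _ h0)] at h1
      exact h (hζ.pow_inj hi hj h1)
    rw [geom_sum_eq h1, mul_pow, ← pow_mul, ← pow_mul, mul_comm i, mul_comm j, pow_mul, pow_mul,
      inv_pow, hζ.pow_eq_one]
    simp

theorem fourierMat_conjT_mul {ζ : ℂ} (hζ : IsPrimitiveRoot ζ n) {N : ℕ} (hN : N ≤ n) :
    (fourierMat ζ n N)ᴴ * fourierMat ζ n N = (n : ℂ) • 1 := by
  ext i j
  rw [Matrix.mul_apply]
  simp only [Matrix.conjTranspose_apply, fourierMat, Matrix.of_apply]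
  rw [sum_fourier hζ (i.2.trans_le hN) (j.2.trans_le hN)]
  simp [Matrix.one_apply, Fin.ext_iff]

theorem norm_fourierMat_mul {ζ : ℂ} (hζ : IsPrimitiveRoot ζ n) {N : ℕ} (hN : N ≤ n) {k : ℕ}
    (X : Matrix (Fin N) (Fin k) ℂ) : ‖fourierMat ζ n N * X‖ = Real.sqrt n * ‖X‖ := by
  have : ‖fourierMat ζ n N * X‖ ^ 2 = n * ‖X‖ ^ 2 := by
    rw [← reIP_self, reIP_mul_left, ← Matrix.mul_assoc, fourierMat_conjT_mul hζ hN,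
      Matrix.smul_mul, Matrix.one_mul, ← Complex.ofReal_natCast, reIP_smul_right, reIP_self]
  rw [← Real.sqrt_sq (norm_nonneg X), ← Real.sqrt_mul (Nat.cast_nonneg n), ← this,
    Real.sqrt_sq (norm_nonneg _)]

/-- A block Hankel matrix is bounded by the sup norm of its symbol on the roots of unity. -/
theorem norm_hankelLift_mul_le (hn : n₁ + n₂ = n + 1) (h₁ : 0 < n₁) (h₂ : 0 < n₂)
    {ζ : ℂ} (hζ : IsPrimitiveRoot ζ n) (Z : Matrix (Fin s) (Fin n) ℂ) {c : ℝ} (hc : 0 ≤ c)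
    (h : ∀ t : Fin n, ∑ l, ‖∑ j : Fin n, Z l j * ζ ^ ((t : ℕ) * (j : ℕ))‖ ^ 2 ≤ c ^ 2)
    {k : ℕ} (X : Matrix (Fin n₂) (Fin k) ℂ) : ‖hankelLift hn Z * X‖ ≤ c * ‖X‖ := by
  have hn0 : 0 < n := by omega
  have hnR : (0 : ℝ) < n := by exact_mod_cast hn0
  have hnC : (n : ℂ) ≠ 0 := by exact_mod_cast hn0.ne'
  have hcj : star ζ = ζ⁻¹ := (Complex.inv_eq_conj (hζ.norm'_eq_one hn0.ne')).symm
  set T : Matrix (Fin n) (Fin k) ℂ := fourierMat ζ⁻¹ n n₂ * X with hT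
  set Y : Fin s → Matrix (Fin n) (Fin k) ℂ := fun l => Matrix.of fun t i =>
    (∑ j : Fin n, Z l j * ζ ^ ((t : ℕ) * (j : ℕ))) * T t i with hY
  -- Fourier inversion of length `n`. No zero padding is needed, because `a + k ≤ n - 1` for all
  -- block positions.
  have hinv : ∀ (l : Fin s) (j : Fin n), (n : ℂ) * Z l j
      = ∑ t : Fin n, star (ζ ^ ((t : ℕ) * (j : ℕ))) *
          ∑ j' : Fin n, Z l j' * ζ ^ ((t : ℕ) * (j' : ℕ)) := by
    intro l j
    simp only [Finset.mul_sum]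
    rw [Finset.sum_comm]
    have : ∀ j' : Fin n, (∑ t : Fin n, star (ζ ^ ((t : ℕ) * (j : ℕ))) *
        (Z l j' * ζ ^ ((t : ℕ) * (j' : ℕ)))) = Z l j' * if (j : ℕ) = j' then (n : ℂ) else 0 := by
      intro j'
      rw [← sum_fourier hζ j.2 j'.2, Finset.mul_sum]
      exact Finset.sum_congr rfl fun t _ => by ring
    simp only [this]
    rw [Finset.sum_eq_single j]
    · simp [mul_comm]
    · intro j' _ hj'
      rw [if_neg (fun h => hj' (Fin.ext h.symm)), mul_zero]
    · simp
  -- Since `ζ^(-t(a+k))` factors, each row slice of the Hankel matrix is a Fourier matrix, times the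
  -- diagonal of the symbol, times another Fourier matrix, up to `n`.
  have hent : ∀ (a : Fin n₁) (l : Fin s) (i : Fin k),
      (n : ℂ) * (hankelLift hn Z * X) (a, l) i = ((fourierMat ζ n n₁)ᴴ * Y l) a i := by
    intro a l i
    rw [Matrix.mul_apply, Matrix.mul_apply, Finset.mul_sum]
    simp only [hankelLift, Matrix.of_apply, ← mul_assoc, hinv]
    simp only [Finset.sum_mul, hY, hT, Matrix.mul_apply, Matrix.of_apply, Finset.mul_sum,
      Matrix.conjTranspose_apply, fourierMat]
    rw [Finset.sum_comm]
    refine Finset.sum_congr rfl fun t _ => ?_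
    refine Finset.sum_congr rfl fun q _ => ?_
    refine Finset.sum_congr rfl fun j _ => ?_
    rw [mul_add, pow_add, star_mul, star_pow ζ ((t : ℕ) * (q : ℕ)), hcj]
    ring
  have hYn : ∑ l, ‖Y l‖ ^ 2 ≤ c ^ 2 * (n * ‖X‖ ^ 2) := by
    have hTn : ‖T‖ ^ 2 = n * ‖X‖ ^ 2 := by
      rw [hT, norm_fourierMat_mul hζ.inv (by omega : n₂ ≤ n), mul_pow, Real.sq_sqrt hnR.le]
    rw [← hTn]
    simp only [frob_sq]
    rw [Finset.sum_comm, Finset.mul_sum]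
    refine Finset.sum_le_sum fun t _ => ?_
    simp only [hY, Matrix.of_apply, norm_mul, mul_pow]
    simp only [← Finset.mul_sum]
    rw [← Finset.sum_mul]
    exact mul_le_mul_of_nonneg_right (h t) (by positivity)
  have hF : ∀ W : Matrix (Fin n) (Fin k) ℂ, ‖(fourierMat ζ n n₁)ᴴ * W‖ ≤ Real.sqrt n * ‖W‖ :=
    norm_conjT_mul_le (Real.sqrt_nonneg _) fun W => (norm_fourierMat_mul hζ (by omega) W).le
  have hsq : (n : ℝ) ^ 2 * ‖hankelLift hn Z * X‖ ^ 2 = ∑ l, ‖(fourierMat ζ n n₁)ᴴ * Y l‖ ^ 2 := by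
    simp only [frob_sq, Fintype.sum_prod_type]
    rw [Finset.sum_comm, Finset.mul_sum]
    refine Finset.sum_congr rfl fun l _ => ?_
    rw [Finset.mul_sum]
    refine Finset.sum_congr rfl fun a _ => ?_
    rw [Finset.mul_sum]
    refine Finset.sum_congr rfl fun i _ => ?_
    rw [← hent, norm_mul, mul_pow]
    simp
  refine (pow_le_pow_iff_left₀ (norm_nonneg _) (by positivity) two_ne_zero).1 ?_
  have h3 : (n : ℝ) ^ 2 * ‖hankelLift hn Z * X‖ ^ 2 ≤ n * (c ^ 2 * (n * ‖X‖ ^ 2)) := by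
    rw [hsq]
    calc _ ≤ ∑ l, n * ‖Y l‖ ^ 2 := by
          refine Finset.sum_le_sum fun l _ => ?_
          have := pow_le_pow_left₀ (norm_nonneg _) (hF (Y l)) 2
          rwa [mul_pow, Real.sq_sqrt hnR.le] at this
      _ = n * ∑ l, ‖Y l‖ ^ 2 := by rw [Finset.mul_sum]
      _ ≤ _ := by gcongr
  have h4 : (n : ℝ) ^ 2 * ‖hankelLift hn Z * X‖ ^ 2 ≤ n ^ 2 * (c * ‖X‖) ^ 2 := by
    refine h3.trans_eq (by ring)
  exact le_of_mul_le_mul_left h4 (by positivity)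

end Fourier

/-! ### Antidiagonal counts and averages over antidiagonals. -/

section Weights

variable {n N₁ N₂ : ℕ}

theorem antidiagCard_comm (N₁ N₂ i : ℕ) : antidiagCard N₁ N₂ i = antidiagCard N₂ N₁ i := by
  rw [antidiagCard, antidiagCard]
  refine Finset.card_bij (fun p _ => p.swap) ?_ ?_ ?_
  · intro p hp
    simp only [Finset.mem_filter, Finset.mem_univ, true_and, Prod.fst_swap, Prod.snd_swap] at hp ⊢
    omega
  · intro p _ q _ h
    exact Prod.swap_injective h
  · intro p hp
    refine ⟨p.swap, ?_, by simp⟩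
    simp only [Finset.mem_filter, Finset.mem_univ, true_and, Prod.fst_swap, Prod.snd_swap] at hp ⊢
    omega

theorem le_antidiagCard (hn : N₁ + N₂ = n + 1) {j m : ℕ} (h1 : m ≤ j + 1) (h2 : m + j ≤ n)
    (h3 : m ≤ N₁) (h4 : m ≤ N₂) : m ≤ antidiagCard N₁ N₂ j := by
  have : m = (Finset.univ : Finset (Fin m)).card := by simp
  conv_lhs => rw [this]
  rw [antidiagCard]
  -- The smallest admissible first index is `j + 1 - N₂`, truncated at `0`; it and its `m - 1`
  -- successors are all admissible.
  refine Finset.card_le_card_of_injOn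
    (fun t => (⟨j + 1 - N₂ + t, by omega⟩, ⟨j - (j + 1 - N₂) - t, by omega⟩)) ?_ ?_
  · intro t _
    simp
    omega
  · intro t _ t' _ h
    simp at h
    omega

/-- `w_j` is at least the minimum of `j + 1`, `n - j`, `N₁`, `N₂`, and the reciprocal of a minimum
is at most the sum of the reciprocals. The first two give harmonic sums, hence a single logarithm.
-/
theorem inv_antidiagCard_le (hn : N₁ + N₂ = n + 1) (h₁ : 0 < N₁) (h₂ : 0 < N₂) (j : Fin n) :
    ((antidiagCard N₁ N₂ j : ℝ))⁻¹
      ≤ ((j : ℕ) + 1 : ℝ)⁻¹ + (((Fin.rev j : Fin n) : ℕ) + 1 : ℝ)⁻¹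
        + ((N₁ : ℝ)⁻¹ + (N₂ : ℝ)⁻¹) := by
  have hj := j.2
  have key : ∀ m : ℕ, 0 < m → m ≤ antidiagCard N₁ N₂ j →
      ((antidiagCard N₁ N₂ j : ℝ))⁻¹ ≤ (m : ℝ)⁻¹ := fun m hm h =>
    inv_anti₀ (by exact_mod_cast hm) (by exact_mod_cast h)
  have p1 : (0 : ℝ) ≤ ((j : ℕ) + 1 : ℝ)⁻¹ := by positivity
  have p2 : (0 : ℝ) ≤ (((Fin.rev j : Fin n) : ℕ) + 1 : ℝ)⁻¹ := by positivity
  have p3 : (0 : ℝ) ≤ (N₁ : ℝ)⁻¹ := by positivity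
  have p4 : (0 : ℝ) ≤ (N₂ : ℝ)⁻¹ := by positivity
  have hr : ((Fin.rev j : Fin n) : ℕ) = n - (j + 1) := Fin.val_rev j
  obtain ⟨a, ha⟩ : ∃ a, a = min (min ((j : ℕ) + 1) (n - j)) (min N₁ N₂) := ⟨_, rfl⟩
  have hle := le_antidiagCard hn (j := j) (m := a) (by omega) (by omega) (by omega) (by omega)
  have ha0 : 0 < a := by omega
  have hk := key a ha0 hle
  have : a = (j : ℕ) + 1 ∨ a = ((Fin.rev j : Fin n) : ℕ) + 1 ∨ a = N₁ ∨ a = N₂ := by omega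
  rcases this with h | h | h | h <;> rw [h] at hk <;> push_cast at hk <;> linarith

theorem sum_inv_succ_le (n : ℕ) : ∑ j : Fin n, ((j : ℕ) + 1 : ℝ)⁻¹ ≤ 1 + Real.log n := by
  have h := harmonic_le_one_add_log n
  rw [harmonic] at h
  push_cast at h
  rwa [Fin.sum_univ_eq_sum_range (fun j => ((j : ℝ) + 1)⁻¹) n]

theorem sum_inv_antidiagCard_le (hn : N₁ + N₂ = n + 1) (h₁ : 0 < N₁) (h₂ : 0 < N₂)
    (J : Finset (Fin n)) :
    ∑ j ∈ J, ((antidiagCard N₁ N₂ j : ℝ))⁻¹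
      ≤ 2 * (1 + Real.log n) + J.card * ((N₁ : ℝ)⁻¹ + (N₂ : ℝ)⁻¹) := by
  refine (Finset.sum_le_sum fun j _ => inv_antidiagCard_le hn h₁ h₂ j).trans ?_
  rw [Finset.sum_add_distrib, Finset.sum_add_distrib, Finset.sum_const, nsmul_eq_mul]
  have a1 : ∑ j ∈ J, ((j : ℕ) + 1 : ℝ)⁻¹ ≤ 1 + Real.log n :=
    (Finset.sum_le_univ_sum_of_nonneg fun j => by positivity).trans (sum_inv_succ_le n)
  have a2 : ∑ j ∈ J, (((Fin.rev j : Fin n) : ℕ) + 1 : ℝ)⁻¹ ≤ 1 + Real.log n := by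
    refine (Finset.sum_le_univ_sum_of_nonneg fun j => by positivity).trans ?_
    refine le_trans (le_of_eq ?_) (sum_inv_succ_le n)
    exact Equiv.sum_comp Fin.revPerm (fun j : Fin n => ((j : ℕ) + 1 : ℝ)⁻¹)
  linarith

/-- The average of `u a` over the pairs `(a, k)` with `a + k = j`. -/
noncomputable def antidiagAvg (N₁ N₂ : ℕ) (u : Fin N₁ → ℝ) (j : ℕ) : ℝ :=
  ((antidiagCard N₁ N₂ j : ℝ))⁻¹ * ∑ a : Fin N₁, ∑ k : Fin N₂, if (a : ℕ) + k = j then u a else 0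

theorem sum_ite_add_eq_le {f : ℝ} (hf : 0 ≤ f) (a j : ℕ) :
    ∑ k : Fin N₂, (if a + (k : ℕ) = j then f else 0) ≤ f := by
  by_cases h : ∃ k : Fin N₂, a + (k : ℕ) = j
  · obtain ⟨k, hk⟩ := h
    rw [Finset.sum_eq_single k]
    · rw [if_pos hk]
    · intro k' _ hk'
      rw [if_neg]
      intro h
      exact hk' (Fin.ext (by omega))
    · simp
  · push Not at h
    rw [Finset.sum_eq_zero fun k _ => if_neg (h k)]
    exact hf

theorem antidiagAvg_nonneg {u : Fin N₁ → ℝ} (hu : ∀ a, 0 ≤ u a) (j : ℕ) :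
    0 ≤ antidiagAvg N₁ N₂ u j := by
  refine mul_nonneg (by positivity) (Finset.sum_nonneg fun a _ => Finset.sum_nonneg fun k _ => ?_)
  split_ifs
  exacts [hu a, le_rfl]

theorem antidiagAvg_le {u : Fin N₁ → ℝ} {β : ℝ} (hβ : 0 ≤ β) (hu : ∀ a, u a ≤ β) (j : ℕ) :
    antidiagAvg N₁ N₂ u j ≤ β := by
  have h : (∑ a : Fin N₁, ∑ k : Fin N₂, if (a : ℕ) + k = j then u a else 0)
      ≤ antidiagCard N₁ N₂ j * β := by
    rw [antidiagCard, Finset.card_filter, Nat.cast_sum, Fintype.sum_prod_type, Finset.sum_mul]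
    refine Finset.sum_le_sum fun a _ => ?_
    rw [Finset.sum_mul]
    refine Finset.sum_le_sum fun k _ => ?_
    split_ifs with h
    · simpa using hu a
    · simp
  rw [antidiagAvg]
  rcases Nat.eq_zero_or_pos (antidiagCard N₁ N₂ j) with h0 | h0
  · simpa [h0] using hβ
  · rw [inv_mul_le_iff₀ (by exact_mod_cast h0)]
    exact h

theorem antidiagAvg_le_sum {u : Fin N₁ → ℝ} (hu : ∀ a, 0 ≤ u a) (j : ℕ) :
    antidiagAvg N₁ N₂ u j ≤ (∑ a, u a) * ((antidiagCard N₁ N₂ j : ℝ))⁻¹ := by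
  rw [antidiagAvg, mul_comm]
  refine mul_le_mul_of_nonneg_right ?_ (by positivity)
  exact Finset.sum_le_sum fun a _ => sum_ite_add_eq_le (hu a) a j

/-- The mass `u a` is spread over the `N₂` antidiagonals `a, …, a + N₂ - 1` with weights `1 / w_j`.
The condition `N₂ ≤ N₁` keeps the term `N₂ (1/N₁ + 1/N₂)` at most `2`; without it the ratio `N₂ /
N₁` would remain. -/
theorem sum_antidiagAvg_le (hn : N₁ + N₂ = n + 1) (h₂ : 0 < N₂) (hle : N₂ ≤ N₁)
    {u : Fin N₁ → ℝ} (hu : ∀ a, 0 ≤ u a) :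
    ∑ j : Fin n, antidiagAvg N₁ N₂ u j ≤ (∑ a, u a) * (2 * (1 + Real.log n) + 2) := by
  have h₁ : 0 < N₁ := by omega
  simp only [antidiagAvg, Finset.mul_sum]
  rw [Finset.sum_comm, Finset.sum_mul]
  refine Finset.sum_le_sum fun a _ => ?_
  rw [Finset.sum_comm]
  have e : ∀ k : Fin N₂, (∑ j : Fin n, ((antidiagCard N₁ N₂ j : ℝ))⁻¹ *
      if (a : ℕ) + k = j then u a else 0)
      = u a * ((antidiagCard N₁ N₂ ((a : ℕ) + k) : ℝ))⁻¹ := by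
    intro k
    rw [Finset.sum_eq_single (⟨(a : ℕ) + k, by omega⟩ : Fin n)]
    · simp [mul_comm]
    · intro j _ hj
      rw [if_neg (fun h => hj (Fin.ext h.symm)), mul_zero]
    · simp
  simp only [e]
  rw [← Finset.mul_sum]
  refine mul_le_mul_of_nonneg_left ?_ (hu a)
  have hinj : Function.Injective (fun k : Fin N₂ => (⟨(a : ℕ) + k, by omega⟩ : Fin n)) := by
    intro k k' h
    simp only [Fin.mk.injEq] at h
    exact Fin.ext (by omega)
  have h := sum_inv_antidiagCard_le hn h₁ h₂ (Finset.univ.map ⟨_, hinj⟩)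
  rw [Finset.sum_map] at h
  refine h.trans ?_
  rw [Finset.card_map, Finset.card_univ, Fintype.card_fin]
  have hN₂ : (0 : ℝ) < N₂ := by exact_mod_cast h₂
  have h3 : (N₁ : ℝ)⁻¹ ≤ (N₂ : ℝ)⁻¹ := inv_anti₀ hN₂ (by exact_mod_cast hle)
  have h4 : (N₂ : ℝ) * ((N₁ : ℝ)⁻¹ + (N₂ : ℝ)⁻¹) ≤ N₂ * ((N₂ : ℝ)⁻¹ + (N₂ : ℝ)⁻¹) := by gcongr
  have h5 : (N₂ : ℝ) * ((N₂ : ℝ)⁻¹ + (N₂ : ℝ)⁻¹) = 2 := by field_simp; norm_num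
  linarith

end Weights

/-! ### A Schur test adapted to kernels with overlapping supports. -/

section Schur

variable {I I' κ : Type*} [Fintype I] [Fintype I'] [Fintype κ]

/-- A Schur-type test for a kernel supported on a relation. -/
theorem norm_kernel_sum_le {K : I → I' → ℂ} {rel : I → I' → Prop} [∀ i i', Decidable (rel i i')]
    (hrel : ∀ i i', ¬ rel i i' → K i i' = 0) {S : ℝ}
    (hS : ∀ i', ∑ i, (if rel i i' then ∑ i'', ‖K i i''‖ ^ 2 else 0) ≤ S)
    (x : I → ℂ) (y : I' → ℂ) :
    ‖∑ i, ∑ i', star (x i) * y i' * K i i'‖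
      ≤ Real.sqrt S * (Real.sqrt (∑ i, ‖x i‖ ^ 2) * Real.sqrt (∑ i', ‖y i'‖ ^ 2)) := by
  -- Cauchy-Schwarz in each row keeps only the `y i'` related to `i`. After summing over `i`, each
  -- `y i'` is weighted by the squared row norms of its relatives, not of all rows.
  have step : ∀ i, ‖∑ i', star (x i) * y i' * K i i'‖
      ≤ ‖x i‖ * Real.sqrt ((∑ i', ‖K i i'‖ ^ 2) *
          ∑ i', if rel i i' then ‖y i'‖ ^ 2 else 0) := by
    intro i
    have e : ∑ i', star (x i) * y i' * K i i'
        = star (x i) * ∑ i', K i i' * (if rel i i' then y i' else 0) := by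
      rw [Finset.mul_sum]
      refine Finset.sum_congr rfl fun i' _ => ?_
      split_ifs with h
      · ring
      · rw [hrel i i' h]; simp
    rw [e, norm_mul, norm_star]
    gcongr
    refine Real.le_sqrt_of_sq_le ?_
    calc ‖∑ i', K i i' * (if rel i i' then y i' else 0)‖ ^ 2
        ≤ (∑ i', ‖K i i'‖ * ‖if rel i i' then y i' else 0‖) ^ 2 := by
          gcongr
          refine (norm_sum_le _ _).trans_eq ?_
          simp only [norm_mul]
      _ ≤ (∑ i', ‖K i i'‖ ^ 2) * ∑ i', ‖if rel i i' then y i' else 0‖ ^ 2 :=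
          Finset.sum_mul_sq_le_sq_mul_sq _ _ _
      _ = _ := by
          congr 1
          refine Finset.sum_congr rfl fun i' _ => ?_
          split_ifs <;> simp
  refine (norm_sum_le _ _).trans ((Finset.sum_le_sum fun i _ => step i).trans ?_)
  have hcs := Finset.sum_mul_sq_le_sq_mul_sq Finset.univ (fun i => ‖x i‖)
    (fun i => Real.sqrt ((∑ i', ‖K i i'‖ ^ 2) * ∑ i', if rel i i' then ‖y i'‖ ^ 2 else 0))
  have hpos : ∀ i, 0 ≤ (∑ i', ‖K i i'‖ ^ 2) * ∑ i', if rel i i' then ‖y i'‖ ^ 2 else 0 := by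
    intro i
    refine mul_nonneg (by positivity) (Finset.sum_nonneg fun i' _ => ?_)
    split_ifs <;> positivity
  simp only [Real.sq_sqrt (hpos _)] at hcs
  have hsum : ∑ i, (∑ i', ‖K i i'‖ ^ 2) * (∑ i', if rel i i' then ‖y i'‖ ^ 2 else 0)
      ≤ S * ∑ i', ‖y i'‖ ^ 2 := by
    simp only [Finset.mul_sum]
    rw [Finset.sum_comm]
    refine Finset.sum_le_sum fun i' _ => ?_
    refine le_trans (le_of_eq ?_) (mul_le_mul_of_nonneg_right (hS i') (sq_nonneg _))
    rw [Finset.sum_mul]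
    refine Finset.sum_congr rfl fun i _ => ?_
    split_ifs <;> simp
  refine (Real.le_sqrt_of_sq_le hcs).trans ?_
  by_cases hI : Nonempty I'
  · have hS0 : 0 ≤ S := by
      obtain ⟨i'⟩ := hI
      refine le_trans (Finset.sum_nonneg fun i _ => ?_) (hS i')
      split_ifs <;> positivity
    rw [← Real.sqrt_mul (by positivity), ← Real.sqrt_mul hS0]
    refine Real.sqrt_le_sqrt ?_
    calc _ ≤ (∑ i, ‖x i‖ ^ 2) * (S * ∑ i', ‖y i'‖ ^ 2) := by gcongr
      _ = _ := by ring
  · rw [not_nonempty_iff] at hI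
    simp

/-- The Schur-type test for a kernel dominated by a sum of products of profiles. -/
theorem norm_kernel_sum_le_of_profile {K : I → I' → ℂ} {N : I → κ → ℝ} {N' : I' → κ → ℝ}
    (hN : ∀ i j, 0 ≤ N i j) (hN' : ∀ i j, 0 ≤ N' i j) {T Λ S : ℝ} (hT : 0 ≤ T)
    (hK : ∀ i i', ‖K i i'‖ ^ 2 ≤ T * ∑ j, N i j * N' i' j) {p p' : κ → ℝ}
    (hp : ∀ j, ∑ i, N i j ≤ Λ * p j) (hp' : ∀ j, ∑ i, N' i j ≤ Λ * p' j)
    (J : I' → Finset κ)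
    (hJ : ∀ i i' j j', N i j' * N' i' j' ≠ 0 → N i j ≠ 0 → j ∈ J i')
    (hS : ∀ i', T * Λ ^ 2 * ∑ j ∈ J i', p j * p' j ≤ S) (x : I → ℂ) (y : I' → ℂ) :
    ‖∑ i, ∑ i', star (x i) * y i' * K i i'‖
      ≤ Real.sqrt S * (Real.sqrt (∑ i, ‖x i‖ ^ 2) * Real.sqrt (∑ i', ‖y i'‖ ^ 2)) := by
  classical
  refine norm_kernel_sum_le (rel := fun i i' => ∃ j, N i j * N' i' j ≠ 0) ?_ ?_ x y
  · intro i i' h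
    push Not at h
    have := hK i i'
    rw [Finset.sum_eq_zero fun j _ => h j, mul_zero] at this
    simpa using le_antisymm this (sq_nonneg _)
  · intro i'
    refine le_trans ?_ (hS i')
    have h1 : ∀ i, (if ∃ j, N i j * N' i' j ≠ 0 then ∑ i'', ‖K i i''‖ ^ 2 else 0)
        ≤ ∑ j ∈ J i', T * (N i j * (Λ * p' j)) := by
      intro i
      have hnn : ∀ j, 0 ≤ T * (N i j * (Λ * p' j)) := fun j =>
        mul_nonneg hT (mul_nonneg (hN i j)
          ((Finset.sum_nonneg fun i _ => hN' i j).trans (hp' j)))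
      split_ifs with h
      · obtain ⟨j₀, hj₀⟩ := h
        calc ∑ i'', ‖K i i''‖ ^ 2 ≤ ∑ i'', T * ∑ j, N i j * N' i'' j :=
              Finset.sum_le_sum fun i'' _ => hK i i''
          _ = ∑ j, T * (N i j * ∑ i'', N' i'' j) := by
              simp only [Finset.mul_sum]
              rw [Finset.sum_comm]
          _ = ∑ j ∈ J i', T * (N i j * ∑ i'', N' i'' j) := by
              symm
              refine Finset.sum_subset (Finset.subset_univ _) fun j _ hj => ?_
              have : N i j = 0 := by
                by_contra hc
                exact hj (hJ i i' j j₀ hj₀ hc)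
              simp [this]
          _ ≤ _ := by
              refine Finset.sum_le_sum fun j _ => ?_
              exact mul_le_mul_of_nonneg_left (mul_le_mul_of_nonneg_left (hp' j) (hN i j)) hT
      · exact Finset.sum_nonneg fun j _ => hnn j
    refine (Finset.sum_le_sum fun i _ => h1 i).trans ?_
    rw [Finset.sum_comm, Finset.mul_sum]
    refine Finset.sum_le_sum fun j _ => ?_
    rw [← Finset.mul_sum, ← Finset.sum_mul]
    have h2 : 0 ≤ Λ * p' j := (Finset.sum_nonneg fun i _ => hN' i j).trans (hp' j)
    calc T * ((∑ i, N i j) * (Λ * p' j)) ≤ T * (Λ * p j * (Λ * p' j)) :=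
          mul_le_mul_of_nonneg_left (mul_le_mul_of_nonneg_right (hp j) h2) hT
      _ = _ := by ring

end Schur

/-! ### Schur bounds for windowed atoms. -/

section Kernel

variable {I I' : Type*} [Fintype I] [Fintype I'] {n N₁ N₂ : ℕ}

/-- Kernel bound for a single family of atoms, the `i`-th being supported on the window of length
`N₁` at `pos i`. -/
theorem norm_kernel_sum_le_self (hn : N₁ + N₂ = n + 1) (h₁ : 0 < N₁) (h₂ : 0 < N₂)
    {K : I → I → ℂ} {N : I → Fin n → ℝ} (hN : ∀ i j, 0 ≤ N i j) (pos : I → ℕ)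
    (hpos : ∀ i j, N i j ≠ 0 → pos i ≤ j ∧ (j : ℕ) < pos i + N₁) {T Λ β : ℝ} (hT : 0 ≤ T)
    (hβ : 0 ≤ β) (hK : ∀ i i', ‖K i i'‖ ^ 2 ≤ T * ∑ j, N i j * N i' j)
    {u : Fin N₁ → ℝ} (hu : ∀ a, 0 ≤ u a) (huβ : ∀ a, u a ≤ β)
    (hp : ∀ j, ∑ i, N i j ≤ Λ * antidiagAvg N₁ N₂ u j) (x y : I → ℂ) :
    ‖∑ i, ∑ i', star (x i) * y i' * K i i'‖
      ≤ Real.sqrt (T * Λ ^ 2 * (β * ((∑ a, u a) * (2 * (1 + Real.log n) + 8)))) *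
        (Real.sqrt (∑ i, ‖x i‖ ^ 2) * Real.sqrt (∑ i', ‖y i'‖ ^ 2)) := by
  have hu0 : 0 ≤ ∑ a, u a := Finset.sum_nonneg fun a _ => hu a
  have hA0 := fun j : ℕ => antidiagAvg_nonneg (N₂ := N₂) hu j
  have hAβ := fun j : ℕ => antidiagAvg_le (N₂ := N₂) hβ huβ j
  -- For short windows (`N₁ ≤ N₂`) the summed averages carry no uniform bound, but two atoms
  -- interact only if their windows meet, so `j` stays within `2 N₁` of `pos i'` and `|J| (1/N₁ +
  -- 1/N₂) ≤ 8`. For long windows the global sum of the averages is enough.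
  rcases le_or_gt N₁ N₂ with hle | hlt
  · refine norm_kernel_sum_le_of_profile hN hN hT hK hp hp
      (fun i' => Finset.univ.filter fun j : Fin n =>
        (j : ℕ) < pos i' + 2 * N₁ ∧ pos i' < (j : ℕ) + 2 * N₁) ?_ ?_ x y
    · intro i i' j j' h1 h2
      have a1 := hpos i j' (left_ne_zero_of_mul h1)
      have a2 := hpos i' j' (right_ne_zero_of_mul h1)
      have a3 := hpos i j h2
      simp only [Finset.mem_filter, Finset.mem_univ, true_and]
      omega
    · intro i'
      refine mul_le_mul_of_nonneg_left ?_ (by positivity)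
      set J := Finset.univ.filter fun j : Fin n =>
        (j : ℕ) < pos i' + 2 * N₁ ∧ pos i' < (j : ℕ) + 2 * N₁ with hJ
      have hcard : J.card ≤ 4 * N₁ := by
        have : J.card ≤ (Finset.Ico (pos i' + 1 - 2 * N₁) (pos i' + 2 * N₁)).card := by
          refine Finset.card_le_card_of_injOn (fun j => (j : ℕ)) ?_ ?_
          · intro j hj
            simp only [hJ, Finset.coe_filter, Finset.mem_univ, true_and, Set.mem_ofPred_eq] at hj
            simp only [Finset.coe_Ico, Set.mem_Ico]
            omega
          · intro j _ j' _ h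
            exact Fin.ext h
        rw [Nat.card_Ico] at this
        omega
      calc ∑ j ∈ J, antidiagAvg N₁ N₂ u j * antidiagAvg N₁ N₂ u j
          ≤ ∑ j ∈ J, β * ((∑ a, u a) * ((antidiagCard N₁ N₂ j : ℝ))⁻¹) :=
            Finset.sum_le_sum fun j _ => mul_le_mul (hAβ j) (antidiagAvg_le_sum hu j) (hA0 j) hβ
        _ = β * ((∑ a, u a) * ∑ j ∈ J, ((antidiagCard N₁ N₂ j : ℝ))⁻¹) := by
            rw [Finset.mul_sum, Finset.mul_sum]
        _ ≤ _ := by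
            refine mul_le_mul_of_nonneg_left (mul_le_mul_of_nonneg_left ?_ hu0) hβ
            refine (sum_inv_antidiagCard_le hn h₁ h₂ J).trans ?_
            have hc : (J.card : ℝ) ≤ 4 * N₁ := by exact_mod_cast hcard
            have hN₁ : (0 : ℝ) < N₁ := by exact_mod_cast h₁
            have h3 : (N₂ : ℝ)⁻¹ ≤ (N₁ : ℝ)⁻¹ := inv_anti₀ hN₁ (by exact_mod_cast hle)
            have h4 : (J.card : ℝ) * ((N₁ : ℝ)⁻¹ + (N₂ : ℝ)⁻¹)
                ≤ 4 * N₁ * ((N₁ : ℝ)⁻¹ + (N₁ : ℝ)⁻¹) := by gcongr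
            have h5 : 4 * (N₁ : ℝ) * ((N₁ : ℝ)⁻¹ + (N₁ : ℝ)⁻¹) = 8 := by field_simp; norm_num
            linarith
  · refine norm_kernel_sum_le_of_profile hN hN hT hK hp hp (fun _ => Finset.univ)
      (fun _ _ _ _ _ _ => Finset.mem_univ _) ?_ x y
    intro i'
    refine mul_le_mul_of_nonneg_left ?_ (by positivity)
    calc ∑ j : Fin n, antidiagAvg N₁ N₂ u j * antidiagAvg N₁ N₂ u j
        ≤ ∑ j : Fin n, β * antidiagAvg N₁ N₂ u j :=
          Finset.sum_le_sum fun j _ => mul_le_mul_of_nonneg_right (hAβ j) (hA0 j)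
      _ = β * ∑ j : Fin n, antidiagAvg N₁ N₂ u j := by rw [Finset.mul_sum]
      _ ≤ _ := by
          refine mul_le_mul_of_nonneg_left ((sum_antidiagAvg_le hn h₂ hlt.le hu).trans ?_) hβ
          gcongr
          norm_num

/-- Kernel bound for two families of atoms with complementary window lengths. -/
theorem norm_kernel_sum_le_cross (hn : N₁ + N₂ = n + 1) (h₁ : 0 < N₁) (h₂ : 0 < N₂)
    {K : I → I' → ℂ} {N : I → Fin n → ℝ} {N' : I' → Fin n → ℝ} (hN : ∀ i j, 0 ≤ N i j)
    (hN' : ∀ i j, 0 ≤ N' i j) {T Λ β c : ℝ} (hT : 0 ≤ T)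
    (hβ : 0 ≤ β) (hK : ∀ i i', ‖K i i'‖ ^ 2 ≤ T * ∑ j, N i j * N' i' j)
    {u : Fin N₁ → ℝ} (hu : ∀ a, 0 ≤ u a) (huβ : ∀ a, u a ≤ β) (huc : ∑ a, u a = c)
    {v : Fin N₂ → ℝ} (hv : ∀ a, 0 ≤ v a) (hvβ : ∀ a, v a ≤ β) (hvc : ∑ a, v a = c)
    (hp : ∀ j, ∑ i, N i j ≤ Λ * antidiagAvg N₁ N₂ u j)
    (hp' : ∀ j, ∑ i, N' i j ≤ Λ * antidiagAvg N₂ N₁ v j) (x : I → ℂ) (y : I' → ℂ) :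
    ‖∑ i, ∑ i', star (x i) * y i' * K i i'‖
      ≤ Real.sqrt (T * Λ ^ 2 * (β * (c * (2 * (1 + Real.log n) + 8)))) *
        (Real.sqrt (∑ i, ‖x i‖ ^ 2) * Real.sqrt (∑ i', ‖y i'‖ ^ 2)) := by
  have hc : 0 ≤ c := huc ▸ Finset.sum_nonneg fun a _ => hu a
  have hA0 := fun j : ℕ => antidiagAvg_nonneg (N₂ := N₂) hu j
  have hAβ := fun j : ℕ => antidiagAvg_le (N₂ := N₂) hβ huβ j
  have hB0 := fun j : ℕ => antidiagAvg_nonneg (N₂ := N₁) hv j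
  have hBβ := fun j : ℕ => antidiagAvg_le (N₂ := N₁) hβ hvβ j
  refine norm_kernel_sum_le_of_profile hN hN' hT hK hp hp' (fun _ => Finset.univ)
    (fun _ _ _ _ _ _ => Finset.mem_univ _) ?_ x y
  intro i'
  refine mul_le_mul_of_nonneg_left ?_ (by positivity)
  -- The window lengths are `N₁` and `N₂`, so the averages of one of the two families have a
  -- controlled sum; the other family is bounded by `β`.
  rcases le_or_gt N₂ N₁ with hle | hlt
  · calc ∑ j : Fin n, antidiagAvg N₁ N₂ u j * antidiagAvg N₂ N₁ v j
        ≤ ∑ j : Fin n, antidiagAvg N₁ N₂ u j * β :=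
          Finset.sum_le_sum fun j _ => mul_le_mul_of_nonneg_left (hBβ j) (hA0 j)
      _ = β * ∑ j : Fin n, antidiagAvg N₁ N₂ u j := by rw [← Finset.sum_mul, mul_comm]
      _ ≤ _ := by
          refine mul_le_mul_of_nonneg_left ((sum_antidiagAvg_le hn h₂ hle hu).trans ?_) hβ
          rw [huc]
          gcongr
          norm_num
  · calc ∑ j : Fin n, antidiagAvg N₁ N₂ u j * antidiagAvg N₂ N₁ v j
        ≤ ∑ j : Fin n, β * antidiagAvg N₂ N₁ v j :=
          Finset.sum_le_sum fun j _ => mul_le_mul_of_nonneg_right (hAβ j) (hB0 j)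
      _ = β * ∑ j : Fin n, antidiagAvg N₂ N₁ v j := by rw [← Finset.mul_sum]
      _ ≤ _ := by
          refine mul_le_mul_of_nonneg_left
            ((sum_antidiagAvg_le ((add_comm _ _).trans hn) h₁ hlt.le hv).trans ?_) hβ
          rw [hvc]
          gcongr
          norm_num

end Kernel

/-! ### The isometry defect on the tangent space. -/

section Tangent

variable {s n n₁ n₂ r : ℕ}

/-- `⟨𝒜 G, 𝒜 G'⟩ - ⟨G, G'⟩`. -/
noncomputable def measForm (B : Matrix (Fin n) (Fin s) ℂ) (G G' : Matrix (Fin s) (Fin n) ℂ) : ℂ :=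
  ∑ j, (star (measA B G j) * measA B G' j - ∑ l, star (G l j) * G' l j)

theorem isoDefect_eq_measForm (B : Matrix (Fin n) (Fin s) ℂ)
    (X Y : Matrix (Fin n₁ × Fin s) (Fin n₂) ℂ) :
    isoDefect B X Y = (measForm B (liftGAdj n X) (liftGAdj n Y)).re := by
  rw [isoDefect, reIP_eq_sum, reIP_eq_sum, measForm, Finset.sum_sub_distrib, Complex.sub_re,
    Finset.sum_comm (s := (Finset.univ : Finset (Fin s)))]
  simp [measCol]

theorem liftGAdj_smul (c : ℂ) (X : Matrix (Fin n₁ × Fin s) (Fin n₂) ℂ) :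
    liftGAdj n (c • X) = c • liftGAdj n X := by
  ext l i
  simp only [liftGAdj, Matrix.of_apply, Matrix.smul_apply, smul_eq_mul, Finset.mul_sum]
  refine Finset.sum_congr rfl fun a _ => Finset.sum_congr rfl fun k _ => ?_
  split_ifs
  · ring
  · simp

theorem liftGAdj_sum {I : Type*} (t : Finset I) (x : I → ℂ)
    (Φ : I → Matrix (Fin n₁ × Fin s) (Fin n₂) ℂ) :
    liftGAdj n (∑ i ∈ t, x i • Φ i) = ∑ i ∈ t, x i • liftGAdj n (Φ i) := by
  classical
  induction t using Finset.induction_on with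
  | empty => ext; simp [liftGAdj]
  | insert i t hi ih => rw [Finset.sum_insert hi, Finset.sum_insert hi, liftGAdj_add, ih,
      liftGAdj_smul]

theorem measA_sum {I : Type*} [Fintype I] (B : Matrix (Fin n) (Fin s) ℂ) (x : I → ℂ)
    (G : I → Matrix (Fin s) (Fin n) ℂ) (j : Fin n) :
    measA B (∑ i, x i • G i) j = ∑ i, x i * measA B (G i) j := by
  simp only [measA_apply, Matrix.sum_apply, Matrix.smul_apply, smul_eq_mul, Finset.mul_sum]
  rw [Finset.sum_comm]
  exact Finset.sum_congr rfl fun i _ => Finset.sum_congr rfl fun l _ => by ring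

theorem measForm_sum {I I' : Type*} [Fintype I] [Fintype I'] (B : Matrix (Fin n) (Fin s) ℂ)
    (x : I → ℂ) (y : I' → ℂ) (G : I → Matrix (Fin s) (Fin n) ℂ)
    (G' : I' → Matrix (Fin s) (Fin n) ℂ) :
    measForm B (∑ i, x i • G i) (∑ i, y i • G' i)
      = ∑ i, ∑ i', star (x i) * y i' * measForm B (G i) (G' i') := by
  have hprod : ∀ (f : I → ℂ) (g : I' → ℂ), star (∑ i, x i * f i) * (∑ i', y i' * g i')
      = ∑ i, ∑ i', star (x i) * y i' * (star (f i) * g i') := by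
    intro f g
    rw [star_sum, Finset.sum_mul_sum]
    refine Finset.sum_congr rfl fun i _ => Finset.sum_congr rfl fun i' _ => ?_
    rw [star_mul]
    ring
  simp only [measForm, measA_sum, Matrix.sum_apply, Matrix.smul_apply, smul_eq_mul, hprod]
  simp only [Finset.mul_sum, mul_sub]
  rw [Finset.sum_sub_distrib]
  simp only [Finset.sum_sub_distrib]
  congr 1
  · rw [Finset.sum_comm]
    exact Finset.sum_congr rfl fun i _ => Finset.sum_comm
  · have : ∀ j : Fin n, (∑ l : Fin s, ∑ i : I, ∑ i' : I',
        star (x i) * y i' * (star (G i l j) * G' i' l j))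
        = ∑ i : I, ∑ i' : I', ∑ l : Fin s, star (x i) * y i' * (star (G i l j) * G' i' l j) := by
      intro j
      rw [Finset.sum_comm]
      exact Finset.sum_congr rfl fun i _ => Finset.sum_comm
    simp only [this]
    rw [Finset.sum_comm]
    exact Finset.sum_congr rfl fun i _ => Finset.sum_comm

/-- `U_c e_kᵀ`, for `p = (k, c)`. -/
def leftAtom (U : Matrix (Fin n₁ × Fin s) (Fin r) ℂ) (p : Fin n₂ × Fin r) :
    Matrix (Fin n₁ × Fin s) (Fin n₂) ℂ := Matrix.of fun q k => if k = p.1 then U q p.2 else 0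

/-- `e_q V_cᴴ`, for `p = (q, c)`. -/
noncomputable def rightAtom (V : Matrix (Fin n₂) (Fin r) ℂ) (p : (Fin n₁ × Fin s) × Fin r) :
    Matrix (Fin n₁ × Fin s) (Fin n₂) ℂ := Matrix.of fun q k => if q = p.1 then star (V k p.2) else 0

/-- A bound on `|bⱼᴴ 𝒢*(U_c e_kᵀ)ⱼ|²`. -/
noncomputable def leftProfile (μ₀ : ℝ) (U : Matrix (Fin n₁ × Fin s) (Fin r) ℂ)
    (p : Fin n₂ × Fin r) (j : Fin n) : ℝ :=
  μ₀ * s * ((antidiagCard n₁ n₂ j : ℝ)⁻¹ *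
    ∑ a : Fin n₁, if (a : ℕ) + p.1 = j then ∑ l, ‖U (a, l) p.2‖ ^ 2 else 0)

/-- A bound on `|bⱼᴴ 𝒢*(e_q V_cᴴ)ⱼ|²`. -/
noncomputable def rightProfile (μ₀ : ℝ) (V : Matrix (Fin n₂) (Fin r) ℂ)
    (p : (Fin n₁ × Fin s) × Fin r) (j : Fin n) : ℝ :=
  μ₀ * ((antidiagCard n₁ n₂ j : ℝ)⁻¹ *
    ∑ k : Fin n₂, if (p.1.1 : ℕ) + k = j then ‖V k p.2‖ ^ 2 else 0)

theorem leftProfile_nonneg {μ₀ : ℝ} (hμ : 0 ≤ μ₀) (U : Matrix (Fin n₁ × Fin s) (Fin r) ℂ)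
    (p : Fin n₂ × Fin r) (j : Fin n) : 0 ≤ leftProfile μ₀ U p j := by
  refine mul_nonneg (by positivity) (mul_nonneg (by positivity) (Finset.sum_nonneg fun a _ => ?_))
  split_ifs <;> positivity

theorem rightProfile_nonneg {μ₀ : ℝ} (hμ : 0 ≤ μ₀) (V : Matrix (Fin n₂) (Fin r) ℂ)
    (p : (Fin n₁ × Fin s) × Fin r) (j : Fin n) : 0 ≤ rightProfile μ₀ V p j := by
  refine mul_nonneg hμ (mul_nonneg (by positivity) (Finset.sum_nonneg fun a _ => ?_))
  split_ifs <;> positivity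

theorem sum_leftProfile (μ₀ : ℝ) (U : Matrix (Fin n₁ × Fin s) (Fin r) ℂ) (j : Fin n) :
    ∑ p : Fin n₂ × Fin r, leftProfile μ₀ U p j
      = μ₀ * s * antidiagAvg n₁ n₂ (fun a => ∑ l, ∑ c, ‖U (a, l) c‖ ^ 2) j := by
  simp only [leftProfile, antidiagAvg, Fintype.sum_prod_type]
  simp only [← Finset.mul_sum]
  congr 2
  rw [Finset.sum_comm (s := (Finset.univ : Finset (Fin n₁)))]
  refine Finset.sum_congr rfl fun k _ => ?_
  rw [Finset.sum_comm]
  refine Finset.sum_congr rfl fun a _ => ?_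
  split_ifs with h
  · rw [Finset.sum_comm]
  · simp

/-- The right atoms are supported in one position of each block, so their profile has no factor `s`;
the sum over positions restores it, and both families get `Λ = μ₀ s`. -/
theorem sum_rightProfile (μ₀ : ℝ) (V : Matrix (Fin n₂) (Fin r) ℂ) (j : Fin n) :
    ∑ p : (Fin n₁ × Fin s) × Fin r, rightProfile μ₀ V p j
      = μ₀ * s * antidiagAvg n₂ n₁ (fun k => ∑ c, ‖V k c‖ ^ 2) j := by
  simp only [rightProfile, antidiagAvg, Fintype.sum_prod_type]
  simp only [← Finset.mul_sum]
  change μ₀ * ((antidiagCard n₁ n₂ j : ℝ)⁻¹ * ∑ a : Fin n₁, ∑ _l : Fin s, ∑ c : Fin r,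
    ∑ k : Fin n₂, if (a : ℕ) + k = j then ‖V k c‖ ^ 2 else 0) = _
  simp only [Finset.sum_const, Finset.card_univ, Fintype.card_fin, nsmul_eq_mul]
  rw [← Finset.mul_sum, antidiagCard_comm n₁ n₂,
    Finset.sum_comm (s := (Finset.univ : Finset (Fin n₂)))]
  have : ∀ a : Fin n₁, (∑ c : Fin r, ∑ k : Fin n₂,
      if (a : ℕ) + k = j then ‖V k c‖ ^ 2 else 0)
      = ∑ k : Fin n₂, if (k : ℕ) + a = j then ∑ c, ‖V k c‖ ^ 2 else 0 := by
    intro a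
    rw [Finset.sum_comm]
    refine Finset.sum_congr rfl fun k _ => ?_
    rw [add_comm (k : ℕ)]
    split_ifs <;> simp
  simp only [this]
  ring

theorem mul_conjT_eq_sum_leftAtom (U : Matrix (Fin n₁ × Fin s) (Fin r) ℂ)
    (W : Matrix (Fin n₂) (Fin r) ℂ) :
    U * Wᴴ = ∑ p : Fin n₂ × Fin r, star (W p.1 p.2) • leftAtom U p := by
  ext q k
  rw [Matrix.sum_apply, Fintype.sum_prod_type, Finset.sum_eq_single k]
  · rw [Matrix.mul_apply]
    refine Finset.sum_congr rfl fun c _ => ?_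
    simp [leftAtom, mul_comm]
  · intro k' _ hk'
    refine Finset.sum_eq_zero fun c _ => ?_
    simp [leftAtom, hk'.symm]
  · simp

theorem mul_conjT_eq_sum_rightAtom (W : Matrix (Fin n₁ × Fin s) (Fin r) ℂ)
    (V : Matrix (Fin n₂) (Fin r) ℂ) :
    W * Vᴴ = ∑ p : (Fin n₁ × Fin s) × Fin r, W p.1 p.2 • rightAtom V p := by
  ext q k
  rw [Matrix.sum_apply, Fintype.sum_prod_type, Finset.sum_eq_single q]
  · rw [Matrix.mul_apply]
    refine Finset.sum_congr rfl fun c _ => ?_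
    simp [rightAtom]
  · intro q' _ hq'
    refine Finset.sum_eq_zero fun c _ => ?_
    simp [rightAtom, hq'.symm]
  · simp

theorem sqrt_sum_prod_eq_norm {m k : Type*} [Fintype m] [Fintype k] (W : Matrix m k ℂ) :
    Real.sqrt (∑ p : m × k, ‖W p.1 p.2‖ ^ 2) = ‖W‖ := by
  rw [Fintype.sum_prod_type]
  dsimp only
  rw [← frob_sq, Real.sqrt_sq (norm_nonneg _)]

theorem leftProfile_support {μ₀ : ℝ} {U : Matrix (Fin n₁ × Fin s) (Fin r) ℂ}
    {p : Fin n₂ × Fin r} {j : Fin n} (h : leftProfile μ₀ U p j ≠ 0) :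
    (p.1 : ℕ) ≤ j ∧ (j : ℕ) < p.1 + n₁ := by
  by_contra hc
  refine h ?_
  rw [leftProfile, Finset.sum_eq_zero, mul_zero, mul_zero]
  intro a _
  rw [if_neg]
  omega

theorem rightProfile_support {μ₀ : ℝ} {V : Matrix (Fin n₂) (Fin r) ℂ}
    {p : (Fin n₁ × Fin s) × Fin r} {j : Fin n} (h : rightProfile μ₀ V p j ≠ 0) :
    (p.1.1 : ℕ) ≤ j ∧ (j : ℕ) < p.1.1 + n₂ := by
  by_contra hc
  refine h ?_
  rw [rightProfile, Finset.sum_eq_zero, mul_zero, mul_zero]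
  intro a _
  rw [if_neg]
  omega

/-- Near isometry on the tangent space from entrywise bounds in the atoms. -/
theorem isoDefect_tangent_le (hn : n₁ + n₂ = n + 1) (h₁ : 0 < n₁) (h₂ : 0 < n₂)
    {B : Matrix (Fin n) (Fin s) ℂ} {U : Matrix (Fin n₁ × Fin s) (Fin r) ℂ}
    {V : Matrix (Fin n₂) (Fin r) ℂ} (hU : Uᴴ * U = 1) (hV : Vᴴ * V = 1) {μ₀ μ₁ T : ℝ}
    (hμ : 0 ≤ μ₀) (hμ₁ : 0 < μ₁) (hinc : Incoherent n μ₁ U V) (hT : 0 ≤ T)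
    (hll : ∀ p p' : Fin n₂ × Fin r,
      ‖measForm B (liftGAdj n (leftAtom U p)) (liftGAdj n (leftAtom U p'))‖ ^ 2
        ≤ T * ∑ j : Fin n, leftProfile μ₀ U p j * leftProfile μ₀ U p' j)
    (hlr : ∀ (p : Fin n₂ × Fin r) (p' : (Fin n₁ × Fin s) × Fin r),
      ‖measForm B (liftGAdj n (leftAtom U p)) (liftGAdj n (rightAtom V p'))‖ ^ 2
        ≤ T * ∑ j : Fin n, leftProfile μ₀ U p j * rightProfile μ₀ V p' j)
    (hrr : ∀ p p' : (Fin n₁ × Fin s) × Fin r,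
      ‖measForm B (liftGAdj n (rightAtom V p)) (liftGAdj n (rightAtom V p'))‖ ^ 2
        ≤ T * ∑ j : Fin n, rightProfile μ₀ V p j * rightProfile μ₀ V p' j)
    {X Y : Matrix (Fin n₁ × Fin s) (Fin n₂) ℂ} (hX : IsTangent U V X) (hY : IsTangent U V Y) :
    isoDefect B X Y
      ≤ 4 * Real.sqrt (T * (μ₀ * s) ^ 2 * (μ₁ * r / n * (r * (2 * (1 + Real.log n) + 8)))) *
        (‖X‖ * ‖Y‖) := by
  set S := T * (μ₀ * s) ^ 2 * (μ₁ * r / n * (r * (2 * (1 + Real.log n) + 8)))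
  have hβ : 0 ≤ μ₁ * r / n := by positivity
  have hu : ∀ a : Fin n₁, 0 ≤ ∑ l, ∑ c, ‖U (a, l) c‖ ^ 2 := fun a => by positivity
  have huβ : ∀ a : Fin n₁, ∑ l, ∑ c, ‖U (a, l) c‖ ^ 2 ≤ μ₁ * r / n := fun a => by
    have := hinc.1 a
    rwa [frob_sq] at this
  have huc : ∑ a : Fin n₁, ∑ l, ∑ c, ‖U (a, l) c‖ ^ 2 = r := by
    have := norm_isometry hU
    rw [← Fintype.sum_prod_type (f := fun q : Fin n₁ × Fin s => ∑ c, ‖U q c‖ ^ 2), ← frob_sq, this,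
      Real.sq_sqrt (Nat.cast_nonneg r)]
  have hv : ∀ k : Fin n₂, 0 ≤ ∑ c, ‖V k c‖ ^ 2 := fun k => by positivity
  have hvc : ∑ k : Fin n₂, ∑ c, ‖V k c‖ ^ 2 = r := by
    have := norm_isometry hV
    rw [← frob_sq, this, Real.sq_sqrt (Nat.cast_nonneg r)]
  have bll : ∀ W W' : Matrix (Fin n₂) (Fin r) ℂ,
      isoDefect B (U * Wᴴ) (U * W'ᴴ) ≤ Real.sqrt S * (‖W‖ * ‖W'‖) := by
    intro W W'
    rw [isoDefect_eq_measForm, mul_conjT_eq_sum_leftAtom, mul_conjT_eq_sum_leftAtom, liftGAdj_sum,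
      liftGAdj_sum, measForm_sum]
    refine (Complex.re_le_norm _).trans ?_
    refine (norm_kernel_sum_le_self hn h₁ h₂ (leftProfile_nonneg hμ U) (fun p => (p.1 : ℕ))
      (fun p j h => leftProfile_support h) hT hβ hll hu huβ
      (fun j => (sum_leftProfile μ₀ U j).le) _ _).trans_eq ?_
    simp only [norm_star, sqrt_sum_prod_eq_norm, huc]
    rfl
  have brr : ∀ W W' : Matrix (Fin n₁ × Fin s) (Fin r) ℂ,
      isoDefect B (W * Vᴴ) (W' * Vᴴ) ≤ Real.sqrt S * (‖W‖ * ‖W'‖) := by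
    intro W W'
    rw [isoDefect_eq_measForm, mul_conjT_eq_sum_rightAtom, mul_conjT_eq_sum_rightAtom,
      liftGAdj_sum, liftGAdj_sum, measForm_sum]
    refine (Complex.re_le_norm _).trans ?_
    refine (norm_kernel_sum_le_self ((add_comm _ _).trans hn) h₂ h₁ (rightProfile_nonneg hμ V)
      (fun p => (p.1.1 : ℕ)) (fun p j h => rightProfile_support h) hT hβ hrr hv hinc.2
      (fun j => (sum_rightProfile μ₀ V j).le) _ _).trans_eq ?_
    simp only [sqrt_sum_prod_eq_norm, hvc]
    rfl
  have blr : ∀ (W : Matrix (Fin n₂) (Fin r) ℂ) (W' : Matrix (Fin n₁ × Fin s) (Fin r) ℂ),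
      isoDefect B (U * Wᴴ) (W' * Vᴴ) ≤ Real.sqrt S * (‖W‖ * ‖W'‖) := by
    intro W W'
    rw [isoDefect_eq_measForm, mul_conjT_eq_sum_leftAtom, mul_conjT_eq_sum_rightAtom,
      liftGAdj_sum, liftGAdj_sum, measForm_sum]
    refine (Complex.re_le_norm _).trans ?_
    refine (norm_kernel_sum_le_cross hn h₁ h₂ (leftProfile_nonneg hμ U) (rightProfile_nonneg hμ V)
      hT hβ hlr hu huβ huc hv hinc.2 hvc (fun j => (sum_leftProfile μ₀ U j).le)
      (fun j => (sum_rightProfile μ₀ V j).le) _ _).trans_eq ?_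
    simp only [norm_star, sqrt_sum_prod_eq_norm]
    rfl
  -- An orthogonal splitting of the tangent space: the second term has columns orthogonal to those
  -- of `U`, and both coefficient matrices are bounded by `‖Z‖`. The factor `4` in the conclusion
  -- counts the four products.
  have hdec : ∀ Z : Matrix (Fin n₁ × Fin s) (Fin n₂) ℂ, IsTangent U V Z →
      Z = U * (Zᴴ * U)ᴴ + ((1 - U * Uᴴ) * Z * V) * Vᴴ := by
    intro Z hZ
    rw [IsTangent, Matrix.mul_sub, Matrix.mul_one, sub_eq_zero] at hZ
    rw [Matrix.mul_assoc _ V, ← hZ, Matrix.conjTranspose_mul, Matrix.conjTranspose_conjTranspose,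
      ← Matrix.mul_assoc, ← Matrix.add_mul]
    simp
  have hn1 : ∀ Z : Matrix (Fin n₁ × Fin s) (Fin n₂) ℂ, ‖Zᴴ * U‖ ≤ ‖Z‖ := fun Z => by
    rw [← norm_conjT, Matrix.conjTranspose_mul, Matrix.conjTranspose_conjTranspose]
    exact norm_conjT_isometry_mul hU Z
  have hn2 : ∀ Z : Matrix (Fin n₁ × Fin s) (Fin n₂) ℂ, ‖(1 - U * Uᴴ) * Z * V‖ ≤ ‖Z‖ := fun Z => by
    refine le_trans ?_ ((IsProj.of_isometry hU).one_sub.norm_mul_le Z)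
    rw [← norm_conjT, Matrix.conjTranspose_mul, ← norm_conjT ((1 - U * Uᴴ) * Z)]
    exact norm_conjT_isometry_mul hV _
  have hS := Real.sqrt_nonneg S
  have hfin : ∀ {a b : ℝ}, 0 ≤ b → a ≤ ‖X‖ → b ≤ ‖Y‖ →
      Real.sqrt S * (a * b) ≤ Real.sqrt S * (‖X‖ * ‖Y‖) := fun h0 h1 h2 =>
    mul_le_mul_of_nonneg_left (mul_le_mul h1 h2 h0 (norm_nonneg _)) hS
  have e : isoDefect B X Y = isoDefect B (U * (Xᴴ * U)ᴴ) (U * (Yᴴ * U)ᴴ)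
      + isoDefect B (U * (Xᴴ * U)ᴴ) (((1 - U * Uᴴ) * Y * V) * Vᴴ)
      + (isoDefect B (U * (Yᴴ * U)ᴴ) (((1 - U * Uᴴ) * X * V) * Vᴴ)
      + isoDefect B (((1 - U * Uᴴ) * X * V) * Vᴴ) (((1 - U * Uᴴ) * Y * V) * Vᴴ)) := by
    conv_lhs => rw [hdec X hX, hdec Y hY]
    rw [isoDefect_add_left, isoDefect_add_right, isoDefect_add_right,
      isoDefect_comm B (((1 - U * Uᴴ) * X * V) * Vᴴ) (U * (Yᴴ * U)ᴴ)]
  have t1 := (bll (Xᴴ * U) (Yᴴ * U)).trans (hfin (norm_nonneg _) (hn1 X) (hn1 Y))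
  have t2 := (blr (Xᴴ * U) ((1 - U * Uᴴ) * Y * V)).trans (hfin (norm_nonneg _) (hn1 X) (hn2 Y))
  have t3 := (blr (Yᴴ * U) ((1 - U * Uᴴ) * X * V)).trans
    ((mul_comm ‖Yᴴ * U‖ _ ▸ hfin (norm_nonneg _) (hn2 X) (hn1 Y)))
  have t4 := (brr ((1 - U * Uᴴ) * X * V) ((1 - U * Uᴴ) * Y * V)).trans
    (hfin (norm_nonneg _) (hn2 X) (hn2 Y))
  rw [e]
  linarith

end Tangent

/-! ### Hoeffding and Bernstein inequalities for complex sums. -/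

section Concentration

variable {Ω : Type*} [MeasurableSpace Ω] {P : Measure Ω} [IsProbabilityMeasure P]
  {ι : Type*} [Fintype ι]

/-- If the real parts of `±f` and `±i f` are all below `t`, then `‖f‖² ≤ 2 t²`; hence the constants
`2` and `4`. -/
theorem measureReal_normSq_gt_le (f : Ω → ℂ) {t q : ℝ}
    (h : ∀ u : ℂ, ‖u‖ = 1 → P.real {ω | t ≤ (u * f ω).re} ≤ q) :
    P.real {ω | 2 * t ^ 2 < ‖f ω‖ ^ 2} ≤ 4 * q := by
  have hsub : {ω | 2 * t ^ 2 < ‖f ω‖ ^ 2} ⊆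
      ({ω | t ≤ (1 * f ω).re} ∪ {ω | t ≤ (-1 * f ω).re}) ∪
        ({ω | t ≤ (Complex.I * f ω).re} ∪ {ω | t ≤ (-Complex.I * f ω).re}) := by
    intro ω hω
    by_contra hc
    simp only [Set.mem_union, Set.mem_ofPred_eq, not_or, not_le] at hc hω
    obtain ⟨⟨h1, h2⟩, h3, h4⟩ := hc
    simp at h1 h2 h3 h4
    rw [← Complex.normSq_eq_norm_sq, Complex.normSq_apply] at hω
    nlinarith
  refine (measureReal_mono hsub).trans ((measureReal_union_le _ _).trans ?_)
  have h1 := measureReal_union_le (μ := P) {ω | t ≤ (1 * f ω).re} {ω | t ≤ (-1 * f ω).re}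
  have h2 := measureReal_union_le (μ := P) {ω | t ≤ (Complex.I * f ω).re}
    {ω | t ≤ (-Complex.I * f ω).re}
  linarith [h 1 (by simp), h (-1) (by simp), h Complex.I (by simp), h (-Complex.I) (by simp)]

theorem integrable_of_norm_le {X : Ω → ℂ} (hX : Measurable X) {c : ℝ}
    (hc : ∀ᵐ ω ∂P, ‖X ω‖ ≤ c) : Integrable X P :=
  Integrable.of_bound hX.aestronglyMeasurable c hc

omit [IsProbabilityMeasure P] in
theorem re_mul_sub_integral {X : Ω → ℂ} (hX : Integrable X P) (u : ℂ) (ω : Ω) :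
    (u * (X ω - ∫ ω, X ω ∂P)).re = (u * X ω).re - ∫ ω, (u * X ω).re ∂P := by
  have h := integral_re (hX.const_mul u)
  simp only [RCLike.re_to_complex] at h
  rw [h, integral_const_mul, mul_sub, Complex.sub_re]

/-- Hoeffding's inequality for complex variables. -/
theorem measureReal_sum_gt_le_hoeffding {X : ι → Ω → ℂ} (hm : ∀ i, Measurable (X i))
    (hi : iIndepFun X P) {c : ι → ℝ} (hc : ∀ i, 0 ≤ c i) (hb : ∀ i, ∀ᵐ ω ∂P, ‖X i ω‖ ≤ c i)
    {a : ℝ} (ha : 0 ≤ a) :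
    P.real {ω | 4 * a * ∑ i, c i ^ 2 < ‖∑ i, (X i ω - ∫ ω, X i ω ∂P)‖ ^ 2}
      ≤ 4 * Real.exp (-a) := by
  have hv : 0 ≤ ∑ i, c i ^ 2 := by positivity
  -- In the degenerate case the Hoeffding exponent would divide by zero; there all variables vanish
  -- almost surely and the strict event is null.
  rcases hv.eq_or_lt with h0 | hpos
  · have hz : ∀ᵐ ω ∂P, ∀ i, X i ω = 0 := by
      rw [ae_all_iff]
      intro i
      have hci : c i = 0 := by
        have := (Finset.sum_eq_zero_iff_of_nonneg fun i _ => sq_nonneg (c i)).1 h0.symm i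
          (Finset.mem_univ i)
        simpa using this
      filter_upwards [hb i] with ω hω
      rw [hci] at hω
      exact norm_le_zero_iff.1 hω
    have hint : ∀ i, ∫ ω, X i ω ∂P = 0 := fun i => by
      rw [integral_congr_ae (hz.mono fun ω h => h i)]; simp
    have : P.real {ω | 4 * a * ∑ i, c i ^ 2 < ‖∑ i, (X i ω - ∫ ω, X i ω ∂P)‖ ^ 2} = 0 := by
      rw [measureReal_def, measure_eq_zero_iff_ae_notMem.2, ENNReal.toReal_zero]
      filter_upwards [hz] with ω hω
      simp [hω, hint, ← h0]
    rw [this]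
    positivity
  · have ht : (0 : ℝ) ≤ Real.sqrt (2 * a * ∑ i, c i ^ 2) := Real.sqrt_nonneg _
    have key := measureReal_normSq_gt_le (P := P) (q := Real.exp (-a))
      (t := Real.sqrt (2 * a * ∑ i, c i ^ 2))
      (fun ω => ∑ i, (X i ω - ∫ ω, X i ω ∂P)) ?_
    · rw [Real.sq_sqrt (by positivity)] at key
      refine le_trans (le_of_eq ?_) key
      congr 2
      ext ω
      rw [show 4 * a * ∑ i, c i ^ 2 = 2 * (2 * a * ∑ i, c i ^ 2) by ring]
    · intro u hu
      have hXi := fun i => integrable_of_norm_le (hm i) (hb i)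
      have hmY : ∀ i, Measurable fun ω => (u * X i ω).re := fun i =>
        Complex.measurable_re.comp ((hm i).const_mul u)
      have hsub : ∀ i ∈ Finset.univ,
          HasSubgaussianMGF (fun ω => (u * X i ω).re - ∫ ω, (u * X i ω).re ∂P)
          ((‖c i - -c i‖₊ / 2) ^ 2) P := by
        intro i _
        refine hasSubgaussianMGF_of_mem_Icc (hmY i).aemeasurable ?_
        filter_upwards [hb i] with ω hω
        have h1 := Complex.abs_re_le_norm (u * X i ω)
        rw [norm_mul, hu, one_mul] at h1
        exact abs_le.1 (h1.trans hω)
      have hind : iIndepFun (fun i ω => (u * X i ω).re - ∫ ω, (u * X i ω).re ∂P) P :=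
        hi.comp (fun i z => (u * z).re - ∫ ω, (u * X i ω).re ∂P) fun i =>
          (Complex.measurable_re.comp (measurable_id.const_mul u)).sub_const _
      have h := HasSubgaussianMGF.measure_sum_ge_le_of_iIndepFun hind hsub ht
      have hcoe : ∀ i, (((‖c i - -c i‖₊ / 2) ^ 2 : NNReal) : ℝ) = c i ^ 2 := by
        intro i
        push_cast
        rw [sub_neg_eq_add, Real.norm_eq_abs, abs_of_nonneg (by linarith [hc i])]
        ring
      rw [Real.sq_sqrt (by positivity)] at h
      push_cast at h hcoe
      simp only [hcoe] at h
      have e : -(2 * a * ∑ i, c i ^ 2) / (2 * ∑ i, c i ^ 2) = -a := by field_simp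
      rw [e] at h
      refine le_trans (le_of_eq ?_) h
      congr 2
      ext ω
      rw [Finset.mul_sum (f := fun i => X i ω - ∫ ω, X i ω ∂P), Complex.re_sum]
      simp only [re_mul_sub_integral (hXi _)]

/-- `e^x ≤ 1 + x + x²` for `|x| ≤ 1`, integrated with mean zero, then `1 + u ≤ e^u`. The constraint
`t c ≤ 1` keeps the argument in that range. -/
theorem integral_exp_le {Y : Ω → ℝ} (hm : Measurable Y) {c v t : ℝ} (ht : 0 ≤ t) (htc : t * c ≤ 1)
    (hb : ∀ᵐ ω ∂P, |Y ω| ≤ c) (hmean : ∫ ω, Y ω ∂P = 0) (hv : ∫ ω, Y ω ^ 2 ∂P ≤ v) :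
    mgf Y P t ≤ Real.exp (t ^ 2 * v) := by
  have hY : Integrable Y P := Integrable.of_bound hm.aestronglyMeasurable c hb
  have hY2 : Integrable (fun ω => Y ω ^ 2) P := by
    refine Integrable.of_bound (hm.pow_const 2).aestronglyMeasurable (c ^ 2) ?_
    filter_upwards [hb] with ω hω
    rw [norm_pow, Real.norm_eq_abs]
    exact pow_le_pow_left₀ (abs_nonneg _) hω 2
  have h1 : mgf Y P t ≤ ∫ ω, (1 + t * Y ω + t ^ 2 * Y ω ^ 2) ∂P := by
    rw [mgf]
    refine integral_mono_ae (integrable_exp_mul_of_mem_Icc hm.aemeasurable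
      (hb.mono fun ω h => abs_le.1 h)) (((integrable_const _).add (hY.const_mul t)).add
      (hY2.const_mul _)) ?_
    filter_upwards [hb] with ω hω
    have h2 : |t * Y ω| ≤ 1 := by
      rw [abs_mul, abs_of_nonneg ht]
      exact (mul_le_mul_of_nonneg_left hω ht).trans htc
    have h3 := (abs_le.1 (Real.abs_exp_sub_one_sub_id_le h2)).2
    rw [mul_pow] at h3
    linarith
  have h2 : ∫ ω, (1 + t * Y ω + t ^ 2 * Y ω ^ 2) ∂P = 1 + t ^ 2 * ∫ ω, Y ω ^ 2 ∂P := by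
    have i1 : Integrable (fun ω => 1 + t * Y ω) P := (integrable_const _).add (hY.const_mul t)
    rw [integral_add i1 (hY2.const_mul _), integral_add (integrable_const _) (hY.const_mul t),
      integral_const_mul, integral_const_mul,
      hmean]
    simp
  rw [h2] at h1
  have h3 := Real.add_one_le_exp (t ^ 2 * v)
  have h4 := mul_le_mul_of_nonneg_left hv (sq_nonneg t)
  linarith

/-- Bernstein's inequality for complex variables. -/
theorem measureReal_sum_gt_le_bernstein {X : ι → Ω → ℂ} (hm : ∀ i, Measurable (X i))
    (hi : iIndepFun X P) {M v t lam : ℝ} (hb : ∀ i, ∀ᵐ ω ∂P, ‖X i ω‖ ≤ M)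
    (hv : ∑ i, ∫ ω, ‖X i ω‖ ^ 2 ∂P ≤ v) (hlam : 0 ≤ lam) (hlM : lam * (2 * M) ≤ 1) :
    P.real {ω | 2 * t ^ 2 < ‖∑ i, (X i ω - ∫ ω, X i ω ∂P)‖ ^ 2}
      ≤ 4 * Real.exp (-lam * t + lam ^ 2 * v) := by
  refine measureReal_normSq_gt_le _ fun u hu => ?_
  have hXi := fun i => integrable_of_norm_le (hm i) (hb i)
  set Y : ι → Ω → ℝ := fun i ω => (u * X i ω).re - ∫ ω, (u * X i ω).re ∂P with hY
  have hmY : ∀ i, Measurable fun ω => (u * X i ω).re := fun i =>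
    Complex.measurable_re.comp ((hm i).const_mul u)
  have hmY' : ∀ i, Measurable (Y i) := fun i => (hmY i).sub_const _
  have hbre : ∀ i, ∀ᵐ ω ∂P, |(u * X i ω).re| ≤ M := by
    intro i
    filter_upwards [hb i] with ω hω
    have h1 := Complex.abs_re_le_norm (u * X i ω)
    rw [norm_mul, hu, one_mul] at h1
    exact h1.trans hω
  have hire : ∀ i, Integrable (fun ω => (u * X i ω).re) P := fun i =>
    Integrable.of_bound (hmY i).aestronglyMeasurable M (hbre i)
  have hire2 : ∀ i, Integrable (fun ω => (u * X i ω).re ^ 2) P := fun i => by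
    refine Integrable.of_bound ((hmY i).pow_const 2).aestronglyMeasurable (M ^ 2) ?_
    filter_upwards [hbre i] with ω hω
    rw [norm_pow, Real.norm_eq_abs]
    exact pow_le_pow_left₀ (abs_nonneg _) hω 2
  have hinorm2 : ∀ i, Integrable (fun ω => ‖X i ω‖ ^ 2) P := fun i => by
    refine Integrable.of_bound ((hm i).norm.pow_const 2).aestronglyMeasurable (M ^ 2) ?_
    filter_upwards [hb i] with ω hω
    rw [norm_pow, norm_norm]
    exact pow_le_pow_left₀ (norm_nonneg _) hω 2
  have hmean : ∀ i, ∫ ω, Y i ω ∂P = 0 := fun i => by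
    rw [hY]
    dsimp only
    rw [integral_sub (hire i) (integrable_const _)]
    simp
  -- Centring doubles the sup bound, hence `2 * M` in the constraint on `lam`; the variance bound
  -- does not increase.
  have hbY : ∀ i, ∀ᵐ ω ∂P, |Y i ω| ≤ 2 * M := fun i => by
    have h1 : |∫ ω, (u * X i ω).re ∂P| ≤ M := by
      have := norm_integral_le_of_norm_le_const (μ := P) (f := fun ω => (u * X i ω).re) (hbre i)
      simpa using this
    filter_upwards [hbre i] with ω hω
    have := abs_sub ((u * X i ω).re) (∫ ω, (u * X i ω).re ∂P)
    simp only [hY]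
    linarith
  have hvar : ∀ i, ∫ ω, Y i ω ^ 2 ∂P ≤ ∫ ω, ‖X i ω‖ ^ 2 ∂P := fun i => by
    have h1 : ∫ ω, Y i ω ^ 2 ∂P = ∫ ω, (u * X i ω).re ^ 2 ∂P - (∫ ω, (u * X i ω).re ∂P) ^ 2 := by
      have e : ∀ ω, Y i ω ^ 2 = (u * X i ω).re ^ 2
          - 2 * (∫ ω, (u * X i ω).re ∂P) * (u * X i ω).re + (∫ ω, (u * X i ω).re ∂P) ^ 2 := by
        intro ω
        simp only [hY]
        ring
      simp only [e]
      have i1 : Integrable (fun ω => (u * X i ω).re ^ 2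
          - 2 * (∫ ω, (u * X i ω).re ∂P) * (u * X i ω).re) P := (hire2 i).sub ((hire i).const_mul _)
      rw [integral_add i1 (integrable_const _),
        integral_sub (hire2 i) ((hire i).const_mul _), integral_const_mul]
      simp
      ring
    rw [h1]
    have h2 : ∫ ω, (u * X i ω).re ^ 2 ∂P ≤ ∫ ω, ‖X i ω‖ ^ 2 ∂P := by
      refine integral_mono (hire2 i) (hinorm2 i) fun ω => ?_
      have h1 := Complex.abs_re_le_norm (u * X i ω)
      rw [norm_mul, hu, one_mul] at h1
      dsimp only
      rw [← sq_abs]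
      exact pow_le_pow_left₀ (abs_nonneg _) h1 2
    linarith [sq_nonneg (∫ ω, (u * X i ω).re ∂P)]
  have hind : iIndepFun Y P :=
    hi.comp (fun i z => (u * z).re - ∫ ω, (u * X i ω).re ∂P) fun i =>
      (Complex.measurable_re.comp (measurable_id.const_mul u)).sub_const _
  have hexp : ∀ i, Integrable (fun ω => Real.exp (lam * Y i ω)) P := fun i =>
    integrable_exp_mul_of_mem_Icc (hmY' i).aemeasurable ((hbY i).mono fun ω h => abs_le.1 h)
  have h1 := measure_ge_le_exp_mul_mgf (μ := P) (X := ∑ i, Y i) t hlam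
    (hind.integrable_exp_mul_sum hmY' fun i _ => hexp i)
  rw [hind.mgf_sum hmY'] at h1
  have h2 : ∏ i, mgf (Y i) P lam ≤ Real.exp (lam ^ 2 * v) := by
    calc ∏ i, mgf (Y i) P lam ≤ ∏ i, Real.exp (lam ^ 2 * ∫ ω, ‖X i ω‖ ^ 2 ∂P) :=
          Finset.prod_le_prod (fun i _ => mgf_nonneg) fun i _ =>
            integral_exp_le (hmY' i) hlam hlM (hbY i) (hmean i) (hvar i)
      _ = Real.exp (lam ^ 2 * ∑ i, ∫ ω, ‖X i ω‖ ^ 2 ∂P) := by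
          rw [← Real.exp_sum, Finset.mul_sum]
      _ ≤ _ := by gcongr
  rw [Real.exp_add]
  refine le_trans (le_of_eq ?_) (h1.trans (by gcongr))
  congr 2
  ext ω
  rw [Finset.mul_sum, Complex.re_sum, Finset.sum_apply]
  simp only [re_mul_sub_integral (hXi _), hY]

end Concentration

/-! ### Moments and tail bounds for the random measurements. -/

section RandomSensing

variable {Ω : Type*} [MeasurableSpace Ω] {P : Measure Ω} [IsProbabilityMeasure P] {n s : ℕ}
  {B : Ω → Matrix (Fin n) (Fin s) ℂ} {μ₀ : ℝ}

theorem norm_sensingVec (B : Matrix (Fin n) (Fin s) ℂ) (j : Fin n) (l : Fin s) :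
    ‖sensingVec B j l‖ = ‖B j l‖ := by
  simp [sensingVec]

omit [IsProbabilityMeasure P] in
theorem RandomSubspace.ae_bounded (hB : RandomSubspace P B μ₀) :
    ∀ᵐ ω ∂P, ∀ j l, ‖B ω j l‖ ^ 2 ≤ μ₀ := by
  rw [ae_all_iff]
  intro j
  filter_upwards [hB.bounded j] with ω hω l
  rw [← norm_sensingVec]
  exact hω l

omit [IsProbabilityMeasure P] in
theorem RandomSubspace.measurable_apply (hB : RandomSubspace P B μ₀) (j : Fin n) (l : Fin s) :
    Measurable fun ω => sensingVec (B ω) j l := (measurable_pi_apply l).comp (hB.measurable j)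

theorem RandomSubspace.integrable_mul (hB : RandomSubspace P B μ₀) (j : Fin n) (l m : Fin s) :
    Integrable (fun ω => sensingVec (B ω) j l * star (sensingVec (B ω) j m)) P := by
  refine Integrable.of_bound ((hB.measurable_apply j l).mul
    (continuous_star.measurable.comp (hB.measurable_apply j m))).aestronglyMeasurable μ₀ ?_
  filter_upwards [hB.bounded j] with ω hω
  rw [norm_mul, norm_star]
  nlinarith [hω l, hω m, sq_nonneg (‖sensingVec (B ω) j l‖ - ‖sensingVec (B ω) j m‖)]

/-- Isotropy makes each coordinate of `b_j` have second moment `1`, which its sup bound `μ₀` must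
dominate. -/
theorem RandomSubspace.one_le (hB : RandomSubspace P B μ₀) (j : Fin n) (l : Fin s) : 1 ≤ μ₀ := by
  have h1 := hB.isotropic j l l
  rw [if_pos rfl] at h1
  have h2 : ‖∫ ω, sensingVec (B ω) j l * star (sensingVec (B ω) j l) ∂P‖ ≤ μ₀ := by
    refine (norm_integral_le_of_norm_le_const (C := μ₀) ?_).trans_eq (by simp)
    filter_upwards [hB.bounded j] with ω hω
    rw [norm_mul, norm_star, ← sq]
    exact hω l
  rwa [h1, norm_one] at h2

/-- Isotropy in bilinear form. It yields both `𝔼 𝒜*𝒜 = ℐ` and the vanishing mean of the isometry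
defect. -/
theorem RandomSubspace.integral_mul_sum (hB : RandomSubspace P B μ₀) (j : Fin n)
    (α β : Fin s → ℂ) :
    ∫ ω, (∑ l, sensingVec (B ω) j l * α l) * (∑ m, star (sensingVec (B ω) j m) * β m) ∂P
      = ∑ l, α l * β l := by
  have e : ∀ ω, (∑ l, sensingVec (B ω) j l * α l) * (∑ m, star (sensingVec (B ω) j m) * β m)
      = ∑ l, ∑ m, (α l * β m) * (sensingVec (B ω) j l * star (sensingVec (B ω) j m)) := by
    intro ω
    rw [Finset.sum_mul_sum]
    exact Finset.sum_congr rfl fun l _ => Finset.sum_congr rfl fun m _ => by ring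
  simp only [e]
  have hi : ∀ l m, Integrable (fun ω => (α l * β m) *
      (sensingVec (B ω) j l * star (sensingVec (B ω) j m))) P := fun l m =>
    (hB.integrable_mul j l m).const_mul _
  rw [integral_finsetSum _ fun l _ => integrable_finsetSum _ fun m _ => hi l m]
  refine Finset.sum_congr rfl fun l _ => ?_
  rw [integral_finsetSum _ fun m _ => hi l m]
  simp only [integral_const_mul, hB.isotropic]
  simp

theorem star_measA (B : Matrix (Fin n) (Fin s) ℂ) (G : Matrix (Fin s) (Fin n) ℂ) (j : Fin n) :
    star (measA B G j) = ∑ l, sensingVec B j l * star (G l j) := by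
  rw [measA, star_sum]
  exact Finset.sum_congr rfl fun l _ => by rw [star_mul, star_star, mul_comm]

theorem RandomSubspace.integral_star_measA_mul (hB : RandomSubspace P B μ₀)
    (G G' : Matrix (Fin s) (Fin n) ℂ) (j : Fin n) :
    ∫ ω, star (measA (B ω) G j) * measA (B ω) G' j ∂P = ∑ l, star (G l j) * G' l j := by
  rw [← hB.integral_mul_sum j]
  simp only [star_measA]
  rfl

theorem measurable_sum_mul (β : Fin s → ℂ) :
    Measurable fun z : Fin s → ℂ => ∑ l, star (z l) * β l := by
  refine Finset.measurable_sum _ fun l _ => ?_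
  have h : Measurable fun z : Fin s → ℂ => star (z l) :=
    continuous_star.measurable.comp (measurable_pi_apply l)
  exact h.mul_const _

/-- Concentration of an entry of the restricted isometry defect. -/
theorem RandomSubspace.measForm_tail (hB : RandomSubspace P B μ₀)
    (G G' : Matrix (Fin s) (Fin n) ℂ) {N N' : Fin n → ℝ} (hN0 : ∀ j, 0 ≤ N j)
    (hN0' : ∀ j, 0 ≤ N' j)
    (hN : ∀ B₀ : Matrix (Fin n) (Fin s) ℂ, (∀ j l, ‖B₀ j l‖ ^ 2 ≤ μ₀) →
      ∀ j, ‖measA B₀ G j‖ ^ 2 ≤ N j)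
    (hN' : ∀ B₀ : Matrix (Fin n) (Fin s) ℂ, (∀ j l, ‖B₀ j l‖ ^ 2 ≤ μ₀) →
      ∀ j, ‖measA B₀ G' j‖ ^ 2 ≤ N' j) {a : ℝ} (ha : 0 ≤ a) :
    P.real {ω | 4 * a * ∑ j, N j * N' j < ‖measForm (B ω) G G'‖ ^ 2} ≤ 4 * Real.exp (-a) := by
  have hφ : ∀ j : Fin n, Measurable fun z : Fin s → ℂ =>
      star (∑ l, star (z l) * G l j) * ∑ l, star (z l) * G' l j := fun j =>
    (continuous_star.measurable.comp (measurable_sum_mul _)).mul (measurable_sum_mul _)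
  have h := measureReal_sum_gt_le_hoeffding (P := P)
    (X := fun j ω => star (measA (B ω) G j) * measA (B ω) G' j)
    (fun j => (hφ j).comp (hB.measurable j)) (hB.indep.comp _ hφ)
    (c := fun j => Real.sqrt (N j) * Real.sqrt (N' j)) (fun j => by positivity) ?_ ha
  · simp only [mul_pow, Real.sq_sqrt (hN0 _), Real.sq_sqrt (hN0' _),
      hB.integral_star_measA_mul] at h
    exact h
  · intro j
    filter_upwards [hB.ae_bounded] with ω hω
    rw [norm_mul, norm_star]
    exact mul_le_mul (Real.le_sqrt_of_sq_le (hN _ hω j)) (Real.le_sqrt_of_sq_le (hN' _ hω j))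
      (norm_nonneg _) (Real.sqrt_nonneg _)

/-- Concentration of the symbol of the initialization error. -/
theorem RandomSubspace.symbol_tail (hB : RandomSubspace P B μ₀)
    (x : Matrix (Fin s) (Fin n) ℂ) {w : Fin n → ℂ} (hw : ∀ j, ‖w j‖ = 1) (l : Fin s)
    {M v t lam : ℝ} (hM : ∀ j, μ₀ * Real.sqrt (s * ∑ m, ‖x m j‖ ^ 2) ≤ M)
    (hv : μ₀ * ‖x‖ ^ 2 ≤ v) (hlam : 0 ≤ lam) (hlM : lam * (2 * M) ≤ 1) :
    P.real {ω | 2 * t ^ 2 < ‖∑ j, (measAAdj (B ω) (measA (B ω) x) - x) l j * w j‖ ^ 2}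
      ≤ 4 * Real.exp (-lam * t + lam ^ 2 * v) := by
  have hφ : ∀ j : Fin n, Measurable fun z : Fin s → ℂ =>
      (∑ m, star (z m) * x m j) * z l * w j := fun j =>
    ((measurable_sum_mul _).mul (measurable_pi_apply l)).mul_const _
  have hmean : ∀ j, ∫ ω, measA (B ω) x j * sensingVec (B ω) j l * w j ∂P = x l j * w j := by
    intro j
    rw [integral_mul_const]
    congr 1
    -- Testing isotropy against a coordinate vector extracts the mean of `(b_jᴴ x_j) b_j[l]`.
    have := hB.integral_mul_sum j (Pi.single l 1) (fun m => x m j)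
    simp only [Pi.single_apply, mul_ite, mul_one, mul_zero, Finset.sum_ite_eq', Finset.mem_univ,
      if_true, ite_mul, one_mul, zero_mul] at this
    rw [← this]
    refine integral_congr_ae (ae_of_all _ fun ω => ?_)
    exact mul_comm _ _
  have h := measureReal_sum_gt_le_bernstein (P := P)
    (X := fun j ω => measA (B ω) x j * sensingVec (B ω) j l * w j)
    (fun j => (hφ j).comp (hB.measurable j)) (hB.indep.comp _ hφ) (M := M) (v := v) (t := t)
    ?_ ?_ hlam hlM
  · simp only [hmean] at h
    refine le_trans (le_of_eq ?_) h
    simp only [Matrix.sub_apply, measAAdj, Matrix.of_apply, sub_mul]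
  · intro j
    filter_upwards [hB.ae_bounded] with ω hω
    have h0 : 0 ≤ μ₀ := (sq_nonneg _).trans (hω j l)
    refine le_trans ?_ (hM j)
    rw [norm_mul, norm_mul, hw, mul_one, norm_sensingVec]
    have e : μ₀ * Real.sqrt (s * ∑ m, ‖x m j‖ ^ 2)
        = Real.sqrt (μ₀ * s * ∑ m, ‖x m j‖ ^ 2) * Real.sqrt μ₀ := by
      rw [mul_assoc, Real.sqrt_mul h0, mul_right_comm, Real.mul_self_sqrt h0]
    rw [e]
    exact mul_le_mul (Real.le_sqrt_of_sq_le (norm_measA_sq_le hω x j))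
      (Real.le_sqrt_of_sq_le (hω j l)) (norm_nonneg _) (Real.sqrt_nonneg _)
  · refine le_trans ?_ hv
    rw [frob_sq, Finset.sum_comm, Finset.mul_sum]
    refine Finset.sum_le_sum fun j _ => ?_
    have hi : Integrable (fun ω => ‖measA (B ω) x j‖ ^ 2) P := by
      refine Integrable.of_bound (((measurable_sum_mul fun l => x l j).comp
        (hB.measurable j)).norm.pow_const 2).aestronglyMeasurable
        (μ₀ * s * ∑ m, ‖x m j‖ ^ 2) ?_
      filter_upwards [hB.ae_bounded] with ω hω
      rw [norm_pow, norm_norm]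
      exact norm_measA_sq_le hω x j
    have h2 : ∫ ω, ‖measA (B ω) x j‖ ^ 2 ∂P = ∑ m, ‖x m j‖ ^ 2 := by
      have h3 := hB.integral_star_measA_mul x x j
      have e : ∀ z : ℂ, star z * z = ((‖z‖ ^ 2 : ℝ) : ℂ) := fun z => by
        rw [← Complex.normSq_eq_norm_sq]
        exact Complex.normSq_eq_conj_mul_self.symm
      simp only [e] at h3
      rw [integral_complex_ofReal] at h3
      exact_mod_cast h3
    calc ∫ ω, ‖measA (B ω) x j * sensingVec (B ω) j l * w j‖ ^ 2 ∂P
        ≤ ∫ ω, μ₀ * ‖measA (B ω) x j‖ ^ 2 ∂P := by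
          refine integral_mono_of_nonneg (ae_of_all _ fun ω => sq_nonneg _) (hi.const_mul _) ?_
          filter_upwards [hB.ae_bounded] with ω hω
          rw [norm_mul, norm_mul, hw, mul_one, norm_sensingVec, mul_pow, mul_comm]
          exact mul_le_mul_of_nonneg_right (hω j l) (sq_nonneg _)
      _ = _ := by rw [integral_const_mul, h2]

end RandomSensing

/-! ### Measurements of the tangent atoms. -/

section Profiles

variable {s n n₁ n₂ r : ℕ}

theorem norm_sum_ite_sq {ι : Type*} [Fintype ι] (p : ι → Prop) [DecidablePred p]
    (hp : ∀ a b, p a → p b → a = b) (f : ι → ℂ) :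
    ‖∑ a, if p a then f a else 0‖ ^ 2 = ∑ a, if p a then ‖f a‖ ^ 2 else 0 := by
  by_cases h : ∃ a, p a
  · obtain ⟨a, ha⟩ := h
    have h1 : ∀ b, b ≠ a → ¬ p b := fun b hb hpb => hb (hp b a hpb ha)
    rw [Finset.sum_eq_single a (fun b _ hb => if_neg (h1 b hb)) (by simp),
      Finset.sum_eq_single a (fun b _ hb => if_neg (h1 b hb)) (by simp), if_pos ha, if_pos ha]
  · push Not at h
    simp [h]

theorem norm_sqrt_inv_mul_sq (w : ℕ) (z : ℂ) :
    ‖((Real.sqrt w : ℝ) : ℂ)⁻¹ * z‖ ^ 2 = (w : ℝ)⁻¹ * ‖z‖ ^ 2 := by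
  rw [norm_mul, mul_pow, norm_inv, Complex.norm_real, inv_pow, Real.norm_eq_abs, sq_abs,
    Real.sq_sqrt (Nat.cast_nonneg w)]

/-- An antidiagonal meets a given column in at most one block, so `𝒢*` adds at most one nonzero term
and squaring commutes with the sum. -/
theorem norm_liftGAdj_leftAtom_sq (U : Matrix (Fin n₁ × Fin s) (Fin r) ℂ)
    (p : Fin n₂ × Fin r) (l : Fin s) (j : Fin n) :
    ‖liftGAdj n (leftAtom U p) l j‖ ^ 2 = (antidiagCard n₁ n₂ j : ℝ)⁻¹ *
      ∑ a : Fin n₁, if (a : ℕ) + p.1 = j then ‖U (a, l) p.2‖ ^ 2 else 0 := by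
  have e : (∑ a : Fin n₁, ∑ k : Fin n₂,
      if (a : ℕ) + (k : ℕ) = (j : ℕ) then leftAtom U p (a, l) k else 0)
      = ∑ a : Fin n₁, if (a : ℕ) + p.1 = j then U (a, l) p.2 else 0 := by
    refine Finset.sum_congr rfl fun a _ => ?_
    rw [Finset.sum_eq_single p.1]
    · simp [leftAtom]
    · intro k _ hk
      simp [leftAtom, hk]
    · simp
  rw [liftGAdj, Matrix.of_apply, norm_sqrt_inv_mul_sq, e, norm_sum_ite_sq]
  intro a b ha hb
  exact Fin.ext (by omega)

theorem norm_liftGAdj_rightAtom_sq (V : Matrix (Fin n₂) (Fin r) ℂ)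
    (p : (Fin n₁ × Fin s) × Fin r) (l : Fin s) (j : Fin n) :
    ‖liftGAdj n (rightAtom V p) l j‖ ^ 2 = if l = p.1.2 then (antidiagCard n₁ n₂ j : ℝ)⁻¹ *
      ∑ k : Fin n₂, (if (p.1.1 : ℕ) + k = j then ‖V k p.2‖ ^ 2 else 0) else 0 := by
  rw [liftGAdj, Matrix.of_apply, norm_sqrt_inv_mul_sq]
  split_ifs with hl
  · have e : (∑ a : Fin n₁, ∑ k : Fin n₂,
        if (a : ℕ) + (k : ℕ) = (j : ℕ) then rightAtom V p (a, l) k else 0)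
        = ∑ k : Fin n₂, if (p.1.1 : ℕ) + k = j then star (V k p.2) else 0 := by
      rw [Finset.sum_eq_single p.1.1]
      · refine Finset.sum_congr rfl fun k _ => ?_
        simp [rightAtom, hl]
      · intro a _ ha
        refine Finset.sum_eq_zero fun k _ => ?_
        have : (a, l) ≠ p.1 := fun h => ha (congrArg Prod.fst h)
        simp [rightAtom, this]
      · simp
    rw [e, norm_sum_ite_sq]
    · simp only [norm_star]
    · intro a b ha hb
      exact Fin.ext (by omega)
  · have e : (∑ a : Fin n₁, ∑ k : Fin n₂,
        if (a : ℕ) + (k : ℕ) = (j : ℕ) then rightAtom V p (a, l) k else 0) = 0 := by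
      refine Finset.sum_eq_zero fun a _ => Finset.sum_eq_zero fun k _ => ?_
      have : (a, l) ≠ p.1 := fun h => hl (congrArg Prod.snd h)
      simp [rightAtom, this]
    rw [e]
    simp

theorem norm_measA_leftAtom_sq_le {B : Matrix (Fin n) (Fin s) ℂ} {μ₀ : ℝ}
    (hB : ∀ j l, ‖B j l‖ ^ 2 ≤ μ₀) (U : Matrix (Fin n₁ × Fin s) (Fin r) ℂ)
    (p : Fin n₂ × Fin r) (j : Fin n) :
    ‖measA B (liftGAdj n (leftAtom U p)) j‖ ^ 2 ≤ leftProfile μ₀ U p j := by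
  refine (norm_measA_sq_le hB _ j).trans_eq ?_
  rw [leftProfile]
  simp only [norm_liftGAdj_leftAtom_sq]
  rw [← Finset.mul_sum, Finset.sum_comm]
  congr 2
  refine Finset.sum_congr rfl fun a _ => ?_
  split_ifs <;> simp

/-- Each column of `𝒢*(e_q V_cᴴ)` has a single possibly nonzero coordinate, so one entry of `B`
appears and Cauchy-Schwarz, with its factor `s`, is avoided. -/
theorem norm_measA_rightAtom_sq_le {B : Matrix (Fin n) (Fin s) ℂ} {μ₀ : ℝ}
    (hB : ∀ j l, ‖B j l‖ ^ 2 ≤ μ₀) (V : Matrix (Fin n₂) (Fin r) ℂ)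
    (p : (Fin n₁ × Fin s) × Fin r) (j : Fin n) :
    ‖measA B (liftGAdj n (rightAtom V p)) j‖ ^ 2 ≤ rightProfile μ₀ V p j := by
  have hz : ∀ l, l ≠ p.1.2 → liftGAdj n (rightAtom V p) l j = 0 := by
    intro l hl
    have := norm_liftGAdj_rightAtom_sq (n := n) V p l j
    rw [if_neg hl] at this
    simpa using this
  have he := norm_liftGAdj_rightAtom_sq (n := n) V p p.1.2 j
  rw [if_pos rfl] at he
  rw [measA_apply, Finset.sum_eq_single p.1.2 (fun l _ hl => by rw [hz l hl, mul_zero]) (by simp),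
    norm_mul, mul_pow, he, rightProfile]
  refine mul_le_mul_of_nonneg_right (hB j _) ?_
  rw [← he]
  positivity

end Profiles

/-! ### Energy and spread of `X⋆` from incoherence. -/

section Signal

variable {s n n₁ n₂ r : ℕ}

theorem norm_mul_diagonal_le {m : Type*} [Fintype m] {σ : Fin r → ℝ} {c : ℝ} (hc : 0 ≤ c)
    (hσ : ∀ i, |σ i| ≤ c) (A : Matrix m (Fin r) ℂ) :
    ‖Matrix.diagonal (fun i => (σ i : ℂ)) * Aᴴ‖ ≤ c * ‖A‖ :=
  (norm_diagonal_mul_le hc hσ _).trans_eq (by rw [norm_conjT])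

theorem norm_row_sq (V : Matrix (Fin n₂) (Fin r) ℂ) (k : Fin n₂) :
    ‖V.submatrix (fun _ : Fin 1 => k) id‖ ^ 2 = ∑ c, ‖V k c‖ ^ 2 := by
  rw [frob_sq]; simp

theorem sum_block_sq_le (hn : n₁ + n₂ = n + 1) {x : Matrix (Fin s) (Fin n) ℂ}
    {U : Matrix (Fin n₁ × Fin s) (Fin r) ℂ} {σ : Fin r → ℝ} {V : Matrix (Fin n₂) (Fin r) ℂ}
    (h : IsSVD (hankelLift hn x) U σ V) {c : ℝ} (hc : 0 ≤ c) (hσ : ∀ i, |σ i| ≤ c)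
    {μ₁ : ℝ} (hinc : Incoherent n μ₁ U V) (a : Fin n₁) :
    ∑ k : Fin n₂, ∑ l, ‖hankelLift hn x (a, l) k‖ ^ 2 ≤ c ^ 2 * (μ₁ * r / n) := by
  set Ua := U.submatrix (fun l : Fin s => (a, l)) id with hUa
  have e : (hankelLift hn x).submatrix (fun l : Fin s => (a, l)) id
      = (V * (Matrix.diagonal (fun i => (σ i : ℂ)) * Uaᴴ))ᴴ := by
    have hd : (Matrix.diagonal (fun i => (σ i : ℂ)))ᴴ = Matrix.diagonal (fun i => (σ i : ℂ)) := by
      rw [Matrix.diagonal_conjTranspose]; congr 1; ext i; simp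
    rw [Matrix.conjTranspose_mul, Matrix.conjTranspose_mul, Matrix.conjTranspose_conjTranspose, hd,
      h.eq]
    ext i j
    simp [Matrix.mul_apply, hUa]
  have h1 : ‖(hankelLift hn x).submatrix (fun l : Fin s => (a, l)) id‖ ≤ c * ‖Ua‖ := by
    rw [e, norm_conjT, norm_isometry_mul h.right_orthonormal]
    exact norm_mul_diagonal_le hc hσ Ua
  have h2 := pow_le_pow_left₀ (norm_nonneg _) h1 2
  rw [mul_pow, frob_sq, Finset.sum_comm] at h2
  refine h2.trans ?_
  gcongr
  exact hinc.1 a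

theorem sum_col_sq_le (hn : n₁ + n₂ = n + 1) {x : Matrix (Fin s) (Fin n) ℂ}
    {U : Matrix (Fin n₁ × Fin s) (Fin r) ℂ} {σ : Fin r → ℝ} {V : Matrix (Fin n₂) (Fin r) ℂ}
    (h : IsSVD (hankelLift hn x) U σ V) {c : ℝ} (hc : 0 ≤ c) (hσ : ∀ i, |σ i| ≤ c)
    {μ₁ : ℝ} (hinc : Incoherent n μ₁ U V) (k : Fin n₂) :
    ∑ a : Fin n₁, ∑ l, ‖hankelLift hn x (a, l) k‖ ^ 2 ≤ c ^ 2 * (μ₁ * r / n) := by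
  set Vk := V.submatrix (fun _ : Fin 1 => k) id with hVk
  have e : (hankelLift hn x).submatrix id (fun _ : Fin 1 => k)
      = U * (Matrix.diagonal (fun i => (σ i : ℂ)) * Vkᴴ) := by
    rw [h.eq, ← Matrix.mul_assoc]
    ext i j
    simp [Matrix.mul_apply, hVk]
  have h1 : ‖(hankelLift hn x).submatrix id (fun _ : Fin 1 => k)‖ ≤ c * ‖Vk‖ := by
    rw [e, norm_isometry_mul h.left_orthonormal]
    exact norm_mul_diagonal_le hc hσ Vk
  have h2 := pow_le_pow_left₀ (norm_nonneg _) h1 2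
  rw [mul_pow, frob_sq, norm_row_sq, Fintype.sum_prod_type] at h2
  simp only [Fin.sum_univ_one, Matrix.submatrix_apply] at h2
  refine h2.trans ?_
  gcongr
  exact hinc.2 k

theorem sum_entry_sq_le (hn : n₁ + n₂ = n + 1) {x : Matrix (Fin s) (Fin n) ℂ}
    {U : Matrix (Fin n₁ × Fin s) (Fin r) ℂ} {σ : Fin r → ℝ} {V : Matrix (Fin n₂) (Fin r) ℂ}
    (h : IsSVD (hankelLift hn x) U σ V) {c : ℝ} (hc : 0 ≤ c) (hσ : ∀ i, |σ i| ≤ c)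
    {μ₁ : ℝ} (hinc : Incoherent n μ₁ U V) (a : Fin n₁) (k : Fin n₂) :
    ∑ l, ‖hankelLift hn x (a, l) k‖ ^ 2 ≤ (c * (μ₁ * r / n)) ^ 2 := by
  set Vk := V.submatrix (fun _ : Fin 1 => k) id with hVk
  set Ua := U.submatrix (fun l : Fin s => (a, l)) id with hUa
  have e : (hankelLift hn x).submatrix (fun l : Fin s => (a, l)) (fun _ : Fin 1 => k)
      = Ua * (Matrix.diagonal (fun i => (σ i : ℂ)) * Vkᴴ) := by
    rw [h.eq, ← Matrix.mul_assoc]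
    ext i j
    simp [Matrix.mul_apply, hVk, hUa]
  have h1 : ‖(hankelLift hn x).submatrix (fun l : Fin s => (a, l)) (fun _ : Fin 1 => k)‖
      ≤ ‖Ua‖ * (c * ‖Vk‖) := by
    rw [e]
    refine (Matrix.frobenius_norm_mul _ _).trans ?_
    gcongr
    exact norm_mul_diagonal_le hc hσ Vk
  have h2 := pow_le_pow_left₀ (norm_nonneg _) h1 2
  rw [mul_pow, mul_pow, frob_sq, norm_row_sq] at h2
  simp only [Fin.sum_univ_one, Matrix.submatrix_apply] at h2
  refine h2.trans ?_
  have h3 := hinc.1 a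
  have h4 := hinc.2 k
  have h5 : 0 ≤ μ₁ * r / n := (sq_nonneg _).trans h3
  calc ‖Ua‖ ^ 2 * (c ^ 2 * ∑ i, ‖V k i‖ ^ 2) ≤ (μ₁ * r / n) * (c ^ 2 * (μ₁ * r / n)) := by gcongr
    _ = _ := by ring

/-- Every column of `X⋆` occurs as a block of the Hankel matrix, and the block in position `(a, k)`
equals `U_a Σ V_kᴴ`, with both outer factors incoherent. -/
theorem sum_signal_col_sq_le (hn : n₁ + n₂ = n + 1) (h₁ : 0 < n₁) (h₂ : 0 < n₂)
    {x : Matrix (Fin s) (Fin n) ℂ}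
    {U : Matrix (Fin n₁ × Fin s) (Fin r) ℂ} {σ : Fin r → ℝ} {V : Matrix (Fin n₂) (Fin r) ℂ}
    (h : IsSVD (hankelLift hn x) U σ V) {c : ℝ} (hc : 0 ≤ c) (hσ : ∀ i, |σ i| ≤ c)
    {μ₁ : ℝ} (hinc : Incoherent n μ₁ U V) (j : Fin n) :
    ∑ l, ‖x l j‖ ^ 2 ≤ (c * (μ₁ * r / n)) ^ 2 := by
  obtain ⟨a, k, hak⟩ : ∃ (a : Fin n₁) (k : Fin n₂), (a : ℕ) + k = j := by
    by_cases hj : (j : ℕ) < n₁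
    · exact ⟨⟨j, hj⟩, ⟨0, h₂⟩, by simp⟩
    · refine ⟨⟨n₁ - 1, by omega⟩, ⟨j - (n₁ - 1), by omega⟩, ?_⟩
      simp only
      omega
  have := sum_entry_sq_le hn h hc hσ hinc a k
  have e : (⟨(a : ℕ) + k, by omega⟩ : Fin n) = j := Fin.ext hak
  simpa only [hankelLift, Matrix.of_apply, e] using this

theorem norm_signal_sq_le (hn : n₁ + n₂ = n + 1) (h₁ : 0 < n₁) (h₂ : 0 < n₂)
    {x : Matrix (Fin s) (Fin n) ℂ}
    {U : Matrix (Fin n₁ × Fin s) (Fin r) ℂ} {σ : Fin r → ℝ} {V : Matrix (Fin n₂) (Fin r) ℂ}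
    (h : IsSVD (hankelLift hn x) U σ V) {c : ℝ} (hc : 0 ≤ c) (hσ : ∀ i, |σ i| ≤ c)
    {μ₁ : ℝ} (hinc : Incoherent n μ₁ U V) : ‖x‖ ^ 2 ≤ 2 * (c ^ 2 * (μ₁ * r / n)) := by
  -- The first block row and the last column of the Hankel matrix together list every column of
  -- `X⋆`, which gives the factor `2`.
  have b1 := sum_block_sq_le hn h hc hσ hinc ⟨0, h₁⟩
  have b2 := sum_col_sq_le hn h hc hσ hinc ⟨n₂ - 1, by omega⟩
  set f : Fin n → ℝ := fun j => ∑ l, ‖x l j‖ ^ 2 with hf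
  have hf0 : ∀ j, 0 ≤ f j := fun j => by positivity
  have e1 : ∑ k : Fin n₂, ∑ l, ‖hankelLift hn x (⟨0, h₁⟩, l) k‖ ^ 2
      = ∑ k : Fin n₂, f (⟨k, by omega⟩ : Fin n) := by
    refine Finset.sum_congr rfl fun k _ => Finset.sum_congr rfl fun l _ => ?_
    simp [hankelLift]
  have e2 : ∑ a : Fin n₁, ∑ l, ‖hankelLift hn x (a, l) (⟨n₂ - 1, by omega⟩ : Fin n₂)‖ ^ 2
      = ∑ a : Fin n₁, f (⟨a + (n₂ - 1), by omega⟩ : Fin n) := by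
    refine Finset.sum_congr rfl fun k _ => Finset.sum_congr rfl fun l _ => ?_
    simp [hankelLift]
  rw [e1] at b1
  rw [e2] at b2
  have h3 : ‖x‖ ^ 2 = ∑ j, f j := by rw [frob_sq, Finset.sum_comm]
  have h4 : ∑ j, f j ≤ ∑ k : Fin n₂, f (⟨k, by omega⟩ : Fin n)
      + ∑ a : Fin n₁, f (⟨a + (n₂ - 1), by omega⟩ : Fin n) := by
    classical
    set i1 : Fin n₂ → Fin n := fun k => ⟨k, by omega⟩ with hi1
    set i2 : Fin n₁ → Fin n := fun a => ⟨a + (n₂ - 1), by omega⟩ with hi2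
    have inj1 : Function.Injective i1 := fun a b hab => by
      simp only [hi1, Fin.mk.injEq] at hab
      exact Fin.ext hab
    have inj2 : Function.Injective i2 := fun a b hab => by
      simp only [hi2, Fin.mk.injEq] at hab
      exact Fin.ext (by omega)
    have hcov : (Finset.univ : Finset (Fin n)) = Finset.univ.image i1 ∪ Finset.univ.image i2 := by
      ext j
      simp only [Finset.mem_univ, Finset.mem_union, Finset.mem_image, true_and, true_iff]
      by_cases hj : (j : ℕ) < n₂
      · exact Or.inl ⟨⟨j, hj⟩, rfl⟩
      · refine Or.inr ⟨⟨j - (n₂ - 1), by omega⟩, Fin.ext ?_⟩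
        simp only [hi2]
        omega
    have := Finset.sum_union_inter (s₁ := Finset.univ.image i1) (s₂ := Finset.univ.image i2)
      (f := f)
    rw [Finset.sum_image fun a _ b _ hab => inj1 hab,
      Finset.sum_image fun a _ b _ hab => inj2 hab] at this
    rw [hcov]
    have h0 : 0 ≤ ∑ j ∈ Finset.univ.image i1 ∩ Finset.univ.image i2, f j :=
      Finset.sum_nonneg fun j _ => hf0 j
    linarith
  linarith

end Signal

/-! ### Deterministic convergence on the good event. -/

section Recovery

variable {s n n₁ n₂ r : ℕ}

/-- The weights cancel, so the initialization error is itself block Hankel, with independent columns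
as its data; this is what makes its symbol a sum of independent terms. -/
theorem liftG_measAAdj_sub (hn : n₁ + n₂ = n + 1) (h₁ : 0 < n₁) (h₂ : 0 < n₂)
    (B : Matrix (Fin n) (Fin s) ℂ) (x : Matrix (Fin s) (Fin n) ℂ) :
    liftG hn (measAAdj B (measA B (liftGAdj n (hankelLift hn x)))) - hankelLift hn x
      = hankelLift hn (measAAdj B (measA B x) - x) := by
  have e : colUnscale n₁ n₂ (measAAdj B (measA B (liftGAdj n (hankelLift hn x))))
      = measAAdj B (measA B x) := by
    ext l i
    have hw : (0 : ℝ) < antidiagCard n₁ n₂ i := by exact_mod_cast antidiagCard_pos hn h₁ h₂ i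
    have hw' : ((Real.sqrt (antidiagCard n₁ n₂ i) : ℝ) : ℂ) ≠ 0 := by
      exact_mod_cast (Real.sqrt_pos.2 hw).ne'
    have e1 : measA B (liftGAdj n (hankelLift hn x)) i
        = ((Real.sqrt (antidiagCard n₁ n₂ i) : ℝ) : ℂ) * measA B x i := by
      rw [measA_apply, measA_apply, Finset.mul_sum]
      refine Finset.sum_congr rfl fun m _ => ?_
      rw [liftGAdj_hankelLift hn h₁ h₂]
      ring
    simp only [colUnscale, measAAdj, Matrix.of_apply, e1]
    rw [mul_assoc, inv_mul_cancel_left₀ hw']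
  rw [liftG, e]
  ext p k
  simp [hankelLift]

/-- Linear convergence of scaled gradient descent on the event that the sensing operator is nearly
isometric on the tangent space and the spectral initialization is accurate. -/
theorem scaledGD_converges (hn : n₁ + n₂ = n + 1) (h₁ : 0 < n₁) (h₂ : 0 < n₂)
    {B : Matrix (Fin n) (Fin s) ℂ} {μ₀ : ℝ} (hB : ∀ j l, ‖B j l‖ ^ 2 ≤ μ₀)
    (hα : 1 ≤ Real.sqrt (μ₀ * s)) {x : Matrix (Fin s) (Fin n) ℂ}
    {U : Matrix (Fin n₁ × Fin s) (Fin r) ℂ} {σ : Fin r → ℝ} {V : Matrix (Fin n₂) (Fin r) ℂ}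
    (h : IsCompactSVD (hankelLift hn x) U σ V) {σmin : ℝ} (hpos : 0 < σmin)
    (hσ : ∀ i, σmin ≤ σ i)
    (ht : ∀ X Y, IsTangent U V X → IsTangent U V Y →
      isoDefect B X Y ≤ 1 / 50 * (‖X‖ * ‖Y‖))
    {η : ℝ} (h0 : 0 < η) (h1 : η ≤ 1 / 4)
    {L₀ : Matrix (Fin n₁ × Fin s) (Fin r) ℂ} {R₀ : Matrix (Fin n₂) (Fin r) ℂ}
    (hinit : 200 * Real.sqrt (μ₀ * s) * ‖L₀ * R₀ᴴ - hankelLift hn x‖ ≤ σmin) (k : ℕ) :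
    let F := scaledGD hn B (measA B (liftGAdj n (hankelLift hn x))) η L₀ R₀
    IsUnit ((F k).1ᴴ * (F k).1) ∧ IsUnit ((F k).2ᴴ * (F k).2) ∧
      ‖estimate n (F k).1 (F k).2 - x‖ ^ 2 ≤ (1 - η / 25) ^ k * σmin ^ 2 := by
  intro F
  have hNI := nearIsometry_of_tangent hn h₁ h₂ hB ht
  set α := Real.sqrt (μ₀ * s) with hαdef
  have hq0 : 0 ≤ 1 - 2 / 5 * η := by linarith
  have hq1 : 1 - 2 / 5 * η ≤ 1 := by linarith
  have hind : ∀ k, ‖(F k).1 * (F k).2ᴴ - hankelLift hn x‖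
      ≤ (1 - 2 / 5 * η) ^ k * ‖L₀ * R₀ᴴ - hankelLift hn x‖ := by
    intro k
    induction k with
    | zero => rw [pow_zero, one_mul]; exact le_rfl
    | succ k ih =>
      have hd : 200 * α * ‖(F k).1 * (F k).2ᴴ - hankelLift hn x‖ ≤ σmin := by
        refine le_trans ?_ hinit
        refine mul_le_mul_of_nonneg_left (ih.trans ?_) (by positivity)
        exact mul_le_of_le_one_left (norm_nonneg _) (pow_le_one₀ hq0 hq1)
      have := scaled_step_contracts h hpos hσ hNI hα hd
        (reIP_gradCore_sub hn h₁ h₂ B x (F k).1 (F k).2) h0 h1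
      refine le_trans this ?_
      rw [pow_succ']
      rw [mul_assoc]
      exact mul_le_mul_of_nonneg_left ih hq0
  have hD0 : ‖L₀ * R₀ᴴ - hankelLift hn x‖ ≤ σmin / 200 := by
    rw [le_div_iff₀ (by norm_num)]
    nlinarith [norm_nonneg (L₀ * R₀ᴴ - hankelLift hn x)]
  have hk := hind k
  have hpk : (1 - 2 / 5 * η) ^ k ≤ 1 := pow_le_one₀ hq0 hq1
  have hlt : ‖(F k).1 * (F k).2ᴴ - hankelLift hn x‖ < σmin := by
    have := mul_le_of_le_one_left (norm_nonneg (L₀ * R₀ᴴ - hankelLift hn x)) hpk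
    linarith
  refine ⟨isUnit_gram_left h hpos.le hσ hlt, isUnit_gram_right h hpos.le hσ hlt, ?_⟩
  have h2 : ‖estimate n (F k).1 (F k).2 - x‖ ≤ (1 - 2 / 5 * η) ^ k * σmin := by
    refine (norm_estimate_sub_le hn h₁ h₂ _ _ x).trans (hk.trans ?_)
    gcongr
    linarith
  -- The rate in the conclusion is loose: `(1 - 2η/5)² ≤ 1 - η/25` for `0 < η ≤ 1/4`.
  calc ‖estimate n (F k).1 (F k).2 - x‖ ^ 2 ≤ ((1 - 2 / 5 * η) ^ k * σmin) ^ 2 := by gcongr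
    _ = ((1 - 2 / 5 * η) ^ 2) ^ k * σmin ^ 2 := by rw [mul_pow, ← pow_mul, ← pow_mul, mul_comm k]
    _ ≤ _ := by
      gcongr
      nlinarith

end Recovery

/-! ### The two random events and their numerical consequences. -/

section Events

variable {s n n₁ n₂ r : ℕ}

/-- The spanning atoms of the tangent space at `U Σ Vᴴ`. -/
noncomputable def tangentAtom (U : Matrix (Fin n₁ × Fin s) (Fin r) ℂ)
    (V : Matrix (Fin n₂) (Fin r) ℂ) :
    (Fin n₂ × Fin r) ⊕ ((Fin n₁ × Fin s) × Fin r) → Matrix (Fin n₁ × Fin s) (Fin n₂) ℂ :=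
  Sum.elim (leftAtom U) (rightAtom V)

/-- The bounds on the measurements of the tangent atoms. -/
noncomputable def tangentProfile (μ₀ : ℝ) (U : Matrix (Fin n₁ × Fin s) (Fin r) ℂ)
    (V : Matrix (Fin n₂) (Fin r) ℂ) :
    (Fin n₂ × Fin r) ⊕ ((Fin n₁ × Fin s) × Fin r) → Fin n → ℝ :=
  Sum.elim (leftProfile μ₀ U) (rightProfile μ₀ V)

theorem tangentProfile_nonneg {μ₀ : ℝ} (hμ : 0 ≤ μ₀) (U : Matrix (Fin n₁ × Fin s) (Fin r) ℂ)
    (V : Matrix (Fin n₂) (Fin r) ℂ) (i) (j : Fin n) : 0 ≤ tangentProfile μ₀ U V i j := by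
  rcases i with p | p
  · exact leftProfile_nonneg hμ U p j
  · exact rightProfile_nonneg hμ V p j

theorem norm_measA_tangentAtom_sq_le {B : Matrix (Fin n) (Fin s) ℂ} {μ₀ : ℝ}
    (hB : ∀ j l, ‖B j l‖ ^ 2 ≤ μ₀) (U : Matrix (Fin n₁ × Fin s) (Fin r) ℂ)
    (V : Matrix (Fin n₂) (Fin r) ℂ) (i) (j : Fin n) :
    ‖measA B (liftGAdj n (tangentAtom U V i)) j‖ ^ 2 ≤ tangentProfile μ₀ U V i j := by
  rcases i with p | p
  · exact norm_measA_leftAtom_sq_le hB U p j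
  · exact norm_measA_rightAtom_sq_le hB V p j

theorem isoDefect_le_of_atoms (hn : n₁ + n₂ = n + 1) (h₁ : 0 < n₁) (h₂ : 0 < n₂)
    {B : Matrix (Fin n) (Fin s) ℂ} {U : Matrix (Fin n₁ × Fin s) (Fin r) ℂ}
    {V : Matrix (Fin n₂) (Fin r) ℂ} (hU : Uᴴ * U = 1) (hV : Vᴴ * V = 1) {μ₀ μ₁ ℓ : ℝ}
    (hμ : 0 ≤ μ₀) (hμ₁ : 0 < μ₁) (hinc : Incoherent n μ₁ U V) (hℓ : 1 ≤ ℓ)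
    (hlog : Real.log n ≤ ℓ)
    (hS : 10 ^ 8 * (μ₀ ^ 2 * μ₁ * (s : ℝ) ^ 2 * (r : ℝ) ^ 2 * ℓ ^ 2) ≤ n)
    (hiso : ∀ i i', ‖measForm B (liftGAdj n (tangentAtom U V i)) (liftGAdj n (tangentAtom U V i'))‖
      ^ 2 ≤ 4 * (6 * ℓ) * ∑ j : Fin n, tangentProfile μ₀ U V i j * tangentProfile μ₀ U V i' j)
    {X Y : Matrix (Fin n₁ × Fin s) (Fin n₂) ℂ} (hX : IsTangent U V X) (hY : IsTangent U V Y) :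
    isoDefect B X Y ≤ 1 / 50 * (‖X‖ * ‖Y‖) := by
  have hn0 : (0 : ℝ) < n := by exact_mod_cast (by omega : 0 < n)
  refine (isoDefect_tangent_le hn h₁ h₂ hU hV hμ hμ₁ hinc (T := 4 * (6 * ℓ)) (by linarith)
    (fun p p' => hiso (.inl p) (.inl p')) (fun p p' => hiso (.inl p) (.inr p'))
    (fun p p' => hiso (.inr p) (.inr p')) hX hY).trans ?_
  refine mul_le_mul_of_nonneg_right ?_ (by positivity)
  -- With `log n ≤ ℓ` and `1 ≤ ℓ`, `2 (1 + log n) + 8 ≤ 12 ℓ`, and `24 · 12 = 288`. The target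
  -- `(1/200)²` leaves `4 · 1/200 = 1/50`.
  have h1 : 4 * (6 * ℓ) * (μ₀ * s) ^ 2 * (μ₁ * r / n * (r * (2 * (1 + Real.log n) + 8)))
      ≤ (1 / 200) ^ 2 := by
    calc 4 * (6 * ℓ) * (μ₀ * s) ^ 2 * (μ₁ * r / n * (r * (2 * (1 + Real.log n) + 8)))
        ≤ 4 * (6 * ℓ) * (μ₀ * s) ^ 2 * (μ₁ * r / n * (r * (12 * ℓ))) := by
          gcongr
          linarith
      _ = 288 / 10 ^ 8 * (10 ^ 8 * (μ₀ ^ 2 * μ₁ * (s : ℝ) ^ 2 * (r : ℝ) ^ 2 * ℓ ^ 2)) / n := by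
          ring
      _ ≤ 288 / 10 ^ 8 * n / n := by gcongr
      _ = 288 / 10 ^ 8 := by field_simp
      _ ≤ _ := by norm_num
  have h2 := Real.sqrt_le_sqrt h1
  rw [Real.sqrt_sq (by norm_num)] at h2
  linarith

/-- Accuracy of the spectral initialization on the event that the symbol of the error is small. -/
theorem norm_init_sub_le (hn : n₁ + n₂ = n + 1) (h₁ : 0 < n₁) (h₂ : 0 < n₂)
    {B : Matrix (Fin n) (Fin s) ℂ} {x : Matrix (Fin s) (Fin n) ℂ}
    {U : Matrix (Fin n₁ × Fin s) (Fin r) ℂ} {σ : Fin r → ℝ} {V : Matrix (Fin n₂) (Fin r) ℂ}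
    (h : IsCompactSVD (hankelLift hn x) U σ V) {ζ : ℂ} (hζ : IsPrimitiveRoot ζ n)
    {μ₀ μ₁ ℓ σmax σmin : ℝ} (hμ : 1 ≤ μ₀) (hμ₁ : 0 < μ₁) (hℓ : 1 ≤ ℓ) (hmin : 0 < σmin)
    (hS : 10 ^ 8 * (μ₀ ^ 2 * μ₁ * (s : ℝ) ^ 2 * (r : ℝ) ^ 2 * ℓ ^ 2) * σmax ^ 2 ≤ n * σmin ^ 2)
    (hsym : ∀ (t : Fin n) (l : Fin s),
      ‖∑ j : Fin n, (measAAdj B (measA B x) - x) l j * ζ ^ ((t : ℕ) * (j : ℕ))‖ ^ 2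
        ≤ 32 * (2 * μ₀ * (σmax ^ 2 * (μ₁ * r / n))) * ℓ)
    {U₀ : Matrix (Fin n₁ × Fin s) (Fin r) ℂ} {σ₀ : Fin r → ℝ} {V₀ : Matrix (Fin n₂) (Fin r) ℂ}
    (h₀ : IsTopSVD (liftG hn (measAAdj B (measA B (liftGAdj n (hankelLift hn x))))) U₀ σ₀ V₀) :
    200 * Real.sqrt (μ₀ * s) * ‖mulSqrt U₀ σ₀ * (mulSqrt V₀ σ₀)ᴴ - hankelLift hn x‖ ≤ σmin := by
  have hn0 : (0 : ℝ) < n := by exact_mod_cast (by omega : 0 < n)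
  set w := 32 * (2 * μ₀ * (σmax ^ 2 * (μ₁ * r / n))) * ℓ with hw
  have hw0 : 0 ≤ w := by positivity
  have h1 := norm_topSVD_sub_le h (Real.sqrt_nonneg (s * w)) (fun k X => by
    rw [liftG_measAAdj_sub hn h₁ h₂]
    refine norm_hankelLift_mul_le hn h₁ h₂ hζ _ (Real.sqrt_nonneg _) (fun t => ?_) X
    rw [Real.sq_sqrt (by positivity)]
    exact (Finset.sum_le_sum fun l _ => hsym t l).trans_eq (by simp)) h₀
  have h2 : 200 * Real.sqrt (μ₀ * s) * (4 * Real.sqrt (s * w) * Real.sqrt r) ≤ σmin := by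
    have e : 200 * Real.sqrt (μ₀ * s) * (4 * Real.sqrt (s * w) * Real.sqrt r)
        = 800 * Real.sqrt (μ₀ * s * (s * w) * r) := by
      rw [Real.sqrt_mul (x := μ₀ * s * (s * w)) (by positivity),
        Real.sqrt_mul (x := μ₀ * s) (by positivity)]
      ring
    rw [e]
    -- One factor `s` sums the coordinates of the symbol, the other comes from the basin radius, and
    -- `r` from truncation; `800 = 200 · 4`.
    have h3 : μ₀ * s * (s * w) * r ≤ (σmin / 800) ^ 2 := by
      calc μ₀ * s * (s * w) * r
          = 64 * ((μ₀ ^ 2 * μ₁ * (s : ℝ) ^ 2 * (r : ℝ) ^ 2 * (ℓ * 1)) * σmax ^ 2) / n := by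
            rw [hw]; ring
        _ ≤ 64 * ((μ₀ ^ 2 * μ₁ * (s : ℝ) ^ 2 * (r : ℝ) ^ 2 * (ℓ * ℓ)) * σmax ^ 2) / n := by
            gcongr
        _ = 64 / 10 ^ 8 *
            (10 ^ 8 * (μ₀ ^ 2 * μ₁ * (s : ℝ) ^ 2 * (r : ℝ) ^ 2 * ℓ ^ 2) * σmax ^ 2) / n := by ring
        _ ≤ 64 / 10 ^ 8 * (n * σmin ^ 2) / n := by gcongr
        _ = 64 / 10 ^ 8 * σmin ^ 2 := by field_simp
        _ ≤ _ := by
            rw [div_pow]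
            nlinarith [sq_nonneg σmin]
    have h4 := Real.sqrt_le_sqrt h3
    rw [Real.sqrt_sq (by positivity)] at h4
    linarith
  refine le_trans ?_ h2
  gcongr

variable {Ω : Type*} [MeasurableSpace Ω] {P : Measure Ω} [IsProbabilityMeasure P]
  {B : Ω → Matrix (Fin n) (Fin s) ℂ} {μ₀ : ℝ}

theorem RandomSubspace.atoms_tail (hB : RandomSubspace P B μ₀) (hμ : 0 ≤ μ₀)
    (U : Matrix (Fin n₁ × Fin s) (Fin r) ℂ) (V : Matrix (Fin n₂) (Fin r) ℂ) {a : ℝ} (ha : 0 ≤ a) :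
    P.real (⋃ q : ((Fin n₂ × Fin r) ⊕ ((Fin n₁ × Fin s) × Fin r)) ×
        ((Fin n₂ × Fin r) ⊕ ((Fin n₁ × Fin s) × Fin r)),
      {ω | 4 * a * ∑ j : Fin n, tangentProfile μ₀ U V q.1 j * tangentProfile μ₀ U V q.2 j <
        ‖measForm (B ω) (liftGAdj n (tangentAtom U V q.1)) (liftGAdj n (tangentAtom U V q.2))‖ ^ 2})
      ≤ ((n₂ * r + n₁ * s * r : ℕ) : ℝ) ^ 2 * (4 * Real.exp (-a)) := by
  have htail := fun q : ((Fin n₂ × Fin r) ⊕ ((Fin n₁ × Fin s) × Fin r)) ×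
      ((Fin n₂ × Fin r) ⊕ ((Fin n₁ × Fin s) × Fin r)) =>
    hB.measForm_tail (liftGAdj n (tangentAtom U V q.1)) (liftGAdj n (tangentAtom U V q.2))
      (N := tangentProfile μ₀ U V q.1) (N' := tangentProfile μ₀ U V q.2)
      (tangentProfile_nonneg hμ U V q.1) (tangentProfile_nonneg hμ U V q.2)
      (fun B₀ h => norm_measA_tangentAtom_sq_le h U V q.1)
      (fun B₀ h => norm_measA_tangentAtom_sq_le h U V q.2) ha
  refine ((measureReal_iUnion_fintype_le _).trans
    (Finset.sum_le_sum fun q _ => htail q)).trans_eq ?_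
  rw [Finset.sum_const, Finset.card_univ, nsmul_eq_mul]
  congr 1
  simp only [Fintype.card_prod, Fintype.card_sum, Fintype.card_fin]
  push_cast
  ring

theorem RandomSubspace.symbols_tail (hB : RandomSubspace P B μ₀) (hμ : 1 ≤ μ₀)
    (hn : n₁ + n₂ = n + 1) (h₁ : 0 < n₁) (h₂ : 0 < n₂) (hr : 0 < r) {x : Matrix (Fin s) (Fin n) ℂ}
    {U : Matrix (Fin n₁ × Fin s) (Fin r) ℂ} {σ : Fin r → ℝ} {V : Matrix (Fin n₂) (Fin r) ℂ}
    (h : IsSVD (hankelLift hn x) U σ V) {μ₁ ℓ σmax : ℝ} (hσ : ∀ i, σ i ≤ σmax) (hmax : 0 < σmax)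
    (hμ₁ : 0 < μ₁) (hinc : Incoherent n μ₁ U V) (hℓ : 1 ≤ ℓ)
    (hS : 2 * (μ₀ * μ₁ * s * r * ℓ) ≤ n) {ζ : ℂ} (hζ : ‖ζ‖ = 1) :
    P.real (⋃ q : Fin n × Fin s,
      {ω | 32 * (2 * μ₀ * (σmax ^ 2 * (μ₁ * r / n))) * ℓ <
        ‖∑ j : Fin n, (measAAdj (B ω) (measA (B ω) x) - x) q.2 j *
          ζ ^ ((q.1 : ℕ) * (j : ℕ))‖ ^ 2})
      ≤ ((s : ℝ) * n) * (4 * Real.exp (-(3 * ℓ))) := by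
  have hn0 : (0 : ℝ) < n := by exact_mod_cast (by omega : 0 < n)
  have hr0 : (0 : ℝ) < r := by exact_mod_cast hr
  have hβ : 0 < μ₁ * r / n := by positivity
  set v := 2 * μ₀ * (σmax ^ 2 * (μ₁ * r / n)) with hv
  have hv0 : 0 < v := by positivity
  have hσ' : ∀ i, |σ i| ≤ σmax := fun i => by rw [abs_of_nonneg (h.nonneg i)]; exact hσ i
  -- This choice makes `lam² v = ℓ` and `lam t = 4 ℓ`, so the exponent is `-3 ℓ`; the sample size
  -- ensures `2 lam M ≤ 1`.
  set lam := Real.sqrt (ℓ / v) with hlam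
  set t := 4 * Real.sqrt (v * ℓ) with ht
  have e1 : lam * t = 4 * ℓ := by
    rw [hlam, ht, mul_left_comm, ← Real.sqrt_mul (by positivity)]
    rw [show ℓ / v * (v * ℓ) = ℓ ^ 2 by field_simp, Real.sqrt_sq (by positivity)]
  have e2 : lam ^ 2 * v = ℓ := by
    rw [hlam, Real.sq_sqrt (by positivity)]
    field_simp
  have e3 : 2 * t ^ 2 = 32 * v * ℓ := by
    rw [ht, mul_pow, Real.sq_sqrt (by positivity)]
    ring
  have e4 : lam * (2 * (μ₀ * (Real.sqrt s * (σmax * (μ₁ * r / n))))) ≤ 1 := by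
    refine (sq_le_sq₀ (by positivity) zero_le_one).1 ?_
    calc (lam * (2 * (μ₀ * (Real.sqrt s * (σmax * (μ₁ * r / n)))))) ^ 2
        = lam ^ 2 * (Real.sqrt s ^ 2) * (4 * μ₀ ^ 2 * σmax ^ 2 * (μ₁ * r / n) ^ 2) := by ring
      _ = (lam ^ 2 * v) * (s * (2 * μ₀ * (μ₁ * r / n))) := by
          rw [Real.sq_sqrt (Nat.cast_nonneg s), hv]
          ring
      _ = 2 * (μ₀ * μ₁ * s * r * ℓ) / n := by rw [e2]; ring
      _ ≤ 1 ^ 2 := by rw [one_pow, div_le_one hn0]; exact hS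
  have htail := fun q : Fin n × Fin s =>
    hB.symbol_tail x (w := fun j => ζ ^ ((q.1 : ℕ) * (j : ℕ))) (fun j => by simp [hζ]) q.2
      (M := μ₀ * (Real.sqrt s * (σmax * (μ₁ * r / n)))) (v := v) (t := t) (lam := lam)
      (fun j => by
        gcongr
        rw [Real.sqrt_mul (Nat.cast_nonneg s)]
        gcongr
        exact (Real.sqrt_le_left (by positivity)).2
          (sum_signal_col_sq_le hn h₁ h₂ h hmax.le hσ' hinc j))
      (by
        rw [hv, mul_comm 2 μ₀, mul_assoc]
        gcongr
        exact norm_signal_sq_le hn h₁ h₂ h hmax.le hσ' hinc)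
      (Real.sqrt_nonneg _) e4
  rw [← e3]
  refine ((measureReal_iUnion_fintype_le _).trans
    (Finset.sum_le_sum fun q _ => htail q)).trans_eq ?_
  rw [Finset.sum_const, Finset.card_univ, nsmul_eq_mul, neg_mul, e1, e2]
  simp only [Fintype.card_prod, Fintype.card_fin]
  push_cast
  rw [show -(4 * ℓ) + ℓ = -(3 * ℓ) by ring]
  ring

end Events

/-! ### Union bound and assembly. -/

section Main

/-- Orthonormal singular vectors with `r ≥ 1` force `n₁, n₂, s ≥ 1`, so positivity of the dimensions
need not be assumed. -/
theorem nonempty_of_isometry {m : Type*} [Fintype m] {r : ℕ} (hr : 0 < r)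
    {A : Matrix m (Fin r) ℂ} (hA : Aᴴ * A = 1) : Nonempty m := by
  by_contra hm
  rw [not_nonempty_iff] at hm
  have := congrFun (congrFun hA ⟨0, hr⟩) ⟨0, hr⟩
  simp [Matrix.mul_apply] at this

theorem le_card_of_isometry {m : Type*} [Fintype m] {r : ℕ}
    {A : Matrix m (Fin r) ℂ} (hA : Aᴴ * A = 1) : r ≤ Fintype.card m := by
  have h1 : (Aᴴ * A).rank = r := by rw [hA, Matrix.rank_one, Fintype.card_fin]
  rw [← h1]
  exact (Matrix.rank_mul_le_right _ _).trans (Matrix.rank_le_card_height A)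

variable {s n n₁ n₂ r : ℕ} {Ω : Type*} [MeasurableSpace Ω] {P : Measure Ω}
  [IsProbabilityMeasure P] {B : Ω → Matrix (Fin n) (Fin s) ℂ} {μ₀ : ℝ}

/-- The complement of a measurable hull of the bad set; measurability of the bad events themselves
is then not needed. -/
theorem exists_measurableSet_compl_le {bad : Set Ω} {ε : ℝ} (h : P.real bad ≤ ε) :
    ∃ E : Set Ω, MeasurableSet E ∧ 1 - ε ≤ P.real E ∧ ∀ ω ∈ E, ω ∉ bad := by
  refine ⟨(toMeasurable P bad)ᶜ, (measurableSet_toMeasurable P bad).compl, ?_,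
    fun ω hω hb => hω (subset_toMeasurable P bad hb)⟩
  rw [probReal_compl_eq_one_sub (measurableSet_toMeasurable P bad), Measure.real,
    measure_toMeasurable]
  exact sub_le_sub_left h 1

theorem exp_neg_nat_mul_log {x : ℝ} (hx : 0 < x) (k : ℕ) :
    Real.exp (-(k * Real.log x)) = (x ^ k)⁻¹ := by
  rw [Real.exp_neg, ← Real.log_pow, Real.exp_log (by positivity)]

/-- Exact recovery with explicit constants. -/
theorem RandomSubspace.exact_recovery (hB : RandomSubspace P B μ₀) (hn : n₁ + n₂ = n + 1)
    (hr : 0 < r) {x : Matrix (Fin s) (Fin n) ℂ}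
    {U : Matrix (Fin n₁ × Fin s) (Fin r) ℂ} {σ : Fin r → ℝ} {V : Matrix (Fin n₂) (Fin r) ℂ}
    (h : IsCompactSVD (hankelLift hn x) U σ V) {μ₁ σmax σmin : ℝ} (hmin : 0 < σmin)
    (hmin' : ∀ i, σmin ≤ σ i) (hmax : ∀ i, σ i ≤ σmax) (hμ₁ : 0 < μ₁)
    (hinc : Incoherent n μ₁ U V)
    (hS : 10 ^ 8 * (μ₀ ^ 2 * μ₁ * (s : ℝ) ^ 2 * (r : ℝ) ^ 2 * Real.log ((s : ℝ) * n) ^ 2)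
      * σmax ^ 2 ≤ n * σmin ^ 2) :
    ∃ E : Set Ω, MeasurableSet E ∧ 1 - 20 * ((s : ℝ) * n) ^ (-2 : ℝ) ≤ P.real E ∧
      ∀ ω ∈ E, ∀ (U₀ : Matrix (Fin n₁ × Fin s) (Fin r) ℂ) (σ₀ : Fin r → ℝ)
        (V₀ : Matrix (Fin n₂) (Fin r) ℂ),
        IsTopSVD (liftG hn (measAAdj (B ω) (measA (B ω) (liftGAdj n (hankelLift hn x)))))
          U₀ σ₀ V₀ → ∀ η : ℝ, 0 < η → η ≤ 1 / 4 → ∀ k : ℕ,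
        let F := scaledGD hn (B ω) (measA (B ω) (liftGAdj n (hankelLift hn x))) η
          (mulSqrt U₀ σ₀) (mulSqrt V₀ σ₀)
        IsUnit ((F k).1ᴴ * (F k).1) ∧ IsUnit ((F k).2ᴴ * (F k).2) ∧
          ‖estimate n (F k).1 (F k).2 - x‖ ^ 2 ≤ (1 - η / 25) ^ k * σmin ^ 2 := by
  have hU := h.1.left_orthonormal
  have hV := h.1.right_orthonormal
  obtain ⟨⟨a₀, l₀⟩⟩ := nonempty_of_isometry hr hU
  obtain ⟨k₀⟩ := nonempty_of_isometry hr hV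
  have h₁ : 0 < n₁ := a₀.pos
  have h₂ : 0 < n₂ := k₀.pos
  have hs : 0 < s := l₀.pos
  have hn0 : 0 < n := by omega
  have hrn : r ≤ n := (le_card_of_isometry hV).trans (by rw [Fintype.card_fin]; omega)
  have hμ : 1 ≤ μ₀ := hB.one_le ⟨0, hn0⟩ l₀
  have hs1 : (1 : ℝ) ≤ s := by exact_mod_cast hs
  have hr1 : (1 : ℝ) ≤ r := by exact_mod_cast hr
  have hnR : (0 : ℝ) < n := by exact_mod_cast hn0
  set z : ℝ := (s : ℝ) * n with hz
  have hz0 : 0 < z := by positivity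
  have hz2 : z ^ (-2 : ℝ) = (z ^ 2)⁻¹ := by
    rw [Real.rpow_neg hz0.le]
    norm_cast
  -- For `z² ≤ 20` the claimed probability is at most `0` and the empty event will do; otherwise `z
  -- > e`, so `ℓ ≥ 1`.
  rcases le_or_gt (z ^ 2) 20 with hz20 | hz20
  · refine ⟨∅, MeasurableSet.empty, ?_, by simp⟩
    rw [measureReal_empty, hz2, ← div_eq_mul_inv, sub_nonpos, le_div_iff₀ (by positivity)]
    linarith
  set ℓ := Real.log z with hℓdef
  have hℓ : 1 ≤ ℓ := by
    rw [hℓdef, Real.le_log_iff_exp_le hz0]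
    have := Real.exp_one_lt_d9
    nlinarith
  have hlog : Real.log n ≤ ℓ := by
    refine Real.log_le_log hnR ?_
    rw [hz]
    nlinarith
  have hmm : σmin ≤ σmax := (hmin' ⟨0, hr⟩).trans (hmax _)
  have hmax0 : 0 < σmax := hmin.trans_le hmm
  set q := μ₀ ^ 2 * μ₁ * (s : ℝ) ^ 2 * (r : ℝ) ^ 2 * ℓ ^ 2 with hq
  have hq0 : 0 ≤ q := by positivity
  have hS1 : 10 ^ 8 * q ≤ n := by
    have : 10 ^ 8 * q * σmin ^ 2 ≤ n * σmin ^ 2 := le_trans (by gcongr) hS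
    exact le_of_mul_le_mul_right this (by positivity)
  have hS2 : 2 * (μ₀ * μ₁ * s * r * ℓ) ≤ n := by
    have : μ₀ * μ₁ * s * r * ℓ ≤ q := by
      have e1 : μ₀ ≤ μ₀ ^ 2 := le_self_pow₀ hμ two_ne_zero
      have e2 : (s : ℝ) ≤ (s : ℝ) ^ 2 := le_self_pow₀ hs1 two_ne_zero
      have e3 : (r : ℝ) ≤ (r : ℝ) ^ 2 := le_self_pow₀ hr1 two_ne_zero
      have e4 : ℓ ≤ ℓ ^ 2 := le_self_pow₀ hℓ two_ne_zero
      rw [hq]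
      gcongr
    linarith
  set ζ : ℂ := Complex.exp (2 * Real.pi * Complex.I / n) with hζdef
  have hζ : IsPrimitiveRoot ζ n := Complex.isPrimitiveRoot_exp n hn0.ne'
  have hζ1 : ‖ζ‖ = 1 := hζ.norm'_eq_one hn0.ne'
  have t1 := hB.ae_bounded
  rw [ae_iff] at t1
  -- `6 ℓ` makes each tail `4 z⁻⁶`, which beats the at most `4 z⁴` pairs of atoms: `16 z⁻²`. The
  -- symbols contribute `z · 4 z⁻³ = 4 z⁻²`, for a total of `20 z⁻²`.
  have t2 := hB.atoms_tail (by linarith) U V (a := 6 * ℓ) (by linarith)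
  have t3 := hB.symbols_tail hμ hn h₁ h₂ hr h.1 hmax hmax0 hμ₁ hinc hℓ hS2 hζ1
  set bad₁ := {ω | ¬ ∀ j l, ‖B ω j l‖ ^ 2 ≤ μ₀} with hbad₁
  set bad₂ := ⋃ q : ((Fin n₂ × Fin r) ⊕ ((Fin n₁ × Fin s) × Fin r)) ×
        ((Fin n₂ × Fin r) ⊕ ((Fin n₁ × Fin s) × Fin r)),
      {ω | 4 * (6 * ℓ) * ∑ j : Fin n, tangentProfile μ₀ U V q.1 j * tangentProfile μ₀ U V q.2 j <
        ‖measForm (B ω) (liftGAdj n (tangentAtom U V q.1))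
          (liftGAdj n (tangentAtom U V q.2))‖ ^ 2} with hbad₂
  set bad₃ := ⋃ q : Fin n × Fin s,
      {ω | 32 * (2 * μ₀ * (σmax ^ 2 * (μ₁ * r / n))) * ℓ <
        ‖∑ j : Fin n, (measAAdj (B ω) (measA (B ω) x) - x) q.2 j *
          ζ ^ ((q.1 : ℕ) * (j : ℕ))‖ ^ 2} with hbad₃
  have hbad : P.real (bad₁ ∪ bad₂ ∪ bad₃) ≤ 20 * z ^ (-2 : ℝ) := by
    have u1 := measureReal_union_le (μ := P) (bad₁ ∪ bad₂) bad₃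
    have u2 := measureReal_union_le (μ := P) bad₁ bad₂
    have u3 : P.real bad₁ = 0 := by rw [Measure.real, t1, ENNReal.toReal_zero]
    have c1 : ((n₂ * r + n₁ * s * r : ℕ) : ℝ) ≤ 2 * z ^ 2 := by
      have : n₂ * r + n₁ * s * r ≤ 2 * (s * n) ^ 2 := by
        have e1 : n₂ * r ≤ (s * n) * (s * n) :=
          Nat.mul_le_mul (by nlinarith) (by nlinarith)
        have e2 : n₁ * s * r ≤ (s * n) * (s * n) :=
          Nat.mul_le_mul (by rw [mul_comm s]; exact Nat.mul_le_mul_right _ (by omega))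
            (by nlinarith)
        linarith
      rw [hz]
      exact_mod_cast this
    have x6 : Real.exp (-(6 * ℓ)) = (z ^ 6)⁻¹ := by
      have := exp_neg_nat_mul_log hz0 6
      exact_mod_cast this
    have x3 : Real.exp (-(3 * ℓ)) = (z ^ 3)⁻¹ := by
      have := exp_neg_nat_mul_log hz0 3
      exact_mod_cast this
    have v2 : P.real bad₂ ≤ 16 * (z ^ 2)⁻¹ := by
      refine t2.trans ?_
      rw [x6]
      calc ((n₂ * r + n₁ * s * r : ℕ) : ℝ) ^ 2 * (4 * (z ^ 6)⁻¹)
          ≤ (2 * z ^ 2) ^ 2 * (4 * (z ^ 6)⁻¹) := by gcongr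
        _ = 16 * (z ^ 2)⁻¹ := by field_simp; ring
    have v3 : P.real bad₃ ≤ 4 * (z ^ 2)⁻¹ := by
      refine t3.trans_eq ?_
      rw [x3, ← hz]
      field_simp
    rw [hz2]
    linarith
  obtain ⟨E, hE, hPE, hEb⟩ := exists_measurableSet_compl_le hbad
  refine ⟨E, hE, hPE, fun ω hω U₀ σ₀ V₀ h₀ η hη0 hη1 k => ?_⟩
  have hω' := hEb ω hω
  simp only [Set.mem_union, not_or, hbad₁, hbad₂, hbad₃, Set.mem_iUnion, Set.mem_ofPred_eq,
    not_exists, not_lt, not_not] at hω'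
  obtain ⟨⟨w1, w2⟩, w3⟩ := hω'
  refine scaledGD_converges hn h₁ h₂ w1 ?_ h hmin hmin' (fun X Y hX hY => ?_) hη0 hη1 ?_ k
  · rw [Real.one_le_sqrt]
    nlinarith
  · exact isoDefect_le_of_atoms hn h₁ h₂ hU hV (by linarith) hμ₁ hinc hℓ hlog hS1
      (fun i i' => w2 (i, i')) hX hY
  · exact norm_init_sub_le hn h₁ h₂ h hζ hμ hμ₁ hℓ hmin hS (fun t l => w3 (t, l)) h₀

end Main

end BlindSR

theorem theorem2 :
    ∃ C c₁ c₂ : ℝ, 0 < C ∧ 0 < c₁ ∧ 0 < c₂ ∧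
      ∀ (n n₁ n₂ s r : ℕ) (hn : n₁ + n₂ = n + 1) (hr : 0 < r)
        -- signal: amplitudes, locations, and subspace coefficients of the point spread functions
        (d : Fin r → ℂ) (τ : Fin r → ℝ) (h : Fin r → Fin s → ℂ)
        -- compact SVD of `M⋆ = ℋ(X⋆)` (so `rank M⋆ = r`), with incoherent singular vectors
        (U : Matrix (Fin n₁ × Fin s) (Fin r) ℂ) (σ : Fin r → ℝ) (V : Matrix (Fin n₂) (Fin r) ℂ)
        (_ : IsCompactSVD (hankelLift hn (signalMatrix n d τ h)) U σ V)
        (μ₀ μ₁ : ℝ) (_ : 0 < μ₁) (_ : Incoherent n μ₁ U V)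
        -- random subspace
        (Ω : Type*) (_ : MeasurableSpace Ω) (P : Measure Ω) (_ : IsProbabilityMeasure P)
        (B : Ω → Matrix (Fin n) (Fin s) ℂ) (_ : RandomSubspace P B μ₀)
        -- step size and sample complexity
        (η δ₀ : ℝ) (_ : 0 < η) (_ : η ≤ 1 / 4) (_ : 0 < δ₀) (_ : δ₀ ≤ 1 / 10)
        (_ : C * (δ₀ ^ 2)⁻¹ * μ₀ ^ 2 * μ₁ * (s : ℝ) ^ 2 * (r : ℝ) ^ 2 *
            (σ ⟨0, hr⟩ / σ ⟨r - 1, Nat.sub_lt hr Nat.one_pos⟩) ^ 2 *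
            Real.log ((s : ℝ) * n) ^ 2 ≤ n),
        ∃ E : Set Ω, MeasurableSet E ∧
          1 - c₁ * ((s : ℝ) * n) ^ (-c₂) ≤ P.real E ∧
          ∀ ω ∈ E,
            let y := weighted n₁ n₂ (samples (B ω) d τ h)
            ∀ (U₀ : Matrix (Fin n₁ × Fin s) (Fin r) ℂ) (σ₀ : Fin r → ℝ)
              (V₀ : Matrix (Fin n₂) (Fin r) ℂ),
              IsTopSVD (liftG hn (measAAdj (B ω) y)) U₀ σ₀ V₀ →
              let F := scaledGD hn (B ω) y η (mulSqrt U₀ σ₀) (mulSqrt V₀ σ₀)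
              ∀ k : ℕ,
                -- the preconditioners are well defined
                IsUnit ((F k).1ᴴ * (F k).1) ∧ IsUnit ((F k).2ᴴ * (F k).2) ∧
                ‖estimate n (F k).1 (F k).2 - signalMatrix n d τ h‖ ^ 2 ≤
                  (1 - η / 25) ^ k * σ ⟨r - 1, Nat.sub_lt hr Nat.one_pos⟩ ^ 2 := by
  refine ⟨10 ^ 6, 20, 2, by norm_num, by norm_num, by norm_num, ?_⟩
  intro n n₁ n₂ s r hn hr d τ h U σ V hsvd μ₀ μ₁ hμ₁ hinc Ω _ P _ B hB η δ₀ hη0 hη1 hδ0 hδ1 hC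
  have hlast := hsvd.2 ⟨r - 1, Nat.sub_lt hr Nat.one_pos⟩
  have hS : 10 ^ 8 * (μ₀ ^ 2 * μ₁ * (s : ℝ) ^ 2 * (r : ℝ) ^ 2 * Real.log ((s : ℝ) * n) ^ 2)
      * σ ⟨0, hr⟩ ^ 2 ≤ n * σ ⟨r - 1, Nat.sub_lt hr Nat.one_pos⟩ ^ 2 := by
    -- Since `δ₀ ≤ 1/10`, the factor `δ₀⁻²` raises `C = 10⁶` to the `10⁸` required by the explicit
    -- version.
    have hδ : (100 : ℝ) ≤ (δ₀ ^ 2)⁻¹ := by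
      rw [le_inv_comm₀ (by norm_num) (by positivity)]
      nlinarith
    rw [← div_le_iff₀ (by positivity)]
    refine le_trans ?_ hC
    calc 10 ^ 8 * (μ₀ ^ 2 * μ₁ * (s : ℝ) ^ 2 * (r : ℝ) ^ 2 * Real.log ((s : ℝ) * n) ^ 2)
          * σ ⟨0, hr⟩ ^ 2 / σ ⟨r - 1, Nat.sub_lt hr Nat.one_pos⟩ ^ 2
        = 10 ^ 6 * 100 * μ₀ ^ 2 * μ₁ * (s : ℝ) ^ 2 * (r : ℝ) ^ 2 *
            (σ ⟨0, hr⟩ / σ ⟨r - 1, Nat.sub_lt hr Nat.one_pos⟩) ^ 2 *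
            Real.log ((s : ℝ) * n) ^ 2 := by
          rw [div_pow]
          ring
      _ ≤ _ := by gcongr
  obtain ⟨E, hE, hPE, hrec⟩ := hB.exact_recovery hn hr hsvd hlast
    (fun i => hsvd.1.antitone (Fin.le_def.2 (Nat.le_sub_one_of_lt i.2)))
    (fun i => hsvd.1.antitone (Fin.le_def.2 (Nat.zero_le _))) hμ₁ hinc hS
  obtain ⟨⟨a₀, _⟩⟩ := nonempty_of_isometry hr hsvd.1.left_orthonormal
  obtain ⟨k₀⟩ := nonempty_of_isometry hr hsvd.1.right_orthonormal
  refine ⟨E, hE, hPE, fun ω hω => ?_⟩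
  intro y U₀ σ₀ V₀ h₀ F k
  have hy : y = measA (B ω) (liftGAdj n (hankelLift hn (signalMatrix n d τ h))) :=
    weighted_samples hn a₀.pos k₀.pos (B ω) d τ h
  have := hrec ω hω U₀ σ₀ V₀ (hy ▸ h₀) η hη0 hη1 k
  rw [← hy] at this
  exact this
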